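/- **Setting.** Let $G$ be a connected complex reductive group with Lie algebra $\mathfrak g$, and let $S\in\mathfrak g$ be semisimple. Let $0<p<q$ be coprime integers and put $f=x^p-y^q$, $E=qx\,\partial_x+py\,\partial_y$, $V=qy^{q-1}\partial_x+px^{p-1}\partial_y$, $w_0=pq-p-q$. Let $\alpha_0=\frac1{pq}d\log f,\ \beta$ be the basis of logarithmic one-forms dual to $E,V$. Write $\mathcal O_w$ for the polynomials of weight $w$, where $|x|=q$ and $|y|=p$, and $\mathfrak g_\lambda$ for the $\lambda$-eigenspace of $\mathrm{ad}_S$ on $\mathfrak g$ (zero if $\lambda$ is not an eigenvalue). Put $$U_0^0=\bigoplus_{w\ge0}\mathcal O_w\otimes\mathfrak g_{-w},\qquad U_0^1=\bigoplus_{w\ge0}\mathcal O_w\otimes\mathfrak g_{w_0-w}\,\beta,\qquad \delta_S(u)=V(u)\,\beta,$$ and let $H^\bullet(U_0)\subseteq U_0^\bullet$ be the subspaces $$H^0(U_0)=\bigoplus_{c\ge0}f^c\,\mathfrak g_{-cpq},\qquad H^1(U_0)=\bigoplus_{c\ge0}\ \bigoplus_{0\le a<p-1,\;0\le b<q-1}f^cx^ay^b\,\mathfrak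 g_{w_0-cpq-aq-bp}\,\beta.$$ Let $\mathrm{Aut}(S)$ be the group of holomorphic maps $g:\mathbb C^2\to G$ with $gSg^{-1}-E(g)g^{-1}=S$, acting on $U_0^1$ by $g*\gamma=g\gamma g^{-1}-V(g)g^{-1}\beta$. Write $S=a+ib$ with $a,b$ the real and imaginary parts of $S$ (commuting semisimple elements with real eigenvalues), and let $$P_S=C_G\bigl(e^{-2\pi iS/(pq)}\bigr)\cap P\bigl(\tfrac{-a}{pq}\bigr),$$ where $P(a')=\{h\in G: z^{a'}hz^{-a'}\text{ has a limit in }G\text{ as }z\to0\text{ along any ray}\}$. Then $P_S$ embeds in $\mathrm{Aut}(S)$ by $h\mapsto\varphi_h\circ f$, where $\varphi_h:\mathbb C\to G$ is the holomorphic automorphism of the connection $d+\frac1{pq}S\,d\log z$ with $\varphi_h(1)=h$, and the gauge action of $P_S$ preserves $H^1(U_0)$. **Proposition.** Suppose that every positive integer eigenvalue of $\mathrm{ad}_S$ on $\mathfrak g$ is strictly greater than $w_0$. Then the inclusion of action groupoids $$P_S\ltimes H^1(U_0)\ \subseteq\ \mathrm{Aut}(S)\ltimes U_0^1$$ is a Morita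 equivalence of Lie groupoids: it is fully faithful, every $\mathrm{Aut}(S)$-orbit in $U_0^1$ meets $H^1(U_0)$, and the action map $\mathrm{Aut}(S)\times H^1(U_0)\to U_0^1$ is a submersion. Moreover, for every $\gamma\in H^1(U_0)$ the inclusion $(H^\bullet(U_0),\mathrm{ad}_\gamma)\to(U_0^\bullet,\delta_S+\mathrm{ad}_\gamma)$ is a quasi-isomorphism. -/

import Mathlib

namespace PlaneCurve

open Matrix Set Filter Topology

section LieGroups


variable {n : ℕ}

/-- Complex `n × n` matrices. -/
abbrev Mat (n : ℕ) : Type := Matrix (Fin n) (Fin n) ℂ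

/-- The value of a polynomial in the matrix entries at the matrix `A`. -/
noncomputable def evalMat (P : MvPolynomial (Fin n × Fin n) ℂ) (A : Mat n) : ℂ :=
  MvPolynomial.eval (fun ij => A ij.1 ij.2) P

/-- A subgroup of `GL n ℂ` cut out by polynomial equations in the matrix entries, i.e. a linear
algebraic group. -/
def IsZariskiClosed (H : Subgroup (GL (Fin n) ℂ)) : Prop :=
  ∃ I : Set (MvPolynomial (Fin n × Fin n) ℂ),
    ∀ g : GL (Fin n) ℂ, g ∈ H ↔ ∀ P ∈ I, evalMat P (g : Mat n) = 0

/-- The derivation of the coordinate ring of matrices given by the vector field `A ↦ Z * A`. -/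
noncomputable def invDer (Z : Mat n) :
    Derivation ℂ (MvPolynomial (Fin n × Fin n) ℂ) (MvPolynomial (Fin n × Fin n) ℂ) :=
  MvPolynomial.mkDerivation ℂ
    (fun ij => ∑ k, MvPolynomial.C (Z ij.1 k) * MvPolynomial.X (k, ij.2))

theorem hasDerivAt_evalMat {A : ℂ → Mat n} {Z : Mat n} {t : ℂ}
    (h : ∀ i j, HasDerivAt (fun s => A s i j) ((Z * A t) i j) t)
    (P : MvPolynomial (Fin n × Fin n) ℂ) :
    HasDerivAt (fun s => evalMat P (A s)) (evalMat (invDer Z P) (A t)) t := by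
  induction P using MvPolynomial.induction_on with
  | C a =>
    simpa [evalMat, invDer] using hasDerivAt_const t a
  | add P Q hP hQ =>
    simp only [evalMat, map_add] at *
    exact hP.add hQ
  | mul_X P ij hP =>
    have h1 : HasDerivAt (fun s => evalMat P (A s) * A s ij.1 ij.2) _ t := hP.mul (h ij.1 ij.2)
    simp only [evalMat, invDer, Derivation.leibniz, MvPolynomial.mkDerivation_X,
      Matrix.mul_apply, smul_eq_mul, map_add, map_mul, map_sum, MvPolynomial.eval_X,
      MvPolynomial.eval_C] at h1 ⊢
    convert! h1 using 1
    ring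

/-- The polynomials vanishing on `H` are stable under `invDer Z`. -/
def Stab (H : Subgroup (GL (Fin n) ℂ)) (Z : Mat n) : Prop :=
  ∀ P : MvPolynomial (Fin n × Fin n) ℂ, (∀ g ∈ H, evalMat P (g : Mat n) = 0) →
    ∀ g ∈ H, evalMat (invDer Z P) (g : Mat n) = 0

theorem hasDerivAt_exp_mul (Z B : Mat n) (t : ℂ) (i j : Fin n) :
    HasDerivAt (fun s : ℂ => (NormedSpace.exp (s • Z) * B) i j)
      ((Z * (NormedSpace.exp (t • Z) * B)) i j) t := by
  have h : ∀ k, HasDerivAt (fun s : ℂ => (NormedSpace.exp (s • Z)) i k)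
      ((Z * NormedSpace.exp (t • Z)) i k) t := by
    intro k
    let _ : NormedRing (Mat n) := Matrix.linftyOpNormedRing
    let _ : NormedAlgebra ℂ (Mat n) := Matrix.linftyOpNormedAlgebra
    have h0 := hasDerivAt_exp_smul_const' Z t
    let L : Mat n →ₗ[ℂ] ℂ := Matrix.entryLinearMap ℂ ℂ i k
    exact (LinearMap.toContinuousLinearMap L).hasFDerivAt.comp_hasDerivAt t h0
  have h1 := HasDerivAt.fun_sum (u := Finset.univ) fun k _ => (h k).mul_const (B k j)
  rw [← mul_assoc]
  simpa only [Matrix.mul_apply (M := NormedSpace.exp _), Matrix.mul_apply (M := Z * _)] using h1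

/-- The invertible matrix `exp A`. -/
noncomputable def expGL (A : Mat n) : GL (Fin n) ℂ := (Matrix.isUnit_exp A).unit

@[simp] theorem coe_expGL (A : Mat n) : (expGL A : Mat n) = NormedSpace.exp A := rfl

theorem stab_iff {H : Subgroup (GL (Fin n) ℂ)} (hH : IsZariskiClosed H) (Z : Mat n) :
    (∀ t : ℂ, expGL (t • Z) ∈ H) ↔ Stab H Z := by
  constructor
  · intro h P hP g hg
    have h1 := hasDerivAt_evalMat (A := fun s : ℂ => NormedSpace.exp (s • Z) * (g : Mat n))
      (hasDerivAt_exp_mul Z (g : Mat n) 0) P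
    have h2 : (fun s : ℂ => evalMat P (NormedSpace.exp (s • Z) * (g : Mat n))) = fun _ => 0 := by
      ext s
      have := hP _ (H.mul_mem (h s) hg)
      rwa [Units.val_mul, coe_expGL] at this
    rw [h2] at h1
    have h3 := h1.unique (hasDerivAt_const (0 : ℂ) (0 : ℂ))
    rwa [zero_smul, NormedSpace.exp_zero, one_mul] at h3
  · intro h t
    obtain ⟨I, hI⟩ := hH
    rw [hI]
    intro P hP
    have hvan : ∀ k : ℕ, ∀ g ∈ H, evalMat ((invDer Z)^[k] P) (g : Mat n) = 0 := by
      intro k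
      induction k with
      | zero => intro g hg; exact (hI g).1 hg P hP
      | succ k ih =>
        intro g hg
        rw [Function.iterate_succ_apply']
        exact h _ ih g hg
    have hd : ∀ (Q : MvPolynomial (Fin n × Fin n) ℂ) (s : ℂ),
        HasDerivAt (fun s : ℂ => evalMat Q (NormedSpace.exp (s • Z)))
          (evalMat (invDer Z Q) (NormedSpace.exp (s • Z))) s := by
      intro Q s
      have h1 := hasDerivAt_evalMat (A := fun s : ℂ => NormedSpace.exp (s • Z) * (1 : Mat n))
        (hasDerivAt_exp_mul Z 1 s) Q
      simp only [mul_one] at h1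
      exact h1
    have hit : ∀ k : ℕ, iteratedDeriv k (fun s : ℂ => evalMat P (NormedSpace.exp (s • Z)))
        = fun s : ℂ => evalMat ((invDer Z)^[k] P) (NormedSpace.exp (s • Z)) := by
      intro k
      induction k with
      | zero => simp
      | succ k ih =>
        rw [iteratedDeriv_succ, ih]
        ext s
        rw [(hd _ s).deriv, Function.iterate_succ_apply']
    have hdiff : Differentiable ℂ (fun s : ℂ => evalMat P (NormedSpace.exp (s • Z))) :=
      fun s => (hd P s).differentiableAt
    have hT := Complex.taylorSeries_eq_of_entire hdiff 0 t
    have h0 : ∀ k : ℕ, iteratedDeriv k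
        (fun s : ℂ => evalMat P (NormedSpace.exp (s • Z))) 0 = 0 := by
      intro k
      rw [hit k]
      have := hvan k 1 H.one_mem
      rwa [Units.val_one, ← NormedSpace.exp_zero, ← zero_smul ℂ Z] at this
    rw [coe_expGL]
    rw [← hT]
    simp [h0]

theorem stab_add {H : Subgroup (GL (Fin n) ℂ)} {Z W : Mat n} (hZ : Stab H Z) (hW : Stab H W) :
    Stab H (Z + W) := by
  intro P hP g hg
  have h : invDer (Z + W) = invDer Z + invDer W := by
    apply MvPolynomial.derivation_ext
    intro ij
    simp [invDer, MvPolynomial.mkDerivation_X, add_mul, Finset.sum_add_distrib]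
  rw [h]
  have h1 := hZ P hP g hg
  have h2 := hW P hP g hg
  simp only [evalMat] at *
  simp [h1, h2]

theorem stab_lie {H : Subgroup (GL (Fin n) ℂ)} {Z W : Mat n} (hZ : Stab H Z) (hW : Stab H W) :
    Stab H ⁅Z, W⁆ := by
  intro P hP g hg
  have h : invDer ⁅Z, W⁆ = ⁅invDer W, invDer Z⁆ := by
    apply MvPolynomial.derivation_ext
    intro ij
    simp only [invDer, MvPolynomial.mkDerivation_X, Derivation.commutator_apply, map_sum,
      Derivation.leibniz, MvPolynomial.derivation_C, mul_zero, smul_eq_mul, Ring.lie_def,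
      Matrix.sub_apply, Matrix.mul_apply, map_sub, map_mul, sub_mul, Finset.sum_sub_distrib,
      Finset.mul_sum, Finset.sum_mul]
    congr 1
    · rw [Finset.sum_comm]
      refine Finset.sum_congr rfl fun k _ => ?_
      rw [add_zero]
      exact Finset.sum_congr rfl fun l _ => mul_assoc _ _ _
    · rw [Finset.sum_comm]
      refine Finset.sum_congr rfl fun k _ => ?_
      rw [add_zero]
      exact Finset.sum_congr rfl fun l _ => mul_assoc _ _ _
  rw [h, Derivation.commutator_apply]
  have h1 := hZ _ (hW P hP) g hg
  have h2 := hW _ (hZ P hP) g hg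
  simp only [evalMat] at *
  simp [h1, h2]

/-- The Lie algebra `{X | exp (t X) ∈ H for all t ∈ ℂ}` of a Zariski closed subgroup `H`; it is
closed under the commutator by `lie_mem`. -/
noncomputable def lieAlgOf (H : Subgroup (GL (Fin n) ℂ)) (hH : IsZariskiClosed H) :
    Submodule ℂ (Mat n) where
  carrier := {X | ∀ t : ℂ, expGL (t • X) ∈ H}
  add_mem' := fun {X Y} hX hY => by
    rw [Set.mem_ofPred_eq, stab_iff hH] at *
    exact stab_add hX hY
  zero_mem' := by
    intro t
    have : expGL (t • (0 : Mat n)) = 1 := by ext1; simp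
    rw [this]; exact H.one_mem
  smul_mem' := fun c X hX t => by
    rw [smul_smul]; exact hX _

theorem mem_lieAlgOf {H : Subgroup (GL (Fin n) ℂ)} (hH : IsZariskiClosed H) {X : Mat n} :
    X ∈ lieAlgOf H hH ↔ ∀ t : ℂ, expGL (t • X) ∈ H := Iff.rfl

theorem lie_mem {H : Subgroup (GL (Fin n) ℂ)} (hH : IsZariskiClosed H) {X Y : Mat n}
    (hX : X ∈ lieAlgOf H hH) (hY : Y ∈ lieAlgOf H hH) : ⁅X, Y⁆ ∈ lieAlgOf H hH := by
  rw [mem_lieAlgOf, stab_iff hH] at *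
  exact stab_lie hX hY

/-- The logarithmic derivative of a curve in `H` lies in the Lie algebra of `H`. -/
theorem logDeriv_mem {H : Subgroup (GL (Fin n) ℂ)} (hH : IsZariskiClosed H)
    {g : ℂ → GL (Fin n) ℂ} (hg : ∀ t, g t ∈ H) {g' : Mat n}
    (hd : ∀ i j, HasDerivAt (fun t => (g t : Mat n) i j) (g' i j) 0) :
    g' * ((g 0)⁻¹ : GL (Fin n) ℂ) ∈ lieAlgOf H hH := by
  rw [mem_lieAlgOf, stab_iff hH]
  intro P hP k hk
  let B : Mat n := (((g 0)⁻¹ * k : GL (Fin n) ℂ) : Mat n)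
  have hA : ∀ i j, HasDerivAt (fun t => ((g t : Mat n) * B) i j)
      ((g' * ((g 0)⁻¹ : GL (Fin n) ℂ) * ((g 0 : Mat n) * B)) i j) 0 := by
    intro i j
    have h0 := HasDerivAt.fun_sum (u := Finset.univ) fun l _ => (hd i l).mul_const (B l j)
    have h1 : g' * ((g 0)⁻¹ : GL (Fin n) ℂ) * ((g 0 : Mat n) * B) = g' * B := by
      simp only [B, Units.val_mul]
      rw [mul_assoc, ← mul_assoc (g 0 : Mat n), Units.mul_inv, one_mul]
    rw [h1]
    simpa only [Matrix.mul_apply] using h0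
  have h1 := hasDerivAt_evalMat (A := fun t => (g t : Mat n) * B) hA P
  have h2 : (fun t => evalMat P ((g t : Mat n) * B))
      = fun _ => 0 := by
    ext t
    have := hP _ (H.mul_mem (hg t) (H.mul_mem (H.inv_mem (hg 0)) hk))
    rwa [Units.val_mul] at this
  rw [h2] at h1
  have h3 := h1.unique (hasDerivAt_const (0 : ℂ) (0 : ℂ))
  have h4 : (g 0 : Mat n) * B = k := by
    rw [← Units.val_mul, mul_inv_cancel_left]
  simpa only [h4] using h3

theorem conj_mem {H : Subgroup (GL (Fin n) ℂ)} (hH : IsZariskiClosed H)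
    {g : GL (Fin n) ℂ} (hg : g ∈ H) {X : Mat n} (hX : X ∈ lieAlgOf H hH) :
    (g : Mat n) * X * (g⁻¹ : GL (Fin n) ℂ) ∈ lieAlgOf H hH := by
  intro t
  have : expGL (t • ((g : Mat n) * X * ((g⁻¹ : GL (Fin n) ℂ) : Mat n)))
      = g * expGL (t • X) * g⁻¹ := by
    ext1
    rw [Units.val_mul, Units.val_mul, coe_expGL, coe_expGL, Matrix.coe_units_inv,
      ← Matrix.exp_conj _ _ g.isUnit]
    simp
  rw [this]
  exact H.mul_mem (H.mul_mem hg (hX t)) (H.inv_mem hg)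

end LieGroups

section Calculus

variable {n : ℕ}

/-- Matrix valued functions on `ℂ²`. -/
abbrev MatFun (n : ℕ) : Type := ℂ × ℂ → Mat n

/-- Holomorphic (complex analytic) matrix valued functions on `ℂ²`. -/
def IsHol (u : MatFun n) : Prop :=
  ∀ i j, AnalyticOnNhd ℂ (fun z => u z i j) Set.univ

/-- The derivative of a matrix valued function along a vector field `X`. -/
noncomputable def vderiv (X : ℂ × ℂ → ℂ × ℂ) (u : MatFun n) : MatFun n :=
  fun z => Matrix.of fun i j => fderiv ℂ (fun w => u w i j) z (X z)

theorem vderiv_apply (X : ℂ × ℂ → ℂ × ℂ) (u : MatFun n) (z : ℂ × ℂ) (i j : Fin n) :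
    vderiv X u z i j = fderiv ℂ (fun w => u w i j) z (X z) := rfl

namespace IsHol

variable {u v : MatFun n}

theorem diffAt (hu : IsHol u) (z : ℂ × ℂ) (i j : Fin n) :
    DifferentiableAt ℂ (fun z => u z i j) z :=
  (hu i j z (Set.mem_univ z)).differentiableAt

theorem const (A : Mat n) : IsHol (fun _ => A) := fun _ _ => analyticOnNhd_const

theorem add (hu : IsHol u) (hv : IsHol v) : IsHol (fun z => u z + v z) :=
  fun i j => (hu i j).add (hv i j)

theorem sub (hu : IsHol u) (hv : IsHol v) : IsHol (fun z => u z - v z) :=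
  fun i j => (hu i j).sub (hv i j)

theorem scal {m : ℂ × ℂ → ℂ} (hm : AnalyticOnNhd ℂ m Set.univ) (hu : IsHol u) :
    IsHol (fun z => m z • u z) :=
  fun i j => hm.mul (hu i j)

theorem mul (hu : IsHol u) (hv : IsHol v) : IsHol (fun z => u z * v z) := by
  intro i j z _
  simp only [Matrix.mul_apply]
  exact Finset.analyticAt_fun_sum _ fun k _ =>
    (hu i k z (Set.mem_univ z)).mul (hv k j z (Set.mem_univ z))

theorem lie (hu : IsHol u) (hv : IsHol v) : IsHol (fun z => ⁅u z, v z⁆) :=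
  (hu.mul hv).sub (hv.mul hu)

theorem vderiv {X : ℂ × ℂ → ℂ × ℂ} (hX : AnalyticOnNhd ℂ X Set.univ) (hu : IsHol u) :
    IsHol (vderiv X u) :=
  fun i j z hz => by
    have h1 : AnalyticAt ℂ (fderiv ℂ (fun z => u z i j)) z := (hu i j).fderiv z hz
    have h2 : AnalyticAt ℂ X z := hX z hz
    change AnalyticAt ℂ (fun z => fderiv ℂ (fun w => u w i j) z (X z)) z
    exact ((ContinuousLinearMap.id ℂ (ℂ × ℂ →L[ℂ] ℂ)).analyticAt_bilinear _).comp₂ h1 h2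

theorem det (hu : IsHol u) (z : ℂ × ℂ) : AnalyticAt ℂ (fun z => (u z).det) z := by
  simp only [Matrix.det_apply']
  refine Finset.analyticAt_fun_sum _ fun σ _ => analyticAt_const.mul ?_
  exact Finset.analyticAt_fun_prod _ fun i _ => hu _ _ z (Set.mem_univ z)

theorem inv {g : ℂ × ℂ → GL (Fin n) ℂ} (hg : IsHol (fun z => (g z : Mat n))) :
    IsHol (fun z => (((g z)⁻¹ : GL (Fin n) ℂ) : Mat n)) := by
  intro i j z _
  have h : ∀ z, (((g z)⁻¹ : GL (Fin n) ℂ) : Mat n) i j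
      = ((g z : Mat n).det)⁻¹ * ((g z : Mat n).updateRow j (Pi.single i 1)).det := by
    intro z
    rw [Matrix.coe_units_inv, Matrix.inv_def, Matrix.smul_apply, Matrix.adjugate_apply,
      Ring.inverse_eq_inv', smul_eq_mul]
  simp only [h]
  refine ((hg.det z).inv ?_).mul ?_
  · exact ((Matrix.isUnit_iff_isUnit_det _).1 (g z).isUnit).ne_zero
  · refine IsHol.det (u := fun z => (g z : Mat n).updateRow j (Pi.single i 1)) ?_ z
    intro a b
    by_cases hab : a = j
    · subst hab
      simp only [Matrix.updateRow_self]
      exact analyticOnNhd_const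
    · simp only [Matrix.updateRow_ne hab]
      exact hg a b

end IsHol

variable {u v : MatFun n} (X : ℂ × ℂ → ℂ × ℂ)

theorem vderiv_const (A : Mat n) : vderiv X (fun _ => A) = 0 := by
  ext z i j
  simp [vderiv]

theorem vderiv_add (hu : IsHol u) (hv : IsHol v) :
    vderiv X (fun z => u z + v z) = fun z => vderiv X u z + vderiv X v z := by
  ext z i j
  simp only [vderiv_apply, Matrix.add_apply]
  rw [fderiv_fun_add (hu.diffAt z i j) (hv.diffAt z i j)]
  rfl

theorem vderiv_sub (hu : IsHol u) (hv : IsHol v) :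
    vderiv X (fun z => u z - v z) = fun z => vderiv X u z - vderiv X v z := by
  ext z i j
  simp only [vderiv_apply, Matrix.sub_apply]
  rw [fderiv_fun_sub (hu.diffAt z i j) (hv.diffAt z i j)]
  rfl

theorem vderiv_scal {m : ℂ × ℂ → ℂ} (hm : AnalyticOnNhd ℂ m Set.univ) (hu : IsHol u) :
    vderiv X (fun z => m z • u z)
      = fun z => fderiv ℂ m z (X z) • u z + m z • vderiv X u z := by
  ext z i j
  simp only [vderiv_apply, Matrix.add_apply, Matrix.smul_apply, smul_eq_mul]
  rw [fderiv_fun_mul (hm z (Set.mem_univ z)).differentiableAt (hu.diffAt z i j)]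
  simp
  ring

theorem vderiv_smul (c : ℂ) (hu : IsHol u) :
    vderiv X (fun z => c • u z) = fun z => c • vderiv X u z := by
  rw [vderiv_scal X (m := fun _ => c) analyticOnNhd_const hu]
  simp

theorem vderiv_mul (hu : IsHol u) (hv : IsHol v) :
    vderiv X (fun z => u z * v z) = fun z => vderiv X u z * v z + u z * vderiv X v z := by
  ext z i j
  simp only [vderiv_apply, Matrix.add_apply, Matrix.mul_apply]
  rw [fderiv_fun_sum fun k _ => (hu.diffAt z i k).fun_mul (hv.diffAt z k j),
    _root_.sum_apply, ← Finset.sum_add_distrib]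
  refine Finset.sum_congr rfl fun k _ => ?_
  rw [fderiv_fun_mul (hu.diffAt z i k) (hv.diffAt z k j)]
  simp
  ring

theorem vderiv_lie (hu : IsHol u) (hv : IsHol v) :
    vderiv X (fun z => ⁅u z, v z⁆)
      = fun z => ⁅vderiv X u z, v z⁆ + ⁅u z, vderiv X v z⁆ := by
  simp only [Ring.lie_def]
  rw [vderiv_sub X (hu.mul hv) (hv.mul hu), vderiv_mul X hu hv, vderiv_mul X hv hu]
  ext1 z
  noncomm_ring

theorem vderiv_inv {g : ℂ × ℂ → GL (Fin n) ℂ} (hg : IsHol (fun z => (g z : Mat n))) (z : ℂ × ℂ) :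
    vderiv X (fun z => (((g z)⁻¹ : GL (Fin n) ℂ) : Mat n)) z
      = - ((((g z)⁻¹ : GL (Fin n) ℂ) : Mat n) * vderiv X (fun z => (g z : Mat n)) z
          * (((g z)⁻¹ : GL (Fin n) ℂ) : Mat n)) := by
  have h := congrFun (vderiv_mul X hg hg.inv) z
  have h1 : (fun z => (g z : Mat n) * (((g z)⁻¹ : GL (Fin n) ℂ) : Mat n)) = fun _ => 1 := by
    ext1 z; exact Units.mul_inv _
  rw [h1, vderiv_const] at h
  have h2 := congrArg (fun A => (((g z)⁻¹ : GL (Fin n) ℂ) : Mat n) * A) h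
  simp only [Pi.zero_apply, mul_zero, mul_add, ← mul_assoc, Units.inv_mul, one_mul] at h2
  exact eq_neg_of_add_eq_zero_right h2.symm

theorem vderiv_mem {W : Submodule ℂ (Mat n)} (hu : IsHol u) (h : ∀ z, u z ∈ W) (z : ℂ × ℂ) :
    vderiv X u z ∈ W := by
  by_contra hn
  obtain ⟨φ, hφ, hW⟩ := Submodule.exists_le_ker_of_notMem hn
  apply hφ
  have key : ∀ A : Mat n, φ A = ∑ i, ∑ j, A i j * φ (Matrix.single i j 1) := by
    intro A
    conv_lhs => rw [Matrix.matrix_eq_sum_single A]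
    simp only [map_sum]
    refine Finset.sum_congr rfl fun i _ => Finset.sum_congr rfl fun j _ => ?_
    rw [← smul_eq_mul, ← map_smul, Matrix.smul_single, smul_eq_mul, mul_one]
  have h0 : (fun w => ∑ i, ∑ j, u w i j * φ (Matrix.single i j 1)) = fun _ => 0 := by
    ext1 w
    rw [← key]
    exact hW (h w)
  have h1 : HasFDerivAt (fun w => ∑ i, ∑ j, u w i j * φ (Matrix.single i j 1))
      (∑ i, ∑ j, (φ (Matrix.single i j 1)) • fderiv ℂ (fun w => u w i j) z) z :=
    HasFDerivAt.fun_sum fun i _ => HasFDerivAt.fun_sum fun j _ =>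
      (hu.diffAt z i j).hasFDerivAt.mul_const _
  rw [h0] at h1
  have h2 := h1.unique (hasFDerivAt_const (0 : ℂ) z)
  have h3 := congrArg (fun L => L (X z)) h2
  rw [key]
  simpa [vderiv_apply, mul_comm] using h3

theorem vderiv_logDeriv_mem {H : Subgroup (GL (Fin n) ℂ)} (hH : IsZariskiClosed H)
    {g : ℂ × ℂ → GL (Fin n) ℂ} (hg : IsHol (fun z => (g z : Mat n))) (hgH : ∀ z, g z ∈ H)
    (z : ℂ × ℂ) :
    vderiv X (fun z => (g z : Mat n)) z * (((g z)⁻¹ : GL (Fin n) ℂ) : Mat n)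
      ∈ lieAlgOf H hH := by
  have h := logDeriv_mem hH (g := fun t : ℂ => g (z + t • X z)) (fun t => hgH _)
    (g' := vderiv X (fun z => (g z : Mat n)) z) ?_
  · simpa using h
  · intro i j
    have h1 : HasFDerivAt (fun w => (g w : Mat n) i j)
        (fderiv ℂ (fun w => (g w : Mat n) i j) z) (z + (0 : ℂ) • X z) := by
      simpa using (hg.diffAt z i j).hasFDerivAt
    have h2 : HasDerivAt (fun t : ℂ => z + t • X z) (X z) 0 := by
      simpa using ((hasDerivAt_id (0 : ℂ)).smul_const (X z)).const_add z
    exact h1.comp_hasDerivAt (0 : ℂ) h2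

end Calculus

section Curve

/-- `f = x ^ p - y ^ q`. -/
def curveFn (p q : ℕ) (z : ℂ × ℂ) : ℂ := z.1 ^ p - z.2 ^ q

/-- The Euler vector field `E = q x ∂_x + p y ∂_y`. -/
def eulerField (p q : ℕ) (z : ℂ × ℂ) : ℂ × ℂ := ((q : ℂ) * z.1, (p : ℂ) * z.2)

/-- The vector field `V = q y ^ (q-1) ∂_x + p x ^ (p-1) ∂_y`. Together with `E` it is a basis of the
logarithmic tangent bundle of `f = 0`; the dual basis is `α₀ = dlog f / (pq)` and `β`. -/
def hamField (p q : ℕ) (z : ℂ × ℂ) : ℂ × ℂ :=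
  ((q : ℂ) * z.2 ^ (q - 1), (p : ℂ) * z.1 ^ (p - 1))

/-- The weight `w₀ = pq - p - q` of `V`. -/
def w₀ (p q : ℕ) : ℤ := (p : ℤ) * q - p - q

variable (p q : ℕ)

theorem eulerField_analytic : AnalyticOnNhd ℂ (eulerField p q) Set.univ := fun _ _ =>
  (analyticAt_const.mul analyticAt_fst).prod (analyticAt_const.mul analyticAt_snd)

theorem hamField_analytic : AnalyticOnNhd ℂ (hamField p q) Set.univ := fun _ _ =>
  (analyticAt_const.mul (analyticAt_snd.pow _)).prod (analyticAt_const.mul (analyticAt_fst.pow _))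

theorem hasFDerivAt_fst_pow (k : ℕ) (z : ℂ × ℂ) :
    HasFDerivAt (fun w : ℂ × ℂ => w.1 ^ k)
      (((k : ℂ) * z.1 ^ (k - 1)) • ContinuousLinearMap.fst ℂ ℂ ℂ) z :=
  (hasDerivAt_pow k z.1).comp_hasFDerivAt z hasFDerivAt_fst

theorem hasFDerivAt_snd_pow (k : ℕ) (z : ℂ × ℂ) :
    HasFDerivAt (fun w : ℂ × ℂ => w.2 ^ k)
      (((k : ℂ) * z.2 ^ (k - 1)) • ContinuousLinearMap.snd ℂ ℂ ℂ) z :=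
  (hasDerivAt_pow k z.2).comp_hasFDerivAt z hasFDerivAt_snd

theorem natCast_mul_pow_pred (k : ℕ) (x : ℂ) : (k : ℂ) * x ^ (k - 1) * x = k * x ^ k := by
  cases k with
  | zero => simp
  | succ k => simp only [Nat.add_sub_cancel]; ring

theorem natCast_mul_pred (k : ℕ) : (k : ℂ) * ((k - 1 : ℕ) : ℂ) = k * (k - 1) := by
  cases k with
  | zero => simp
  | succ k => simp

theorem lieBracket_euler_ham (z : ℂ × ℂ) :
    VectorField.lieBracket ℂ (eulerField p q) (hamField p q) z
      = (w₀ p q : ℂ) • hamField p q z := by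
  have hE : HasFDerivAt (eulerField p q)
      (((q : ℂ) • ContinuousLinearMap.fst ℂ ℂ ℂ).prod
        ((p : ℂ) • ContinuousLinearMap.snd ℂ ℂ ℂ)) z :=
    (hasFDerivAt_fst.const_mul _).prodMk (hasFDerivAt_snd.const_mul _)
  have hV : HasFDerivAt (hamField p q) _ z :=
    ((hasFDerivAt_snd_pow (q - 1) z).const_mul (q : ℂ)).prodMk
      ((hasFDerivAt_fst_pow (p - 1) z).const_mul (p : ℂ))
  rw [VectorField.lieBracket, hE.fderiv, hV.fderiv]
  ext
  · simp [eulerField, hamField, w₀]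
    have h1 := natCast_mul_pow_pred (q - 1) z.2
    have h2 := natCast_mul_pred q
    linear_combination (q : ℂ) * p * h1 + (p : ℂ) * z.2 ^ (q - 1) * h2
  · simp [eulerField, hamField, w₀]
    have h1 := natCast_mul_pow_pred (p - 1) z.1
    have h2 := natCast_mul_pred p
    linear_combination (q : ℂ) * p * h1 + (q : ℂ) * z.1 ^ (p - 1) * h2

theorem vderiv_comm {n : ℕ} {u : MatFun n} (hu : IsHol u) (z : ℂ × ℂ) :
    vderiv (eulerField p q) (vderiv (hamField p q) u) z
      = vderiv (hamField p q) (vderiv (eulerField p q) u) z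
        + (w₀ p q : ℂ) • vderiv (hamField p q) u z := by
  ext i j
  have hu' : AnalyticAt ℂ (fun w => u w i j) z := hu i j z (Set.mem_univ z)
  have h := VectorField.fderiv_apply_lieBracket (n := minSmoothness ℂ 2) (x := z)
    (V := eulerField p q) (W := hamField p q) hu'.contDiffAt le_rfl
    ((hamField_analytic p q) z (Set.mem_univ z)).differentiableAt
    ((eulerField_analytic p q) z (Set.mem_univ z)).differentiableAt
  rw [lieBracket_euler_ham, map_smul] at h
  simp only [Matrix.add_apply, Matrix.smul_apply, vderiv_apply]
  rw [h]
  ring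

theorem fderiv_curveFn_euler (z : ℂ × ℂ) :
    fderiv ℂ (curveFn p q) z (eulerField p q z) = (p : ℂ) * q * curveFn p q z := by
  have h : HasFDerivAt (curveFn p q) _ z := (hasFDerivAt_fst_pow p z).sub (hasFDerivAt_snd_pow q z)
  rw [h.fderiv]
  simp [eulerField, curveFn]
  linear_combination (q : ℂ) * natCast_mul_pow_pred p z.1 - (p : ℂ) * natCast_mul_pow_pred q z.2

/-- The function `f ^ c * x ^ a * y ^ b`. -/
def monom (c a b : ℕ) (z : ℂ × ℂ) : ℂ := curveFn p q z ^ c * z.1 ^ a * z.2 ^ b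

theorem curveFn_analytic (z : ℂ × ℂ) : AnalyticAt ℂ (curveFn p q) z :=
  (analyticAt_fst.pow _).sub (analyticAt_snd.pow _)

theorem monom_analytic (c a b : ℕ) : AnalyticOnNhd ℂ (monom p q c a b) Set.univ := fun z _ =>
  (((curveFn_analytic p q z).pow c).mul (analyticAt_fst.pow _)).mul (analyticAt_snd.pow _)

theorem fderiv_monom_euler (c a b : ℕ) (z : ℂ × ℂ) :
    fderiv ℂ (monom p q c a b) z (eulerField p q z)
      = ((c : ℂ) * (p * q) + a * q + b * p) * monom p q c a b z := by
  have hf := (curveFn_analytic p q z).differentiableAt.hasFDerivAt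
  have h : HasFDerivAt (monom p q c a b) _ z :=
    (((hasDerivAt_pow c (curveFn p q z)).comp_hasFDerivAt z hf).mul
      (hasFDerivAt_fst_pow a z)).mul (hasFDerivAt_snd_pow b z)
  rw [h.fderiv]
  have h4 := fderiv_curveFn_euler p q z
  simp only [eulerField] at h4
  simp [eulerField, monom]
  have h1 := natCast_mul_pow_pred c (curveFn p q z)
  have h2 := natCast_mul_pow_pred a z.1
  have h3 := natCast_mul_pow_pred b z.2
  linear_combination curveFn p q z ^ c * z.1 ^ a * (p : ℂ) * h3
    + curveFn p q z ^ c * z.2 ^ b * (q : ℂ) * h2 + z.1 ^ a * z.2 ^ b * (p * q : ℂ) * h1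
    + (c : ℂ) * curveFn p q z ^ (c - 1) * z.1 ^ a * z.2 ^ b * h4

end Curve

/-- A connected complex reductive group, realised as a Zariski closed subgroup of `GL n ℂ` (every
complex reductive group has such a realisation). Reductive: the only Zariski closed normal
subgroup all of whose elements are unipotent is trivial. -/
structure ReductiveGroup (n : ℕ) where
  toSubgroup : Subgroup (GL (Fin n) ℂ)
  zariskiClosed : IsZariskiClosed toSubgroup
  connected : IsConnected (toSubgroup : Set (GL (Fin n) ℂ))
  reductive : ∀ N : Subgroup (GL (Fin n) ℂ), N ≤ toSubgroup → IsZariskiClosed N →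
    (∀ g ∈ toSubgroup, ∀ x ∈ N, g * x * g⁻¹ ∈ N) →
    (∀ x ∈ N, IsNilpotent ((x : Mat n) - 1)) → N = ⊥

namespace ReductiveGroup

variable {n : ℕ} (G : ReductiveGroup n)

/-- The Lie algebra `𝔤` of `G`. -/
noncomputable def lieAlgebra : Submodule ℂ (Mat n) := lieAlgOf G.toSubgroup G.zariskiClosed

/-- The gauge group of holomorphic maps `ℂ² → G`. -/
def gaugeGroup : Subgroup (ℂ × ℂ → GL (Fin n) ℂ) where
  carrier := {g | IsHol (fun z => (g z : Mat n)) ∧ ∀ z, g z ∈ G.toSubgroup}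
  mul_mem' := fun {g h} hg hh => ⟨by simpa using hg.1.mul hh.1,
    fun z => G.toSubgroup.mul_mem (hg.2 z) (hh.2 z)⟩
  one_mem' := ⟨IsHol.const 1, fun _ => G.toSubgroup.one_mem⟩
  inv_mem' := fun {g} hg => ⟨hg.1.inv, fun z => G.toSubgroup.inv_mem (hg.2 z)⟩

variable (S : Mat n) (p q : ℕ)

theorem preserves_iff (g : ℂ × ℂ → GL (Fin n) ℂ) (z : ℂ × ℂ) :
    ((g z : Mat n) * S * (((g z)⁻¹ : GL (Fin n) ℂ) : Mat n)
        - vderiv (eulerField p q) (fun w => (g w : Mat n)) z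
          * (((g z)⁻¹ : GL (Fin n) ℂ) : Mat n) = S) ↔
      vderiv (eulerField p q) (fun w => (g w : Mat n)) z
        = (g z : Mat n) * S - S * (g z : Mat n) := by
  rw [← sub_mul]
  constructor
  · intro h
    have h' := congrArg (fun A => A * (g z : Mat n)) h
    simp only [mul_assoc, Units.inv_mul, mul_one] at h'
    rw [← h']
    abel
  · intro h
    rw [h, sub_sub_cancel, mul_assoc, Units.mul_inv, mul_one]

/-- `Aut(S)`: the gauge transformations `g : ℂ² → G` fixing the representation `S` of the Lie
algebroid generated by `E`, on which `g` acts by `g * S = g S g⁻¹ - E(g) g⁻¹`. -/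
noncomputable def aut : Subgroup (ℂ × ℂ → GL (Fin n) ℂ) where
  carrier := {g | g ∈ G.gaugeGroup ∧ ∀ z,
    (g z : Mat n) * S * (((g z)⁻¹ : GL (Fin n) ℂ) : Mat n)
      - vderiv (eulerField p q) (fun w => (g w : Mat n)) z
        * (((g z)⁻¹ : GL (Fin n) ℂ) : Mat n) = S}
  mul_mem' := fun {g h} hg hh => by
    refine ⟨G.gaugeGroup.mul_mem hg.1 hh.1, fun z => ?_⟩
    have h1 := (preserves_iff S p q g z).1 (hg.2 z)
    have h2 := (preserves_iff S p q h z).1 (hh.2 z)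
    rw [preserves_iff]
    have h3 := congrFun (vderiv_mul (eulerField p q) hg.1.1 hh.1.1) z
    simp only [Pi.mul_apply, Units.val_mul]
    rw [h3, h1, h2]
    noncomm_ring
  one_mem' := by
    refine ⟨G.gaugeGroup.one_mem, fun z => ?_⟩
    rw [preserves_iff]
    simp [vderiv_const]
  inv_mem' := fun {g} hg => by
    refine ⟨G.gaugeGroup.inv_mem hg.1, fun z => ?_⟩
    have h1 := (preserves_iff S p q g z).1 (hg.2 z)
    rw [preserves_iff]
    have h3 := vderiv_inv (eulerField p q) hg.1.1 z
    simp only [Pi.inv_apply]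
    rw [h3, h1, mul_sub, sub_mul, ← mul_assoc, Units.inv_mul, one_mul, neg_sub, ← mul_assoc,
      mul_assoc (_ * S), Units.mul_inv, mul_one]

/-- Holomorphic maps `u : ℂ² → 𝔤` with `E(u) + [S, u] = k u`. -/
noncomputable def weightSpace (k : ℤ) : Submodule ℂ (MatFun n) where
  carrier := {u | IsHol u ∧ (∀ z, u z ∈ G.lieAlgebra) ∧
    ∀ z, vderiv (eulerField p q) u z + ⁅S, u z⁆ = (k : ℂ) • u z}
  add_mem' := fun {u v} hu hv => by
    refine ⟨hu.1.add hv.1, fun z => G.lieAlgebra.add_mem (hu.2.1 z) (hv.2.1 z), fun z => ?_⟩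
    have h := congrFun (vderiv_add (eulerField p q) hu.1 hv.1) z
    change vderiv _ (fun z => u z + v z) z + ⁅S, u z + v z⁆ = _ • (u z + v z)
    rw [h, smul_add, ← hu.2.2 z, ← hv.2.2 z]
    simp only [Ring.lie_def]
    noncomm_ring
  zero_mem' := by
    refine ⟨IsHol.const 0, fun z => G.lieAlgebra.zero_mem, fun z => ?_⟩
    have h := congrFun (vderiv_const (eulerField p q) (0 : Mat n)) z
    change vderiv _ (fun z => 0) z + ⁅S, (0 : Mat n)⁆ = _ • (0 : Mat n)
    rw [h]
    simp [Ring.lie_def]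
  smul_mem' := fun c u hu => by
    refine ⟨IsHol.scal (m := fun _ => c) analyticOnNhd_const hu.1,
      fun z => G.lieAlgebra.smul_mem c (hu.2.1 z), fun z => ?_⟩
    have h := congrFun (vderiv_smul (eulerField p q) c hu.1) z
    change vderiv _ (fun z => c • u z) z + ⁅S, c • u z⁆ = _ • c • u z
    rw [h, smul_comm, ← hu.2.2 z]
    simp [Ring.lie_def, smul_sub]

/-- `U_0^0`: the kernel of `L_S = L_E + ad_S` on holomorphic maps `ℂ² → 𝔤`, that is, the sum of
the spaces `O_w ⊗ 𝔤_{-w}`. -/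
noncomputable def U0 : Submodule ℂ (MatFun n) := G.weightSpace S p q 0

/-- `U_0^1`: the kernel of `L_S` on the `𝔤`-valued logarithmic one-forms `u β` (those killed by
`ι_E`), identified with their coefficients `u`. As `L_E β = -w₀ β`, this says
`E(u) + [S, u] = w₀ u`, so the space is the sum of the `O_w ⊗ 𝔤_{w₀ - w} β`. -/
noncomputable def U1 : Submodule ℂ (MatFun n) := G.weightSpace S p q (w₀ p q)

/-- The differential `δ_S : U_0^0 → U_0^1`, `u ↦ V(u) β`. -/
noncomputable def delta : G.U0 S p q →ₗ[ℂ] G.U1 S p q where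
  toFun u := ⟨vderiv (hamField p q) (u : MatFun n), by
    obtain ⟨u, hu, hu2, hu3⟩ := u
    refine ⟨hu.vderiv (hamField_analytic p q), fun z => vderiv_mem _ hu hu2 z, fun z => ?_⟩
    have h := vderiv_comm p q hu z
    have h1 : vderiv (eulerField p q) u = fun z => -⁅S, u z⁆ := by
      ext1 z
      have := hu3 z
      rw [Int.cast_zero, zero_smul] at this
      exact eq_neg_of_add_eq_zero_left this
    have h2 : (fun z => -⁅S, u z⁆) = fun z => (-1 : ℂ) • ⁅S, u z⁆ := by
      ext1 z; simp
    have h3 := vderiv_smul (hamField p q) (-1) ((IsHol.const S).lie hu)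
    have h4 := vderiv_lie (hamField p q) (IsHol.const S) hu
    change vderiv (eulerField p q) (vderiv (hamField p q) u) z
      + ⁅S, vderiv (hamField p q) u z⁆ = _ • vderiv (hamField p q) u z
    rw [h, h1, h2, h3, h4, vderiv_const]
    simp only [Pi.zero_apply, Ring.lie_def, zero_mul, mul_zero, sub_zero, zero_add, neg_smul,
      one_smul]
    abel⟩
  map_add' u v := Subtype.ext (vderiv_add (hamField p q) u.2.1 v.2.1)
  map_smul' c u := Subtype.ext (vderiv_smul (hamField p q) c u.2.1)

theorem lie_mem_weightSpace {k l : ℤ} {u v : MatFun n} (hu : u ∈ G.weightSpace S p q k)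
    (hv : v ∈ G.weightSpace S p q l) : (fun z => ⁅u z, v z⁆) ∈ G.weightSpace S p q (k + l) := by
  refine ⟨hu.1.lie hv.1, fun z => lie_mem G.zariskiClosed (hu.2.1 z) (hv.2.1 z), fun z => ?_⟩
  have h := congrFun (vderiv_lie (eulerField p q) hu.1 hv.1) z
  have h1 := eq_sub_of_add_eq (hu.2.2 z)
  have h2 := eq_sub_of_add_eq (hv.2.2 z)
  rw [h, h1, h2]
  push_cast
  simp only [Ring.lie_def, sub_mul, mul_sub, smul_mul_assoc, mul_smul_comm, add_smul, smul_sub,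
    mul_assoc]
  abel

/-- `ad_γ : U_0^0 → U_0^1` for `γ ∈ U_0^1`. -/
noncomputable def adU (γ : G.U1 S p q) : G.U0 S p q →ₗ[ℂ] G.U1 S p q where
  toFun u := ⟨fun z => ⁅(γ : MatFun n) z, (u : MatFun n) z⁆, by
    have := G.lie_mem_weightSpace S p q γ.2 u.2
    rwa [add_zero] at this⟩
  map_add' u v := Subtype.ext (by ext1 z; simp [Ring.lie_def]; noncomm_ring)
  map_smul' c u := Subtype.ext (by ext1 z; simp [Ring.lie_def, smul_sub])

/-- `H^0(U_0)`, the sum of the `f ^ c 𝔤_{-cpq}`. -/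
noncomputable def H0 : Submodule ℂ (MatFun n) :=
  Submodule.span ℂ {u | ∃ (c : ℕ) (X : Mat n), X ∈ G.lieAlgebra ∧
    ⁅S, X⁆ = (-((c : ℂ) * (p * q))) • X ∧ u = fun z => curveFn p q z ^ c • X}

/-- `H^1(U_0) ⊆ U_0^1`, the sum of the `(ℂ[f] ⊗ C)_w ⊗ 𝔤_{w₀ - w}`, where `C` has the basis of
monomials `x ^ a y ^ b` with `0 ≤ a < p - 1`, `0 ≤ b < q - 1`, and `f ^ c x ^ a y ^ b` has weight
`w = cpq + aq + bp`. -/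
noncomputable def H1 : Submodule ℂ (MatFun n) :=
  Submodule.span ℂ {u | ∃ (c a b : ℕ) (X : Mat n), a + 1 < p ∧ b + 1 < q ∧ X ∈ G.lieAlgebra ∧
    ⁅S, X⁆ = ((w₀ p q : ℂ) - ((c : ℂ) * (p * q) + a * q + b * p)) • X ∧
    u = fun z => (curveFn p q z ^ c * z.1 ^ a * z.2 ^ b) • X}

theorem monom_mem (k : ℤ) (c a b : ℕ) {X : Mat n} (hX : X ∈ G.lieAlgebra)
    (hS : ⁅S, X⁆ = ((k : ℂ) - ((c : ℂ) * (p * q) + a * q + b * p)) • X) :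
    (fun z => monom p q c a b z • X) ∈ G.weightSpace S p q k := by
  refine ⟨(IsHol.const X).scal (monom_analytic p q c a b),
    fun z => G.lieAlgebra.smul_mem _ hX, fun z => ?_⟩
  have h := congrFun (vderiv_scal (eulerField p q) (monom_analytic p q c a b) (IsHol.const X)) z
  have h1 : ⁅S, monom p q c a b z • X⁆ = monom p q c a b z • ⁅S, X⁆ := by
    simp [Ring.lie_def, smul_sub]
  rw [h, fderiv_monom_euler, vderiv_const, h1, hS]
  simp only [Pi.zero_apply, smul_zero, add_zero, smul_smul, ← add_smul]
  congr 1
  ring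

theorem H0_le : G.H0 S p q ≤ G.U0 S p q := by
  refine Submodule.span_le.2 ?_
  rintro u ⟨c, X, hX, hS, rfl⟩
  have := G.monom_mem S p q 0 c 0 0 hX (by rw [hS]; simp)
  simp only [monom, pow_zero, mul_one] at this
  exact this

theorem H1_le : G.H1 S p q ≤ G.U1 S p q := by
  refine Submodule.span_le.2 ?_
  rintro u ⟨c, a, b, X, -, -, hX, hS, rfl⟩
  exact G.monom_mem S p q (w₀ p q) c a b hX hS

theorem lie_mem_H1 {γ u : MatFun n} (hγ : γ ∈ G.H1 S p q) (hu : u ∈ G.H0 S p q) :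
    (fun z => ⁅γ z, u z⁆) ∈ G.H1 S p q := by
  induction hγ using Submodule.span_induction with
  | zero =>
    convert (G.H1 S p q).zero_mem using 1
    ext1 z; simp [Ring.lie_def]
  | add x y _ _ hx hy =>
    convert! (G.H1 S p q).add_mem hx hy using 1
    ext1 z; simp [Ring.lie_def]; noncomm_ring
  | smul r x _ hx =>
    convert! (G.H1 S p q).smul_mem r hx using 1
    ext1 z; simp [Ring.lie_def, smul_sub]
  | mem x hx =>
    induction hu using Submodule.span_induction with
    | zero =>
      convert (G.H1 S p q).zero_mem using 1
      ext1 z; simp [Ring.lie_def]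
    | add u v _ _ hu hv =>
      convert! (G.H1 S p q).add_mem hu hv using 1
      ext1 z; simp [Ring.lie_def]; noncomm_ring
    | smul r u _ hu =>
      convert! (G.H1 S p q).smul_mem r hu using 1
      ext1 z; simp [Ring.lie_def, smul_sub]
    | mem u hu =>
      obtain ⟨c, a, b, X, ha, hb, hX, hSX, rfl⟩ := hx
      obtain ⟨d, Y, hY, hSY, rfl⟩ := hu
      refine Submodule.subset_span ⟨c + d, a, b, ⁅X, Y⁆, ha, hb,
        lie_mem G.zariskiClosed hX hY, ?_, ?_⟩
      · have h1 : ⁅S, ⁅X, Y⁆⁆ = ⁅⁅S, X⁆, Y⁆ + ⁅X, ⁅S, Y⁆⁆ := by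
          simp only [Ring.lie_def]; noncomm_ring
        rw [h1, hSX, hSY]
        simp only [Ring.lie_def, smul_mul_assoc, mul_smul_comm, ← smul_sub, ← add_smul]
        congr 1
        push_cast
        ring
      · ext1 z
        simp only [Ring.lie_def, smul_mul_assoc, mul_smul_comm, smul_smul, smul_sub]
        congr 2 <;> ring

/-- `ad_γ : H^0(U_0) → H^1(U_0)` for `γ ∈ H^1(U_0)`. -/
noncomputable def adH (γ : G.H1 S p q) : G.H0 S p q →ₗ[ℂ] G.H1 S p q where
  toFun u := ⟨fun z => ⁅(γ : MatFun n) z, (u : MatFun n) z⁆, G.lie_mem_H1 S p q γ.2 u.2⟩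
  map_add' u v := Subtype.ext (by ext1 z; simp [Ring.lie_def]; noncomm_ring)
  map_smul' c u := Subtype.ext (by ext1 z; simp [Ring.lie_def, smul_sub])

/-- The inclusion `H^0(U_0) → U_0^0`. -/
noncomputable def inclH0 : G.H0 S p q →ₗ[ℂ] G.U0 S p q := Submodule.inclusion (G.H0_le S p q)

/-- The inclusion `H^1(U_0) → U_0^1`. -/
noncomputable def inclH1 : G.H1 S p q →ₗ[ℂ] G.U1 S p q := Submodule.inclusion (G.H1_le S p q)

/-- The twisted differential `δ_S + ad_γ : U_0^0 → U_0^1`. -/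
noncomputable def twistedDiff (γ : G.U1 S p q) : G.U0 S p q →ₗ[ℂ] G.U1 S p q :=
  G.delta S p q + G.adU S p q γ

theorem delta_H0 (u : G.H0 S p q) : G.delta S p q (G.inclH0 S p q u) = 0 := by
  apply Subtype.ext
  obtain ⟨u, hu⟩ := u
  change vderiv (hamField p q) u = 0
  induction hu using Submodule.span_induction with
  | zero => exact vderiv_const _ 0
  | add u v hu hv h1 h2 =>
    have := vderiv_add (hamField p q) (G.H0_le S p q hu).1 (G.H0_le S p q hv).1
    refine this.trans ?_
    rw [h1, h2]
    ext1 z; simp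
  | smul c u hu h1 =>
    have := vderiv_smul (hamField p q) c (G.H0_le S p q hu).1
    refine this.trans ?_
    rw [h1]
    ext1 z; simp
  | mem u hu =>
    obtain ⟨c, X, hX, -, rfl⟩ := hu
    have hm : AnalyticOnNhd ℂ (fun z => curveFn p q z ^ c) Set.univ :=
      fun z _ => (curveFn_analytic p q z).pow c
    rw [vderiv_scal (hamField p q) hm (IsHol.const X), vderiv_const]
    ext1 z
    have hf : HasFDerivAt (curveFn p q) _ z :=
      (hasFDerivAt_fst_pow p z).sub (hasFDerivAt_snd_pow q z)
    have h : HasFDerivAt (fun z => curveFn p q z ^ c) _ z :=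
      (hasDerivAt_pow c (curveFn p q z)).comp_hasFDerivAt z hf
    rw [h.fderiv]
    have h0 : (p : ℂ) * z.1 ^ (p - 1) * (q * z.2 ^ (q - 1))
        - q * z.2 ^ (q - 1) * (p * z.1 ^ (p - 1)) = 0 := by ring
    simp [hamField, h0]

/-- `(H^•, ad_γ) → (U_0^•, δ_S + ad_γ)` is a chain map. -/
theorem inclusion_comm (γ : G.H1 S p q) :
    G.inclH1 S p q ∘ₗ G.adH S p q γ
      = G.twistedDiff S p q (G.inclH1 S p q γ) ∘ₗ G.inclH0 S p q := by
  ext1 u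
  simp only [twistedDiff, LinearMap.comp_apply, LinearMap.add_apply, delta_H0, zero_add]
  rfl

/-- The gauge action `g * γ = g γ g⁻¹ - δ_S(g) g⁻¹`; for `g` in `Aut(S)` one has
`δ_S(g) g⁻¹ = V(g) g⁻¹ β`. -/
noncomputable def gaugeAct (g : ℂ × ℂ → GL (Fin n) ℂ) (γ : MatFun n) : MatFun n := fun z =>
  (g z : Mat n) * γ z * (((g z)⁻¹ : GL (Fin n) ℂ) : Mat n)
    - vderiv (hamField p q) (fun w => (g w : Mat n)) z * (((g z)⁻¹ : GL (Fin n) ℂ) : Mat n)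

theorem gaugeAct_mem {g : ℂ × ℂ → GL (Fin n) ℂ} (hg : g ∈ G.aut S p q) {γ : MatFun n}
    (hγ : γ ∈ G.U1 S p q) : gaugeAct p q g γ ∈ G.U1 S p q := by
  obtain ⟨⟨hhol, hG⟩, hpres⟩ := hg
  have hE : vderiv (eulerField p q) (fun w => (g w : Mat n))
      = fun z => (g z : Mat n) * S - S * (g z : Mat n) :=
    funext fun z => (preserves_iff S p q g z).1 (hpres z)
  have hV : IsHol (vderiv (hamField p q) (fun w => (g w : Mat n))) :=
    hhol.vderiv (hamField_analytic p q)
  refine ⟨((hhol.mul hγ.1).mul hhol.inv).sub (hV.mul hhol.inv), fun z => ?_, fun z => ?_⟩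
  · exact G.lieAlgebra.sub_mem (conj_mem G.zariskiClosed (hG z) (hγ.2.1 z))
      (vderiv_logDeriv_mem _ G.zariskiClosed hhol hG z)
  · have h1 := congrFun (vderiv_sub (eulerField p q) ((hhol.mul hγ.1).mul hhol.inv)
      (hV.mul hhol.inv)) z
    have h2 := congrFun (vderiv_mul (eulerField p q) (hhol.mul hγ.1) hhol.inv) z
    have h3 := congrFun (vderiv_mul (eulerField p q) hhol hγ.1) z
    have h4 := congrFun (vderiv_mul (eulerField p q) hV hhol.inv) z
    have h5 := vderiv_inv (eulerField p q) hhol z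
    have h6 := vderiv_comm p q hhol z
    have h7 := eq_sub_of_add_eq (hγ.2.2 z)
    have h8 : vderiv (hamField p q) (vderiv (eulerField p q) (fun w => (g w : Mat n))) z
        = vderiv (hamField p q) (fun w => (g w : Mat n)) z * S
          - S * vderiv (hamField p q) (fun w => (g w : Mat n)) z := by
      rw [hE, vderiv_sub _ (hhol.mul (IsHol.const S)) ((IsHol.const S).mul hhol),
        vderiv_mul _ hhol (IsHol.const S), vderiv_mul _ (IsHol.const S) hhol, vderiv_const]
      simp
    have h9 := congrFun hE z
    unfold gaugeAct
    rw [h1, h2, h3, h4, h5, h6, h7, h8, h9]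
    have hi1 : (((g z)⁻¹ : GL (Fin n) ℂ) : Mat n) * (g z : Mat n) = 1 := Units.inv_mul _
    have hi2 : (g z : Mat n) * (((g z)⁻¹ : GL (Fin n) ℂ) : Mat n) = 1 := Units.mul_inv _
    generalize (((g z)⁻¹ : GL (Fin n) ℂ) : Mat n) = b at *
    generalize vderiv (hamField p q) (fun w => (g w : Mat n)) z = v at *
    generalize γ z = c at *
    generalize (g z : Mat n) = a at *
    have hk : b * (a * S - S * a) * b = S * b - b * S := by
      rw [mul_sub, sub_mul, ← mul_assoc, hi1, one_mul, mul_assoc b, mul_assoc S, hi2, mul_one]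
    rw [hk]
    simp only [Ring.lie_def, sub_mul, mul_sub, add_mul, smul_mul_assoc, mul_smul_comm,
      smul_sub, mul_neg, mul_assoc]
    abel

/-- The gauge action of `Aut(S)` on `U_0^1`. -/
noncomputable instance : MulAction (G.aut S p q) (G.U1 S p q) where
  smul g γ := ⟨gaugeAct p q g γ, G.gaugeAct_mem S p q g.2 γ.2⟩
  one_smul γ := by
    apply Subtype.ext
    ext1 z
    change gaugeAct p q (fun _ => 1) (γ : MatFun n) z = _
    simp [gaugeAct, vderiv_const]
  mul_smul g h γ := by
    apply Subtype.ext
    ext1 z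
    change gaugeAct p q ((g : ℂ × ℂ → GL (Fin n) ℂ) * (h : ℂ × ℂ → GL (Fin n) ℂ)) (γ : MatFun n) z
      = gaugeAct p q g (gaugeAct p q h γ) z
    have h1 := congrFun (vderiv_mul (hamField p q) g.2.1.1 h.2.1.1) z
    simp only [gaugeAct, Pi.mul_apply, Units.val_mul, _root_.mul_inv_rev]
    rw [h1]
    have hi : ((h : ℂ × ℂ → GL (Fin n) ℂ) z : Mat n)
        * ((((h : ℂ × ℂ → GL (Fin n) ℂ) z)⁻¹ : GL (Fin n) ℂ) : Mat n) = 1 := Units.mul_inv _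
    generalize ((((h : ℂ × ℂ → GL (Fin n) ℂ) z)⁻¹ : GL (Fin n) ℂ) : Mat n) = hb at *
    rw [add_mul]
    have h2 : ∀ v w : Mat n, v * ((h : ℂ × ℂ → GL (Fin n) ℂ) z : Mat n) * (hb * w) = v * w := by
      intro v w
      rw [mul_assoc, ← mul_assoc _ hb, hi, one_mul]
    rw [h2]
    noncomm_ring

theorem coe_smul (g : G.aut S p q) (γ : G.U1 S p q) :
    ((g • γ : G.U1 S p q) : MatFun n) = gaugeAct p q g γ := rfl

/-- The real part `a` of a semisimple matrix `S = a + i b`: the value at `S` of the interpolation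
polynomial taking the value `Re l` at each eigenvalue `l` of `S`. So if `S` is diagonal with
entries `l_k` in some basis, then `a` is diagonal with entries `Re l_k` in this basis. -/
noncomputable def rePart : Mat n :=
  Polynomial.aeval S
    (Lagrange.interpolate S.charpoly.roots.toFinset id fun l => ((l.re : ℝ) : ℂ))

/-- `z ^ a g z ^ (-a)` at the point `z = r exp (i θ)` of a ray, where `z ^ a = exp (log z a)`. -/
noncomputable def rayConj (a : Mat n) (g : GL (Fin n) ℂ) (θ r : ℝ) : GL (Fin n) ℂ :=
  expGL (((Real.log r : ℂ) + θ * Complex.I) • a) * g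
    * (expGL (((Real.log r : ℂ) + θ * Complex.I) • a))⁻¹

/-- `P(a)`: the elements `g` of `G` such that `z ^ a g z ^ (-a)` has a limit in `G` as `z → 0` along
any ray. -/
noncomputable def parabolic (a : Mat n) : Subgroup (GL (Fin n) ℂ) where
  carrier := {g | g ∈ G.toSubgroup ∧ ∀ θ : ℝ, ∃ h ∈ G.toSubgroup,
    Tendsto (rayConj a g θ) (𝓝[>] 0) (𝓝 h)}
  mul_mem' := fun {g g'} hg hg' => by
    refine ⟨G.toSubgroup.mul_mem hg.1 hg'.1, fun θ => ?_⟩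
    obtain ⟨h, hh, ht⟩ := hg.2 θ
    obtain ⟨h', hh', ht'⟩ := hg'.2 θ
    refine ⟨h * h', G.toSubgroup.mul_mem hh hh', ?_⟩
    have : rayConj a (g * g') θ = fun r => rayConj a g θ r * rayConj a g' θ r := by
      ext1 r; simp only [rayConj]; group
    rw [this]
    exact ht.mul ht'
  one_mem' := by
    refine ⟨G.toSubgroup.one_mem, fun θ => ⟨1, G.toSubgroup.one_mem, ?_⟩⟩
    have : rayConj a 1 θ = fun _ => 1 := by
      ext1 r; simp only [rayConj]; group
    rw [this]
    exact tendsto_const_nhds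
  inv_mem' := fun {g} hg => by
    refine ⟨G.toSubgroup.inv_mem hg.1, fun θ => ?_⟩
    obtain ⟨h, hh, ht⟩ := hg.2 θ
    refine ⟨h⁻¹, G.toSubgroup.inv_mem hh, ?_⟩
    have : rayConj a g⁻¹ θ = fun r => (rayConj a g θ r)⁻¹ := by
      ext1 r; simp only [rayConj]; group
    rw [this]
    exact ht.inv

/-- `P_S = C_G(exp (-2πi S / (qp))) ∩ P(-a / (qp))`, where `a` is the real part of `S`. -/
noncomputable def pS : Subgroup (GL (Fin n) ℂ) :=
  Subgroup.centralizer {expGL ((-2 * Real.pi * Complex.I / (q * p) : ℂ) • S)} ⊓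
    G.parabolic ((-1 / (q * p) : ℂ) • rePart S)

/-- `φ : ℂ → G` is an automorphism of the logarithmic connection `d + (S / (qp)) dlog t` on `ℂ`:
it is holomorphic and `φ (S / (qp)) φ⁻¹ - t φ'(t) φ⁻¹ = S / (qp)`. -/
def IsAutOnLine (φ : ℂ → GL (Fin n) ℂ) : Prop :=
  (∀ i j, Differentiable ℂ fun t => (φ t : Mat n) i j) ∧ (∀ t, φ t ∈ G.toSubgroup) ∧
    ∀ t : ℂ, (φ t : Mat n) * ((1 / (q * p) : ℂ) • S) * (((φ t)⁻¹ : GL (Fin n) ℂ) : Mat n)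
      - (t • Matrix.of fun i j => deriv (fun s => (φ s : Mat n) i j) t)
        * (((φ t)⁻¹ : GL (Fin n) ℂ) : Mat n) = (1 / (q * p) : ℂ) • S

/-- The embedding of `P_S` in `Aut(S)`: it sends `h` to `φ ∘ f`, where `φ` is the automorphism of
`d + (S / (qp)) dlog t` with `φ 1 = h`. (So it is injective, and it is unique as `φ` solves a linear
ordinary differential equation.) Moreover, the gauge action of `P_S` preserves `H^1(U_0)`. -/
structure ParabolicEmbedding where
  toHom : G.pS S p q →* G.aut S p q
  pullback : ∀ h : G.pS S p q, ∃ φ : ℂ → GL (Fin n) ℂ, G.IsAutOnLine S p q φ ∧ φ 1 = h ∧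
    ∀ z, (toHom h : ℂ × ℂ → GL (Fin n) ℂ) z = φ (curveFn p q z)
  preserves : ∀ (h : G.pS S p q) (γ : G.H1 S p q),
    ((toHom h • G.inclH1 S p q γ : G.U1 S p q) : MatFun n) ∈ G.H1 S p q

namespace ParabolicEmbedding

variable {G S p q} (j : G.ParabolicEmbedding S p q)

/-- The space `H^1(U_0)` with the gauge action of `P_S`. -/
def Rep (_j : G.ParabolicEmbedding S p q) : Type := G.H1 S p q

noncomputable instance : SMul (G.pS S p q) j.Rep where
  smul h γ := (⟨_, j.preserves h γ⟩ : G.H1 S p q)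

/-- The inclusion `H^1(U_0) ⊆ U_0^1`. -/
noncomputable def toU1 (γ : j.Rep) : G.U1 S p q := G.inclH1 S p q γ

theorem toU1_injective : Function.Injective j.toU1 := Submodule.inclusion_injective _

theorem toU1_smul (h : G.pS S p q) (γ : j.Rep) : j.toU1 (h • γ) = j.toHom h • j.toU1 γ := rfl

noncomputable instance : MulAction (G.pS S p q) j.Rep where
  one_smul γ := j.toU1_injective (by rw [toU1_smul, map_one, one_smul])
  mul_smul g h γ := j.toU1_injective (by simp only [toU1_smul, map_mul, mul_smul])

open CategoryTheory in
/-- The inclusion of action groupoids `P_S ⋉ H^1(U_0) → Aut(S) ⋉ U_0^1`. -/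
noncomputable def inclusion :
    ActionCategory (G.pS S p q) j.Rep ⥤ ActionCategory (G.aut S p q) (G.U1 S p q) where
  obj x := (j.toU1 x.back : ActionCategory (G.aut S p q) (G.U1 S p q))
  map {x y} f := ⟨j.toHom (show G.pS S p q from f.val), by
    have h : (show G.pS S p q from f.val) • x.back = y.back := f.2
    change j.toHom (show G.pS S p q from f.val) • j.toU1 x.back = j.toU1 y.back
    rw [← h, toU1_smul]⟩
  map_id x := Subtype.ext (map_one j.toHom)
  map_comp f g := Subtype.ext (map_mul j.toHom _ _)

/-- Morita equivalence for the inclusion of Lie groupoids `P_S ⋉ H^1(U_0) → Aut(S) ⋉ U_0^1`: it is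
fully faithful and essentially surjective (every orbit meets `H^1(U_0)`), and the action map
`Aut(S) × H^1(U_0) → U_0^1`, i.e. the target map on the arrows with source in `H^1(U_0)`, is a
submersion: at each point `(g, γ)` every tangent vector `v` of `U_0^1` is the velocity of the image
of a holomorphic curve through `(g, γ)`. -/
structure IsMoritaEquivalence : Prop where
  isEquivalence : j.inclusion.IsEquivalence
  submersive : ∀ (g : G.aut S p q) (γ : G.H1 S p q) (v : G.U1 S p q),
    ∃ (c : ℂ → G.aut S p q) (η : ℂ → G.H1 S p q), c 0 = g ∧ η 0 = γ ∧
      (∀ z a b, Differentiable ℂ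
        fun t => ((c t : ℂ × ℂ → GL (Fin n) ℂ) z : Mat n) a b) ∧
      (∀ z a b, Differentiable ℂ fun t => (η t : MatFun n) z a b) ∧
      ∀ z a b, HasDerivAt
        (fun t => ((c t • G.inclH1 S p q (η t) : G.U1 S p q) : MatFun n) z a b)
        ((v : MatFun n) z a b) 0

end ParabolicEmbedding

end ReductiveGroup

/-- The chain map `(f₀, f₁)` from the complex `d : A₀ → A₁` to the complex `d' : B₀ → B₁` (in degrees
`0` and `1`) is a quasi-isomorphism: it induces bijections of kernels and of cokernels. -/
def IsQuasiIso₂ {A₀ A₁ B₀ B₁ : Type*} [AddCommGroup A₀] [AddCommGroup A₁] [AddCommGroup B₀]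
    [AddCommGroup B₁] [Module ℂ A₀] [Module ℂ A₁] [Module ℂ B₀] [Module ℂ B₁]
    (d : A₀ →ₗ[ℂ] A₁) (d' : B₀ →ₗ[ℂ] B₁) (f₀ : A₀ →ₗ[ℂ] B₀) (f₁ : A₁ →ₗ[ℂ] B₁)
    (comm : f₁ ∘ₗ d = d' ∘ₗ f₀) : Prop :=
  Function.Bijective (f₀.restrict (p := LinearMap.ker d) (q := LinearMap.ker d') fun x hx => by
    have h := LinearMap.congr_fun comm x
    rw [LinearMap.mem_ker] at hx ⊢
    simpa [hx] using h.symm) ∧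
  Function.Bijective ((LinearMap.range d).mapQ (LinearMap.range d') f₁ (by
    rintro _ ⟨x, rfl⟩
    exact ⟨f₀ x, (LinearMap.congr_fun comm x).symm⟩))

/-- Semisimple, i.e. diagonalisable, matrices. -/
def IsSemisimple {n : ℕ} (S : Mat n) : Prop :=
  ∃ (P : GL (Fin n) ℂ) (d : Fin n → ℂ),
    S = (P : Mat n) * Matrix.diagonal d * ((P⁻¹ : GL (Fin n) ℂ) : Mat n)

/-- `S` is large enough: all positive integer eigenvalues of `ad_S` on `𝔤` exceed `w₀`. -/
def ReductiveGroup.LargeEnough {n : ℕ} (G : ReductiveGroup n) (S : Mat n) (p q : ℕ) : Prop :=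
  ∀ k : ℤ, 0 < k → (∃ X ∈ G.lieAlgebra, X ≠ 0 ∧ ⁅S, X⁆ = (k : ℂ) • X) → w₀ p q < k

end PlaneCurve

namespace PlaneCurve

open Matrix Set Filter Topology

variable {n : ℕ}

/-! ### Entrywise calculus of holomorphic matrix-valued maps. -/

section LinearMaps

/-! Everything follows from comparing weights. Holomorphic eigenfunctions of `E` are
quasihomogeneous polynomials (`eigenfunction_mem_quasiHom`), so an element of `U_0^•` splits into
components of weight `w` with coefficients in one eigenspace of `ad_S` (`comp_eq_zero_or`). As
`ad_S` has finitely many eigenvalues, only finitely many weights occur, and every induction on the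
lowest weight stops (`exists_order_bound`).

The field `V` raises weights by exactly `w₀`. The weights in `U_0^1` are nonnegative combinations of
`p` and `q`; the hypothesis on `S` excludes those below `w₀`, and `w₀` itself, the Frobenius number,
is no such combination. So every `γ` in `U_0^1` has order greater than `w₀` (`U1_le_orderGE`), and
multiplication by `γ` raises weights by more than `w₀`. To leading order both `δ_S + ad_γ` and the
gauge action are therefore governed by `V` alone.

For `V` two facts suffice. Every quasihomogeneous polynomial is the sum of some `V(u)` and a
combination of the monomials `f^c x^a y^b` with `a < p - 1`, `b < q - 1`
(`exists_eq_vderiv_add_complement`). Conversely, if `V(u)` is such a combination, then `u` is a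
multiple of a power of `f` and `V(u) = 0` (`eq_curveFn_pow_of_vderiv_mem_complement`).

The first fact, applied to the lowest weight again and again, gives surjectivity: linearly `U_0^1 =
H^1 + im(δ_S + ad_γ)`, hence surjectivity on cokernels and the submersion property; nonlinearly, by
gauging with exponentials, every orbit meets `H^1`. The second fact gives `mem_H0of_of_vderiv`: a
solution of `V(u) = u γ - γ' u + h` with `γ, γ', h` in `H^1` is a polynomial in `f`. Taking `γ = γ'`
yields the rest of the quasi-isomorphism. Taking `u = g` and `h = 0`, where the equation says `g * γ
= γ'`, shows that arrows between points of `H^1` are polynomials in `f`.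

Such a polynomial is determined by its value at `(1, 0)`, where `f = 1`, and these values form
exactly `P_S`. For `h` in `P_S` the centralizer condition makes the relevant eigenvalues of `ad_S`
multiples of `pq`, the existence of limits makes them nonpositive, and `t^{-S/(pq)} h t^{S/(pq)}` is
then a polynomial in `t` with values in `G`. -/

theorem linearMap_apply_eq_sum {M : Type*} [AddCommGroup M] [Module ℂ M] (L : Mat n →ₗ[ℂ] M)
    (A : Mat n) : L A = ∑ i, ∑ j, A i j • L (Matrix.single i j 1) := by
  conv_lhs => rw [Matrix.matrix_eq_sum_single A]
  simp only [map_sum]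
  refine Finset.sum_congr rfl fun i _ => Finset.sum_congr rfl fun j _ => ?_
  rw [← map_smul, Matrix.smul_single, smul_eq_mul, mul_one]

theorem linearMap_apply_apply (L : Mat n →ₗ[ℂ] Mat n) (A : Mat n) (a b : Fin n) :
    L A a b = ∑ i, ∑ j, A i j * L (Matrix.single i j 1) a b := by
  have h := congrArg (fun B : Mat n => B a b) (linearMap_apply_eq_sum L A)
  refine h.trans ?_
  rw [Matrix.sum_apply]
  refine Finset.sum_congr rfl fun i _ => ?_
  rw [Matrix.sum_apply]
  rfl

theorem IsHol.map (L : Mat n →ₗ[ℂ] Mat n) {u : MatFun n} (hu : IsHol u) :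
    IsHol (fun z => L (u z)) := by
  intro a b z hz
  rw [show (fun z => L (u z) a b) = fun z => ∑ i, ∑ j, u z i j * L (Matrix.single i j 1) a b from
    funext fun z => linearMap_apply_apply L (u z) a b]
  exact Finset.analyticAt_fun_sum _ fun i _ => Finset.analyticAt_fun_sum _ fun j _ =>
    (hu i j z hz).mul analyticAt_const

theorem vderiv_map (X : ℂ × ℂ → ℂ × ℂ) (L : Mat n →ₗ[ℂ] Mat n) {u : MatFun n} (hu : IsHol u) :
    vderiv X (fun z => L (u z)) = fun z => L (vderiv X u z) := by
  ext z a b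
  rw [vderiv_apply, linearMap_apply_apply L]
  rw [show (fun z => L (u z) a b) = fun z => ∑ i, ∑ j, u z i j * L (Matrix.single i j 1) a b from
    funext fun z => linearMap_apply_apply L (u z) a b]
  have h : HasFDerivAt (fun w => ∑ i, ∑ j, u w i j * L (Matrix.single i j 1) a b)
      (∑ i, ∑ j, (L (Matrix.single i j 1) a b) • fderiv ℂ (fun w => u w i j) z) z :=
    HasFDerivAt.fun_sum fun i _ => HasFDerivAt.fun_sum fun j _ =>
      (hu.diffAt z i j).hasFDerivAt.mul_const _
  rw [h.fderiv]
  simp [vderiv_apply, mul_comm]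

theorem IsHol.sum {ι : Type*} (s : Finset ι) {u : ι → MatFun n} (h : ∀ i ∈ s, IsHol (u i)) :
    IsHol (fun z => ∑ i ∈ s, u i z) := by
  classical
  induction s using Finset.induction_on with
  | empty => simpa using IsHol.const 0
  | insert a s ha ih =>
    simp only [Finset.sum_insert ha]
    exact (h a (by simp)).add (ih fun i hi => h i (by simp [hi]))

theorem vderiv_sum {ι : Type*} (X : ℂ × ℂ → ℂ × ℂ) (s : Finset ι) {u : ι → MatFun n}
    (h : ∀ i ∈ s, IsHol (u i)) :
    vderiv X (fun z => ∑ i ∈ s, u i z) = fun z => ∑ i ∈ s, vderiv X (u i) z := by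
  classical
  induction s using Finset.induction_on with
  | empty =>
    simp only [Finset.sum_empty]
    exact vderiv_const X 0
  | insert a s ha ih =>
    simp only [Finset.sum_insert ha]
    rw [vderiv_add X (h a (by simp)) (IsHol.sum s fun i hi => h i (by simp [hi])),
      ih fun i hi => h i (by simp [hi])]

theorem vderiv_add' (X : ℂ × ℂ → ℂ × ℂ) {u v : MatFun n} (hu : IsHol u) (hv : IsHol v) :
    vderiv X (u + v) = vderiv X u + vderiv X v := vderiv_add X hu hv

theorem vderiv_sub' (X : ℂ × ℂ → ℂ × ℂ) {u v : MatFun n} (hu : IsHol u) (hv : IsHol v) :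
    vderiv X (u - v) = vderiv X u - vderiv X v := vderiv_sub X hu hv

theorem vderiv_smul' (X : ℂ × ℂ → ℂ × ℂ) (c : ℂ) {u : MatFun n} (hu : IsHol u) :
    vderiv X (c • u) = c • vderiv X u := vderiv_smul X c hu

theorem vderiv_mul' (X : ℂ × ℂ → ℂ × ℂ) {u v : MatFun n} (hu : IsHol u) (hv : IsHol v) :
    vderiv X (u * v) = vderiv X u * v + u * vderiv X v := vderiv_mul X hu hv

end LinearMaps

/-! ### Weight spaces, quasihomogeneous polynomials and the order filtration. -/

section Weights

/-- Holomorphic maps `u : ℂ² → 𝔤𝔩_n` with `E(u) + [S, u] = k u`. -/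
noncomputable def weightGL (S : Mat n) (p q : ℕ) (k : ℤ) : Submodule ℂ (MatFun n) where
  carrier := {u | IsHol u ∧ ∀ z, vderiv (eulerField p q) u z + ⁅S, u z⁆ = (k : ℂ) • u z}
  add_mem' := fun {u v} hu hv => by
    refine ⟨hu.1.add hv.1, fun z => ?_⟩
    rw [vderiv_add' _ hu.1 hv.1, Pi.add_apply, Pi.add_apply, smul_add, ← hu.2 z, ← hv.2 z]
    simp only [Ring.lie_def]
    noncomm_ring
  zero_mem' := by
    refine ⟨IsHol.const 0, fun z => ?_⟩
    have h := congrFun (vderiv_const (eulerField p q) (0 : Mat n)) z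
    change vderiv _ (fun z => 0) z + ⁅S, (0 : Mat n)⁆ = _ • (0 : Mat n)
    rw [h]
    simp [Ring.lie_def]
  smul_mem' := fun c u hu => by
    refine ⟨IsHol.scal (m := fun _ => c) analyticOnNhd_const hu.1, fun z => ?_⟩
    rw [vderiv_smul' _ c hu.1, Pi.smul_apply, Pi.smul_apply, smul_comm, ← hu.2 z]
    simp [Ring.lie_def, smul_sub]

variable {S : Mat n} {p q : ℕ} {k l : ℤ} {u v : MatFun n}

theorem mem_weightSpace_iff (G : ReductiveGroup n) :
    u ∈ G.weightSpace S p q k ↔ u ∈ weightGL S p q k ∧ ∀ z, u z ∈ G.lieAlgebra :=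
  ⟨fun h => ⟨⟨h.1, h.2.2⟩, h.2.1⟩, fun h => ⟨h.1.1, h.2, h.1.2⟩⟩

/-- `E + ad_S` is a derivation of the associative product. This is why weights are also studied with
values in all matrices: powers, exponentials and elements of `Aut(S)` do not stay in `𝔤`. -/
theorem mul_mem_weightGL (hu : u ∈ weightGL S p q k) (hv : v ∈ weightGL S p q l) :
    u * v ∈ weightGL S p q (k + l) := by
  refine ⟨hu.1.mul hv.1, fun z => ?_⟩
  rw [vderiv_mul' _ hu.1 hv.1]
  have h1 := eq_sub_of_add_eq (hu.2 z)
  have h2 := eq_sub_of_add_eq (hv.2 z)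
  simp only [Pi.add_apply, Pi.mul_apply]
  rw [h1, h2]
  push_cast
  simp only [Ring.lie_def, sub_mul, mul_sub, smul_mul_assoc, mul_smul_comm, add_smul, mul_assoc]
  abel

theorem one_mem_weightGL : (1 : MatFun n) ∈ weightGL S p q 0 := by
  refine ⟨IsHol.const 1, fun z => ?_⟩
  have h := congrFun (vderiv_const (eulerField p q) (1 : Mat n)) z
  change vderiv _ (fun z => 1) z + ⁅S, (1 : Mat n)⁆ = _ • (1 : Mat n)
  rw [h]
  simp [Ring.lie_def]

theorem pow_mem_weightGL (hu : u ∈ weightGL S p q 0) (m : ℕ) : u ^ m ∈ weightGL S p q 0 := by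
  induction m with
  | zero => simpa using one_mem_weightGL
  | succ m ih =>
    rw [pow_succ]
    simpa using mul_mem_weightGL ih hu

/-- Matrix valued monomials. -/
def mono (m k : ℕ) (X : Mat n) : MatFun n := fun z => (z.1 ^ m * z.2 ^ k) • X

theorem mono_eq_monom (p q m k : ℕ) (X : Mat n) :
    mono m k X = fun z => monom p q 0 m k z • X := by
  funext z; simp [mono, monom]

theorem isHol_mono (m k : ℕ) (X : Mat n) : IsHol (mono m k X) := by
  rw [mono_eq_monom 0 0]
  exact (IsHol.const X).scal (monom_analytic 0 0 0 m k)

theorem mono_mul (m k m' k' : ℕ) (X Y : Mat n) :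
    mono m k X * mono m' k' Y = mono (m + m') (k + k') (X * Y) := by
  funext z
  simp only [Pi.mul_apply, mono, smul_mul_assoc, mul_smul_comm, smul_smul]
  congr 1; ring

theorem mono_add (m k : ℕ) (X Y : Mat n) : mono m k (X + Y) = mono m k X + mono m k Y := by
  funext z; simp [mono, smul_add]

theorem mono_smul (m k : ℕ) (c : ℂ) (X : Mat n) : mono m k (c • X) = c • mono m k X := by
  funext z; simp [mono, smul_comm c]

theorem vderiv_euler_mono (p q m k : ℕ) (X : Mat n) :
    vderiv (eulerField p q) (mono m k X) = ((q : ℂ) * m + p * k) • mono m k X := by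
  rw [mono_eq_monom p q, vderiv_scal _ (monom_analytic p q 0 m k) (IsHol.const X), vderiv_const]
  funext z
  rw [fderiv_monom_euler]
  simp [smul_smul]
  congr 1; ring

theorem vderiv_mono (F : ℂ × ℂ → ℂ × ℂ) (m k : ℕ) (X : Mat n) (z : ℂ × ℂ) :
    vderiv F (mono m k X) z
      = ((m * z.1 ^ (m - 1) * z.2 ^ k) * (F z).1 + (k * z.1 ^ m * z.2 ^ (k - 1)) * (F z).2) • X := by
  rw [mono_eq_monom 0 0, vderiv_scal _ (monom_analytic 0 0 0 m k) (IsHol.const X), vderiv_const]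
  have h : HasFDerivAt (fun z : ℂ × ℂ => z.1 ^ m * z.2 ^ k) _ z :=
    (hasFDerivAt_fst_pow m z).mul (hasFDerivAt_snd_pow k z)
  have h2 : monom 0 0 0 m k = fun z : ℂ × ℂ => z.1 ^ m * z.2 ^ k := by
    funext z; simp [monom]
  rw [h2]
  beta_reduce
  rw [h.fderiv]
  simp
  congr 1; ring

/-- Quasihomogeneous polynomials of weight `w` with coefficients in `W`. -/
def quasiHom (p q : ℕ) (W : Submodule ℂ (Mat n)) (w : ℤ) : Submodule ℂ (MatFun n) :=
  Submodule.span ℂ {u | ∃ (m k : ℕ) (X : Mat n), X ∈ W ∧ (q : ℤ) * m + p * k = w ∧ u = mono m k X}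

/-- Matrix valued polynomials all of whose monomials have weight at least `v`. -/
def orderGE (n p q : ℕ) (v : ℤ) : Submodule ℂ (MatFun n) :=
  Submodule.span ℂ {u | ∃ (m k : ℕ) (X : Mat n), v ≤ (q : ℤ) * m + p * k ∧ u = mono m k X}

/-- The span of the `f ^ c x ^ a y ^ b X` of weight `w` with `a < p - 1`, `b < q - 1`, `X ∈ W`. -/
def complement (p q : ℕ) (W : Submodule ℂ (Mat n)) (w : ℤ) : Submodule ℂ (MatFun n) :=
  Submodule.span ℂ {u | ∃ (c a b : ℕ) (X : Mat n), a + 1 < p ∧ b + 1 < q ∧ X ∈ W ∧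
    (c : ℤ) * (p * q) + a * q + b * p = w ∧ u = fun z => monom p q c a b z • X}

variable {W W' : Submodule ℂ (Mat n)} {w : ℤ}

theorem mono_mem_quasiHom {m k : ℕ} {X : Mat n} (hX : X ∈ W) (h : (q : ℤ) * m + p * k = w) :
    mono m k X ∈ quasiHom p q W w := Submodule.subset_span ⟨m, k, X, hX, h, rfl⟩

theorem quasiHom_mono (h : W ≤ W') : quasiHom p q W w ≤ quasiHom p q W' w := by
  refine Submodule.span_mono ?_
  rintro u ⟨m, k, X, hX, hw, rfl⟩
  exact ⟨m, k, X, h hX, hw, rfl⟩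

theorem complement_mono (h : W ≤ W') : complement p q W w ≤ complement p q W' w := by
  refine Submodule.span_mono ?_
  rintro u ⟨c, a, b, X, ha, hb, hX, hw, rfl⟩
  exact ⟨c, a, b, X, ha, hb, h hX, hw, rfl⟩

theorem quasiHom_le_orderGE {v : ℤ} (h : v ≤ w) : quasiHom p q W w ≤ orderGE n p q v := by
  refine Submodule.span_mono ?_
  rintro u ⟨m, k, X, hX, rfl, rfl⟩
  exact ⟨m, k, X, h, rfl⟩

theorem orderGE_anti {v v' : ℤ} (h : v ≤ v') : orderGE n p q v' ≤ orderGE n p q v := by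
  refine Submodule.span_mono ?_
  rintro u ⟨m, k, X, hw, rfl⟩
  exact ⟨m, k, X, h.trans hw, rfl⟩

theorem isHol_of_mem_orderGE {v : ℤ} (hu : u ∈ orderGE n p q v) : IsHol u := by
  induction hu using Submodule.span_induction with
  | zero => exact IsHol.const 0
  | add x y _ _ hx hy => exact hx.add hy
  | smul c x _ hx => exact IsHol.scal (m := fun _ => c) analyticOnNhd_const hx
  | mem x hx =>
    obtain ⟨m, k, X, -, rfl⟩ := hx
    exact isHol_mono m k X

theorem isHol_of_mem_quasiHom (hu : u ∈ quasiHom p q W w) : IsHol u :=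
  isHol_of_mem_orderGE (quasiHom_le_orderGE le_rfl hu)

theorem isHol_of_mem_complement (hu : u ∈ complement p q W w) : IsHol u := by
  induction hu using Submodule.span_induction with
  | zero => exact IsHol.const 0
  | add x y _ _ hx hy => exact hx.add hy
  | smul c x _ hx => exact IsHol.scal (m := fun _ => c) analyticOnNhd_const hx
  | mem x hx =>
    obtain ⟨c, a, b, X, -, -, -, -, rfl⟩ := hx
    exact (IsHol.const X).scal (monom_analytic p q c a b)

theorem mem_of_mem_quasiHom (hu : u ∈ quasiHom p q W w) (z : ℂ × ℂ) : u z ∈ W := by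
  induction hu using Submodule.span_induction with
  | zero => exact W.zero_mem
  | add x y _ _ hx hy => exact W.add_mem hx hy
  | smul c x _ hx => exact W.smul_mem c hx
  | mem x hx =>
    obtain ⟨m, k, X, hX, -, rfl⟩ := hx
    exact W.smul_mem _ hX

theorem vderiv_euler_of_mem_quasiHom (hu : u ∈ quasiHom p q W w) :
    vderiv (eulerField p q) u = (w : ℂ) • u := by
  induction hu using Submodule.span_induction with
  | zero => rw [smul_zero]; exact vderiv_const _ 0
  | add x y hx hy h1 h2 =>
    rw [vderiv_add' _ (isHol_of_mem_quasiHom hx) (isHol_of_mem_quasiHom hy), h1, h2, smul_add]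
  | smul c x hx h =>
    rw [vderiv_smul' _ _ (isHol_of_mem_quasiHom hx), h, smul_comm]
  | mem x hx =>
    obtain ⟨m, k, X, hX, rfl, rfl⟩ := hx
    rw [vderiv_euler_mono]
    push_cast
    rfl

theorem mul_mem_orderGE {v v' : ℤ} (hu : u ∈ orderGE n p q v) {u' : MatFun n}
    (hu' : u' ∈ orderGE n p q v') : u * u' ∈ orderGE n p q (v + v') := by
  induction hu using Submodule.span_induction with
  | zero => rw [zero_mul]; exact Submodule.zero_mem _
  | add x y _ _ hx hy => rw [add_mul]; exact Submodule.add_mem _ hx hy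
  | smul c x _ hx => rw [smul_mul_assoc]; exact Submodule.smul_mem _ _ hx
  | mem x hx =>
    obtain ⟨m, k, X, hm, rfl⟩ := hx
    induction hu' using Submodule.span_induction with
    | zero => rw [mul_zero]; exact Submodule.zero_mem _
    | add x y _ _ hx hy => rw [mul_add]; exact Submodule.add_mem _ hx hy
    | smul c x _ hx => rw [mul_smul_comm]; exact Submodule.smul_mem _ _ hx
    | mem x hx =>
      obtain ⟨m', k', X', hm', rfl⟩ := hx
      rw [mono_mul]
      refine Submodule.subset_span ⟨_, _, _, ?_, rfl⟩
      push_cast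
      linarith

theorem one_mem_orderGE {v : ℤ} (hv : v ≤ 0) : (1 : MatFun n) ∈ orderGE n p q v :=
  Submodule.subset_span ⟨0, 0, 1, by simpa using hv, by funext z; simp [mono]⟩

theorem pow_mem_orderGE {v : ℤ} (hu : u ∈ orderGE n p q v) (m : ℕ) :
    u ^ m ∈ orderGE n p q (m * v) := by
  induction m with
  | zero => simpa using one_mem_orderGE le_rfl
  | succ m ih =>
    rw [pow_succ]
    have := mul_mem_orderGE ih hu
    convert this using 2
    push_cast; ring

theorem map_mem_orderGE (L : Mat n →ₗ[ℂ] Mat n) {v : ℤ} (hu : u ∈ orderGE n p q v) :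
    (fun z => L (u z)) ∈ orderGE n p q v := by
  induction hu using Submodule.span_induction with
  | zero => convert! Submodule.zero_mem _ using 1; funext z; simp
  | add x y _ _ hx hy => convert! Submodule.add_mem _ hx hy using 1; funext z; simp
  | smul c x _ hx => convert! Submodule.smul_mem _ c hx using 1; funext z; simp
  | mem x hx =>
    obtain ⟨m, k, X, hm, rfl⟩ := hx
    refine Submodule.subset_span ⟨m, k, L X, hm, ?_⟩
    funext z; simp [mono]

theorem vderiv_ham_mono (m k : ℕ) (X : Mat n) : vderiv (hamField p q) (mono m k X)
    = ((q : ℂ) * m) • mono (m - 1) (k + (q - 1)) X + ((p : ℂ) * k) • mono (m + (p - 1)) (k - 1) X := by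
  funext z
  rw [vderiv_mono]
  simp only [hamField, mono, Pi.add_apply, Pi.smul_apply, smul_smul, ← add_smul, pow_add]
  congr 1
  ring

theorem vderiv_ham_mem_quasiHom (hp : 0 < p) (hq : 0 < q) (hu : u ∈ quasiHom p q W w) :
    vderiv (hamField p q) u ∈ quasiHom p q W (w + w₀ p q) := by
  induction hu using Submodule.span_induction with
  | zero =>
    have h : vderiv (hamField p q) (0 : MatFun n) = 0 := vderiv_const _ 0
    rw [h]; exact Submodule.zero_mem _
  | add x y hx hy h1 h2 =>
    rw [vderiv_add' _ (isHol_of_mem_quasiHom hx) (isHol_of_mem_quasiHom hy)]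
    exact Submodule.add_mem _ h1 h2
  | smul c x hx h =>
    rw [vderiv_smul' _ _ (isHol_of_mem_quasiHom hx)]
    exact Submodule.smul_mem _ _ h
  | mem x hx =>
    obtain ⟨m, k, X, hX, rfl, rfl⟩ := hx
    rw [vderiv_ham_mono]
    refine Submodule.add_mem _ ?_ ?_
    -- For `m = 0` the truncated exponent `m - 1` would give the wrong weight, but the coefficient
    -- is then zero.
    · rcases m with _ | m
      · simp
      · refine Submodule.smul_mem _ _ (mono_mem_quasiHom hX ?_)
        simp only [w₀]; push_cast [Nat.cast_sub (show 1 ≤ q from hq)]; ring_nf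
    · rcases k with _ | k
      · simp
      · refine Submodule.smul_mem _ _ (mono_mem_quasiHom hX ?_)
        simp only [w₀]; push_cast [Nat.cast_sub (show 1 ≤ p from hp)]; ring_nf

theorem quasiHom_of_mono {m k : ℕ} (X : Mat n) :
    mono m k X ∈ quasiHom p q ⊤ ((q : ℤ) * m + p * k) := mono_mem_quasiHom trivial rfl

theorem vderiv_ham_mem_orderGE (hp : 0 < p) (hq : 0 < q) {v : ℤ} (hu : u ∈ orderGE n p q v) :
    vderiv (hamField p q) u ∈ orderGE n p q (v + w₀ p q) := by
  induction hu using Submodule.span_induction with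
  | zero =>
    have h : vderiv (hamField p q) (0 : MatFun n) = 0 := vderiv_const _ 0
    rw [h]; exact Submodule.zero_mem _
  | add x y hx hy h1 h2 =>
    rw [vderiv_add' _ (isHol_of_mem_orderGE hx) (isHol_of_mem_orderGE hy)]
    exact Submodule.add_mem _ h1 h2
  | smul c x hx h =>
    rw [vderiv_smul' _ _ (isHol_of_mem_orderGE hx)]
    exact Submodule.smul_mem _ _ h
  | mem x hx =>
    obtain ⟨m, k, X, hm, rfl⟩ := hx
    exact quasiHom_le_orderGE (by linarith) (vderiv_ham_mem_quasiHom hp hq (quasiHom_of_mono X))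

theorem mul_curveFn_mem_quasiHom (hu : u ∈ quasiHom p q W w) :
    (fun z => curveFn p q z • u z) ∈ quasiHom p q W (w + p * q) := by
  induction hu using Submodule.span_induction with
  | zero => convert! Submodule.zero_mem _ using 1; funext z; simp
  | add x y _ _ hx hy => convert! Submodule.add_mem _ hx hy using 1; funext z; simp
  | smul c x _ hx =>
    simp only [Pi.smul_apply, smul_comm _ c]
    exact Submodule.smul_mem _ c hx
  | mem x hx =>
    obtain ⟨m, k, X, hX, rfl, rfl⟩ := hx
    have : (fun z => curveFn p q z • mono m k X z) = mono (m + p) k X - mono m (k + q) X := by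
      funext z
      simp only [mono, curveFn, Pi.sub_apply, smul_smul, ← sub_smul]
      congr 1; ring
    rw [this]
    refine Submodule.sub_mem _ (mono_mem_quasiHom hX ?_) (mono_mem_quasiHom hX ?_)
    · push_cast; ring
    · push_cast; ring

theorem monom_mem_quasiHom {c a b : ℕ} {X : Mat n} (hX : X ∈ W)
    (h : (c : ℤ) * (p * q) + a * q + b * p = w) :
    (fun z => monom p q c a b z • X) ∈ quasiHom p q W w := by
  induction c generalizing w with
  | zero =>
    rw [← mono_eq_monom]
    exact mono_mem_quasiHom hX (by push_cast at h; linarith)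
  | succ c ih =>
    have := mul_curveFn_mem_quasiHom (ih (w := w - p * q) (by push_cast at h; linarith))
    rw [sub_add_cancel] at this
    convert! this using 1
    funext z; simp only [smul_smul, monom]; congr 1; ring

theorem mul_curveFn_mem_complement (hu : u ∈ complement p q W w) :
    (fun z => curveFn p q z • u z) ∈ complement p q W (w + p * q) := by
  induction hu using Submodule.span_induction with
  | zero => convert! Submodule.zero_mem _ using 1; funext z; simp
  | add x y _ _ hx hy => convert! Submodule.add_mem _ hx hy using 1; funext z; simp
  | smul c x _ hx =>
    simp only [Pi.smul_apply, smul_comm _ c]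
    exact Submodule.smul_mem _ c hx
  | mem x hx =>
    obtain ⟨c, a, b, X, ha, hb, hX, rfl, rfl⟩ := hx
    refine Submodule.subset_span ⟨c + 1, a, b, X, ha, hb, hX, by push_cast; ring, ?_⟩
    funext z; simp only [smul_smul, monom]; congr 1; ring

/-- Up to sign `V` is the Hamiltonian field of `f`, so `f` is constant along it and differentiation
along `V` is `ℂ[f]`-linear. -/
theorem fderiv_curveFn_ham (z : ℂ × ℂ) : fderiv ℂ (curveFn p q) z (hamField p q z) = 0 := by
  have hf : HasFDerivAt (curveFn p q) _ z :=
    (hasFDerivAt_fst_pow p z).sub (hasFDerivAt_snd_pow q z)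
  rw [hf.fderiv]
  simp [hamField]
  ring

theorem vderiv_ham_mul_curveFn (hu : IsHol u) :
    vderiv (hamField p q) (fun z => curveFn p q z • u z)
      = fun z => curveFn p q z • vderiv (hamField p q) u z := by
  rw [vderiv_scal _ (fun z _ => curveFn_analytic p q z) hu]
  funext z
  simp [fderiv_curveFn_ham]

theorem vderiv_ham_mul_curveFn_pow (hu : IsHol u) (c : ℕ) :
    vderiv (hamField p q) (fun z => curveFn p q z ^ c • u z)
      = fun z => curveFn p q z ^ c • vderiv (hamField p q) u z := by
  induction c with
  | zero => simp
  | succ c ih =>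
    have h : IsHol fun z => curveFn p q z ^ c • u z :=
      hu.scal fun z _ => (curveFn_analytic p q z).pow c
    simp only [pow_succ', mul_smul]
    rw [vderiv_ham_mul_curveFn h, ih]

end Weights

/-! ### Integers that are not nonnegative combinations of `p` and `q`. -/

section Arithmetic

variable {p q : ℕ}

/-- The Frobenius number of `p, q` is not a nonnegative combination of `p` and `q`. -/
theorem w₀_not_representable (hp : 0 < p) (hcop : Nat.Coprime p q) (i j : ℕ) :
    (q : ℤ) * i + p * j ≠ w₀ p q := by
  intro h
  have h1 : (q : ℤ) * (i + 1) = p * (q - (j + 1)) := by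
    simp only [w₀] at h; linarith
  have h2 : p ∣ q * (i + 1) := by
    have : (p : ℤ) ∣ ((q * (i + 1) : ℕ) : ℤ) := ⟨_, by push_cast; exact h1⟩
    exact_mod_cast this
  -- Then `q(i + 1) ≥ pq`, which exceeds the right-hand side `p(q - j - 1)` of `h1`.
  have h3 : p ≤ i + 1 := Nat.le_of_dvd (by omega) (hcop.dvd_of_dvd_mul_left h2)
  have h4 : (p : ℤ) ≤ i + 1 := by exact_mod_cast h3
  have hp' : (0 : ℤ) < p := by exact_mod_cast hp
  have h5 : (0 : ℤ) ≤ q := by positivity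
  nlinarith [mul_le_mul_of_nonneg_left h4 h5, mul_nonneg hp'.le (Int.natCast_nonneg j)]

theorem le_of_modEq_of_lt {r i m : ℕ} (hr : r < m) (h : (m : ℤ) ∣ (i : ℤ) - r) : r ≤ i := by
  have h1 : r ≡ i [MOD m] := (Nat.modEq_iff_dvd).2 h
  have h2 : r % m = i % m := h1
  rw [Nat.mod_eq_of_lt hr] at h2
  rw [h2]
  exact Nat.mod_le _ _

/-- Equality would read `q(i - a - 1) + p(j - b - 1) + pq = 0`. Modulo `p` and `q` it gives `i ≡ a +
1` and `j ≡ b + 1`; since `a + 1 < p` and `b + 1 < q` are reduced residues, `i ≥ a + 1` and `j ≥ b +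
1`, and the left side is positive. -/
theorem shifted_not_representable (hq : 0 < q) (hp : 0 < p) (hcop : Nat.Coprime p q) {a b : ℕ}
    (ha : a + 1 < p) (hb : b + 1 < q) (i j : ℕ) :
    (q : ℤ) * i + p * j + w₀ p q ≠ a * q + b * p := by
  intro h
  simp only [w₀] at h
  have hc : IsCoprime (p : ℤ) (q : ℤ) := Nat.isCoprime_iff_coprime.2 hcop
  have h1 : (p : ℤ) ∣ (i : ℤ) - ((a + 1 : ℕ) : ℤ) := by
    refine hc.dvd_of_dvd_mul_left ⟨b + 1 - j - q, ?_⟩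
    push_cast; linarith
  have h2 : (q : ℤ) ∣ (j : ℤ) - ((b + 1 : ℕ) : ℤ) := by
    refine hc.symm.dvd_of_dvd_mul_left ⟨a + 1 - i - p, ?_⟩
    push_cast; linarith
  have h3 : ((a + 1 : ℕ) : ℤ) ≤ i := by exact_mod_cast le_of_modEq_of_lt ha h1
  have h4 : ((b + 1 : ℕ) : ℤ) ≤ j := by exact_mod_cast le_of_modEq_of_lt hb h2
  have hp' : (0 : ℤ) < p := by exact_mod_cast hp
  have hq' : (0 : ℤ) < q := by exact_mod_cast hq
  push_cast at h3 h4
  nlinarith [mul_le_mul_of_nonneg_left h3 hq'.le, mul_le_mul_of_nonneg_left h4 hp'.le,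
    mul_pos hp' hq']

end Arithmetic

/-! ### Image and kernel of `V` on quasihomogeneous polynomials. -/

section Decomposition

variable {p q : ℕ} {W : Submodule ℂ (Mat n)} {w : ℤ} {u : MatFun n}

theorem mul_curveFn_mono (m k : ℕ) (X : Mat n) :
    (fun z => curveFn p q z • mono m k X z) = mono (m + p) k X - mono m (k + q) X := by
  funext z
  simp only [mono, curveFn, Pi.sub_apply, smul_smul, ← sub_smul]
  congr 1; ring

/-- The quasihomogeneous maps are the sum of the image of `V` and `complement`. -/
theorem exists_mono_eq (hp : 0 < p) (hq : 0 < q) (N : ℕ) : ∀ (m k : ℕ), m + k < N →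
    ∀ X ∈ W, ∃ u ∈ quasiHom p q W ((q : ℤ) * m + p * k - w₀ p q),
      ∃ h ∈ complement p q W ((q : ℤ) * m + p * k),
        mono m k X = vderiv (hamField p q) u + h := by
  have hq0 : (q : ℂ) ≠ 0 := by exact_mod_cast hq.ne'
  have hp0 : (p : ℂ) ≠ 0 := by exact_mod_cast hp.ne'
  induction N with
  | zero => intro m k h; omega
  | succ N ih =>
    -- an element of the image of `V` which is `d` times the monomial up to a multiple of `f`
    have key : ∀ (m k : ℕ) (X : Mat n), ∀ v ∈ quasiHom p q W ((q : ℤ) * m + p * k - w₀ p q),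
        ∀ (e d : ℂ), d ≠ 0 → (e ≠ 0 → ∃ m' k' : ℕ, ∃ Y ∈ W, m' + k' < N ∧
          (q : ℤ) * m' + p * k' + p * q = q * m + p * k ∧
          vderiv (hamField p q) v = d • mono m k X + e • fun z => curveFn p q z • mono m' k' Y z) →
        (e = 0 → vderiv (hamField p q) v = d • mono m k X) →
        ∃ u ∈ quasiHom p q W ((q : ℤ) * m + p * k - w₀ p q),
          ∃ h ∈ complement p q W ((q : ℤ) * m + p * k),
            mono m k X = vderiv (hamField p q) u + h := by
      intro m k X v hv e d hd he he0
      by_cases hez : e = 0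
      · refine ⟨d⁻¹ • v, Submodule.smul_mem _ _ hv, 0, Submodule.zero_mem _, ?_⟩
        rw [vderiv_smul' _ _ (isHol_of_mem_quasiHom hv), he0 hez, smul_smul, inv_mul_cancel₀ hd,
          one_smul, add_zero]
      -- The cofactor of `f` has smaller degree, so it is already decomposed; multiplying that
      -- decomposition by `f` is harmless because `V` commutes with `f` and `complement` is stable
      -- under it.
      · obtain ⟨m', k', Y, hY, hN, hw, hV⟩ := he hez
        obtain ⟨u', hu', h', hh', hm⟩ := ih m' k' hN Y hY
        have hu1 := mul_curveFn_mem_quasiHom hu'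
        have hh1 := mul_curveFn_mem_complement hh'
        rw [show (q : ℤ) * m' + p * k' - w₀ p q + p * q = (q : ℤ) * m + p * k - w₀ p q by
          linarith] at hu1
        rw [hw] at hh1
        have hV2 := vderiv_ham_mul_curveFn (p := p) (q := q) (isHol_of_mem_quasiHom hu')
        refine ⟨d⁻¹ • v - (d⁻¹ * e) • fun z => curveFn p q z • u' z,
          Submodule.sub_mem _ (Submodule.smul_mem _ _ hv) (Submodule.smul_mem _ _ hu1),
          - ((d⁻¹ * e) • fun z => curveFn p q z • h' z),
          Submodule.neg_mem _ (Submodule.smul_mem _ _ hh1), ?_⟩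
        have hH1 := isHol_of_mem_quasiHom hv
        have hH2 := isHol_of_mem_quasiHom hu1
        rw [vderiv_sub' _ (isHol_of_mem_quasiHom (Submodule.smul_mem _ _ hv))
          (isHol_of_mem_quasiHom (Submodule.smul_mem _ _ hu1)), vderiv_smul' _ _ hH1,
          vderiv_smul' _ _ hH2, hV2, hV, hm]
        funext z
        simp only [Pi.add_apply, Pi.sub_apply, Pi.smul_apply, Pi.neg_apply, smul_add, smul_smul,
          inv_mul_cancel₀ hd, one_smul]
        module
    intro m k hN X hX
    have hp1 : ((p - 1 : ℕ) : ℤ) = p - 1 := by push_cast [Nat.cast_sub (show 1 ≤ p from hp)]; rfl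
    have hq1 : ((q - 1 : ℕ) : ℤ) = q - 1 := by push_cast [Nat.cast_sub (show 1 ≤ q from hq)]; rfl
    -- With `i = m + 1 - p` and `y^q = x^p - f`, one has `V(x^i y^(k+1)) = (qi + p(k+1)) x^m y^k -
    -- qi f x^(i-1) y^k`. The leading coefficient is a positive integer, hence invertible.
    by_cases hm : p ≤ m + 1
    · obtain ⟨i, hi⟩ := Nat.exists_eq_add_of_le hm
      have hiz : (m : ℤ) + 1 = p + i := by exact_mod_cast hi
      have hd : (q : ℂ) * i + p * (k + 1) ≠ 0 := by
        have : 0 < q * i + p * (k + 1) := by positivity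
        exact_mod_cast this.ne'
      refine key m k X (mono i (k + 1) X) (mono_mem_quasiHom hX ?_) (-((q : ℂ) * i)) _ hd ?_ ?_
      · simp only [w₀]; push_cast; linear_combination (-(q : ℤ)) * hiz
      · intro he
        obtain ⟨i, rfl⟩ : ∃ i', i = i' + 1 := Nat.exists_eq_succ_of_ne_zero (by
          rintro rfl; simp at he)
        refine ⟨i, k, X, hX, by omega, by push_cast at hiz; linear_combination (-(q : ℤ)) * hiz, ?_⟩
        rw [vderiv_ham_mono, mul_curveFn_mono]
        rw [show i + 1 - 1 = i by omega, show k + 1 + (q - 1) = k + q by omega,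
          show i + 1 + (p - 1) = m by omega, show k + 1 - 1 = k by omega, show i + p = m by omega]
        push_cast
        module
      · intro he
        have hi0 : (i : ℂ) = 0 := by simpa [hq0] using he
        have hi0' : i = 0 := by exact_mod_cast hi0
        subst hi0'
        rw [vderiv_ham_mono, show 0 + (p - 1) = m by omega, show k + 1 - 1 = k by omega]
        simp
    -- Symmetrically, with `j = k + 1 - q` and `x^p = y^q + f`, one has `V(x^(m+1) y^j) = (q(m+1) +
    -- pj) x^m y^k + pj f x^m y^(j-1)`.
    · by_cases hk : q ≤ k + 1
      · obtain ⟨j, hj⟩ := Nat.exists_eq_add_of_le hk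
        have hjz : (k : ℤ) + 1 = q + j := by exact_mod_cast hj
        have hd : (q : ℂ) * (m + 1) + p * j ≠ 0 := by
          have : 0 < q * (m + 1) + p * j := by positivity
          exact_mod_cast this.ne'
        refine key m k X (mono (m + 1) j X) (mono_mem_quasiHom hX ?_) ((p : ℂ) * j) _ hd ?_ ?_
        · simp only [w₀]; push_cast; linear_combination (-(p : ℤ)) * hjz
        · intro he
          obtain ⟨j, rfl⟩ : ∃ j', j = j' + 1 := Nat.exists_eq_succ_of_ne_zero (by
            rintro rfl; simp at he)
          refine ⟨m, j, X, hX, by omega, by push_cast at hjz; linear_combination (-(p : ℤ)) * hjz,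
            ?_⟩
          rw [vderiv_ham_mono, mul_curveFn_mono]
          rw [show m + 1 - 1 = m by omega, show j + 1 + (q - 1) = k by omega,
            show m + 1 + (p - 1) = m + p by omega, show j + 1 - 1 = j by omega,
            show j + q = k by omega]
          push_cast
          module
        · intro he
          have hj0 : (j : ℂ) = 0 := by simpa [hp0] using he
          have hj0' : j = 0 := by exact_mod_cast hj0
          subst hj0'
          rw [vderiv_ham_mono, show 0 + (q - 1) = k by omega, show m + 1 - 1 = m by omega]
          simp
      · refine ⟨0, Submodule.zero_mem _, mono m k X, Submodule.subset_span
          ⟨0, m, k, X, by omega, by omega, hX, by push_cast; ring, mono_eq_monom p q m k X⟩, ?_⟩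
        have h : vderiv (hamField p q) (0 : MatFun n) = 0 := vderiv_const _ 0
        rw [h, zero_add]

theorem exists_eq_vderiv_add_complement (hp : 0 < p) (hq : 0 < q) (hu : u ∈ quasiHom p q W w) :
    ∃ u' ∈ quasiHom p q W (w - w₀ p q), ∃ h ∈ complement p q W w,
      u = vderiv (hamField p q) u' + h := by
  induction hu using Submodule.span_induction with
  | zero =>
    refine ⟨0, Submodule.zero_mem _, 0, Submodule.zero_mem _, ?_⟩
    rw [show vderiv (hamField p q) (0 : MatFun n) = 0 from vderiv_const _ 0, zero_add]
  | add x y _ _ hx hy =>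
    obtain ⟨u, hu, h, hh, rfl⟩ := hx
    obtain ⟨u', hu', h', hh', rfl⟩ := hy
    refine ⟨u + u', Submodule.add_mem _ hu hu', h + h', Submodule.add_mem _ hh hh', ?_⟩
    rw [vderiv_add' _ (isHol_of_mem_quasiHom hu) (isHol_of_mem_quasiHom hu')]
    abel
  | smul c x _ hx =>
    obtain ⟨u, hu, h, hh, rfl⟩ := hx
    refine ⟨c • u, Submodule.smul_mem _ _ hu, c • h, Submodule.smul_mem _ _ hh, ?_⟩
    rw [vderiv_smul' _ _ (isHol_of_mem_quasiHom hu), smul_add]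
  | mem x hx =>
    obtain ⟨m, k, X, hX, rfl, rfl⟩ := hx
    exact exists_mono_eq hp hq _ m k (Nat.lt_succ_self _) X hX

/-- The cofactor is the geometric sum of `(x^p)^s - (y^q)^s` divided by `x^p - y^q`. -/
theorem exists_pow_sub_pow (m k s : ℕ) {X : Mat n} (hX : X ∈ W) :
    ∃ u ∈ quasiHom p q W ((q : ℤ) * (m + p * s) + p * k - p * q),
      mono (m + p * s) k X - mono m (k + q * s) X = fun z => curveFn p q z • u z := by
  refine ⟨∑ i ∈ Finset.range s, mono (m + p * i) (k + q * (s - 1 - i)) X,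
    Submodule.sum_mem _ fun i hi => mono_mem_quasiHom hX ?_, ?_⟩
  · have hi' : i < s := Finset.mem_range.1 hi
    have : ((s - 1 - i : ℕ) : ℤ) = s - 1 - i := by omega
    push_cast
    rw [this]
    ring
  · funext z
    have h := (Commute.all (z.1 ^ p) (z.2 ^ q)).geom_sum₂_mul s
    simp only [Pi.sub_apply, mono, Finset.sum_apply, ← Finset.sum_smul, smul_smul, ← sub_smul]
    congr 1
    have h2 : ∑ i ∈ Finset.range s, z.1 ^ (m + p * i) * z.2 ^ (k + q * (s - 1 - i))
        = z.1 ^ m * z.2 ^ k * ∑ i ∈ Finset.range s, (z.1 ^ p) ^ i * (z.2 ^ q) ^ (s - 1 - i) := by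
      rw [Finset.mul_sum]
      refine Finset.sum_congr rfl fun i _ => ?_
      rw [pow_add, pow_add, pow_mul, pow_mul]; ring
    rw [h2, curveFn, pow_add, pow_add, pow_mul, pow_mul]
    linear_combination -(z.1 ^ m * z.2 ^ k) * h

/-- Two monomials of the same weight differ by a multiple of `f`. -/
theorem exists_mono_sub_mono (hp : 0 < p) (hcop : Nat.Coprime p q) {m k m' k' : ℕ}
    (h : (q : ℤ) * m + p * k = q * m' + p * k') {X : Mat n} (hX : X ∈ W) :
    ∃ u ∈ quasiHom p q W ((q : ℤ) * m + p * k - p * q),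
      mono m k X - mono m' k' X = fun z => curveFn p q z • u z := by
  wlog hle : m' ≤ m generalizing m k m' k'
  · obtain ⟨u, hu, hu'⟩ := this h.symm (by omega)
    rw [← h] at hu
    refine ⟨-u, Submodule.neg_mem _ hu, ?_⟩
    rw [← neg_sub, hu']
    funext z
    simp
  obtain ⟨r, rfl⟩ := Nat.exists_eq_add_of_le hle
  have h1 : q * r + p * k = p * k' := by
    have : (q : ℤ) * r + p * k = p * k' := by push_cast at h; linarith
    exact_mod_cast this
  have h2 : p ∣ q * r := (Nat.dvd_add_left (dvd_mul_right p k)).1 (h1 ▸ dvd_mul_right p k')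
  -- Coprimality makes the difference of the `x`-exponents a multiple `p s`, so that of the
  -- `y`-exponents is `q s`.
  obtain ⟨s, rfl⟩ := hcop.dvd_of_dvd_mul_left h2
  have h3 : k' = k + q * s := by
    apply Nat.eq_of_mul_eq_mul_left hp
    linarith
  subst h3
  have := exists_pow_sub_pow (p := p) (q := q) m' k s hX
  push_cast
  exact this

/-- Modulo `f` all monomials of one weight agree, and each equals `1` at the point `(1, 1)` of the
curve. So the value there is the coefficient modulo `f`; if it vanishes, `f` divides `u`. -/
theorem exists_sub_value_eq (hp : 0 < p) (hcop : Nat.Coprime p q) (m k : ℕ)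
    (hu : u ∈ quasiHom p q W ((q : ℤ) * m + p * k)) :
    ∃ u' ∈ quasiHom p q W ((q : ℤ) * m + p * k - p * q),
      u - mono m k (u (1, 1)) = fun z => curveFn p q z • u' z := by
  induction hu using Submodule.span_induction with
  | zero => exact ⟨0, Submodule.zero_mem _, by funext z; simp [mono]⟩
  | add x y _ _ hx hy =>
    obtain ⟨u, hu, hu'⟩ := hx
    obtain ⟨v, hv, hv'⟩ := hy
    refine ⟨u + v, Submodule.add_mem _ hu hv, ?_⟩
    rw [Pi.add_apply, mono_add, add_sub_add_comm, hu', hv']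
    funext z; simp
  | smul c x _ hx =>
    obtain ⟨u, hu, hu'⟩ := hx
    refine ⟨c • u, Submodule.smul_mem _ _ hu, ?_⟩
    rw [Pi.smul_apply, mono_smul, ← smul_sub, hu']
    funext z; simp [smul_comm c]
  | mem x hx =>
    obtain ⟨m', k', X, hX, hw, rfl⟩ := hx
    obtain ⟨v, hv, hv'⟩ := exists_mono_sub_mono hp hcop hw hX
    rw [hw] at hv
    refine ⟨v, hv, ?_⟩
    rw [← hv']
    simp [mono]

theorem quasiHom_eq_zero_or (hu : u ∈ quasiHom p q W w) :
    u = 0 ∨ ∃ m k : ℕ, w = (q : ℤ) * m + p * k := by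
  by_cases h : ∃ m k : ℕ, w = (q : ℤ) * m + p * k
  · exact Or.inr h
  · left
    induction hu using Submodule.span_induction with
    | zero => rfl
    | add x y _ _ hx hy => rw [hx, hy, add_zero]
    | smul c x _ hx => rw [hx, smul_zero]
    | mem x hx =>
      obtain ⟨m, k, X, -, hw, rfl⟩ := hx
      exact absurd ⟨m, k, hw.symm⟩ h

theorem quasiHom_eq_zero_of_neg (hu : u ∈ quasiHom p q W w) (hw : w < 0) : u = 0 := by
  rcases quasiHom_eq_zero_or hu with h | ⟨m, k, rfl⟩
  · exact h
  · exact absurd hw (not_lt.2 (by positivity))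

/-- On each line `y = const` the function `f` has isolated zeros, so `u` vanishes off a discrete set
and hence, by continuity, everywhere. -/
theorem vanish_of_curveFn_smul (hp : 0 < p) {u : MatFun n} (hu : IsHol u)
    (h : ∀ z, curveFn p q z • u z = 0) : u = 0 := by
  ext z i j
  have hc : Continuous fun z => u z i j := by
    rw [← continuousOn_univ]; exact (hu i j).continuousOn
  obtain ⟨x, y⟩ := z
  have h1 : ∀ᶠ t : ℂ in 𝓝[≠] x, u (t, y) i j = 0 := by
    have h2 : ∀ᶠ t : ℂ in 𝓝[≠] x, curveFn p q (t, y) ≠ 0 := by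
      have hd : Differentiable ℂ fun t : ℂ => curveFn p q (t, y) := by
        unfold curveFn; fun_prop
      have ha : AnalyticOnNhd ℂ (fun t : ℂ => curveFn p q (t, y)) Set.univ :=
        hd.differentiableOn.analyticOnNhd isOpen_univ
      rcases (ha x trivial).eventually_eq_zero_or_eventually_ne_zero with h3 | h3
      -- If `f(t, y)` vanished for all `t`, then `t = 0` would give `y^q = 0` and `t = 1` would give
      -- `y^q = 1`.
      · exfalso
        have h4 := ha.eqOn_zero_of_preconnected_of_eventuallyEq_zero isPreconnected_univ
          (Set.mem_univ x) h3
        have h5 := h4 (Set.mem_univ (0 : ℂ))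
        have h6 := h4 (Set.mem_univ (1 : ℂ))
        simp [curveFn, hp.ne'] at h5 h6
        rw [h5.1, zero_pow h5.2, sub_zero] at h6
        exact one_ne_zero h6
      · exact h3
    filter_upwards [h2] with t ht
    have := h (t, y)
    rw [smul_eq_zero] at this
    rw [this.resolve_left ht]; rfl
  have hc2 : Continuous fun t : ℂ => u (t, y) i j := hc.comp (by fun_prop)
  have h3 : Tendsto (fun t : ℂ => u (t, y) i j) (𝓝[≠] x) (𝓝 (u (x, y) i j)) :=
    (hc2.tendsto x).mono_left nhdsWithin_le_nhds
  exact tendsto_nhds_unique h3 (tendsto_const_nhds.congr' (by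
    filter_upwards [h1] with t ht using ht.symm))

/-- By `shifted_not_representable`, no monomial `x^a y^b` in the box has weight `w + w₀` when `w` is
representable, so the generators with `c = 0` do not occur. -/
theorem exists_curveFn_factor (hp : 0 < p) (hq : 0 < q) (hcop : Nat.Coprime p q)
    (hu : ∃ m k : ℕ, w = (q : ℤ) * m + p * k) {h : MatFun n}
    (hh : h ∈ complement p q W (w + w₀ p q)) :
    ∃ h' ∈ complement p q W (w - p * q + w₀ p q), h = fun z => curveFn p q z • h' z := by
  induction hh using Submodule.span_induction with
  | zero => exact ⟨0, Submodule.zero_mem _, by funext z; simp⟩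
  | add x y _ _ hx hy =>
    obtain ⟨u, hu, rfl⟩ := hx
    obtain ⟨v, hv, rfl⟩ := hy
    exact ⟨u + v, Submodule.add_mem _ hu hv, by funext z; simp⟩
  | smul c x _ hx =>
    obtain ⟨u, hu, rfl⟩ := hx
    exact ⟨c • u, Submodule.smul_mem _ _ hu, by funext z; simp [smul_comm c]⟩
  | mem x hx =>
    obtain ⟨c, a, b, X, ha, hb, hX, hw, rfl⟩ := hx
    obtain ⟨m, k, rfl⟩ := hu
    rcases c with _ | c
    · exact absurd (by push_cast at hw; linarith) (shifted_not_representable hq hp hcop ha hb m k)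
    · refine ⟨fun z => monom p q c a b z • X,
        Submodule.subset_span ⟨c, a, b, X, ha, hb, hX, by push_cast at hw; linarith, rfl⟩, ?_⟩
      funext z; simp only [smul_smul, monom]; congr 1; ring

/-- If `u` is quasihomogeneous and `V(u)` lies in `complement`, then `u` is a multiple of a power
of `f`. -/
theorem eq_curveFn_pow_of_vderiv_mem_complement (hp : 0 < p) (hq : 0 < q)
    (hcop : Nat.Coprime p q) (N : ℕ) : ∀ {w : ℤ} {u : MatFun n}, w < N →
      u ∈ quasiHom p q ⊤ w → vderiv (hamField p q) u ∈ complement p q ⊤ (w + w₀ p q) →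
      u = 0 ∨ ∃ (d : ℕ) (R : Mat n), (d : ℤ) * (p * q) = w ∧ u = fun z => curveFn p q z ^ d • R := by
  induction N with
  | zero => intro w u hw hu _; exact Or.inl (quasiHom_eq_zero_of_neg hu (by simpa using hw))
  | succ N ih =>
    intro w u hw hu hV
    rcases quasiHom_eq_zero_or hu with h0 | hr
    · exact Or.inl h0
    obtain ⟨h', hh', hV'⟩ := exists_curveFn_factor hp hq hcop hr hV
    obtain ⟨m, k, rfl⟩ := hr
    obtain ⟨u', hu', hd⟩ := exists_sub_value_eq hp hcop m k hu
    -- In weight zero only constants exist. Otherwise the weight can be divided out, `u` is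
    -- divisible by `f`, and the induction continues with the quotient.
    by_cases hz : (q : ℤ) * m + p * k = 0
    · right
      refine ⟨0, u (1, 1), by simp [hz], ?_⟩
      have hpq : (0 : ℤ) < p * q := by positivity
      rw [quasiHom_eq_zero_of_neg hu' (by linarith)] at hd
      have hm : m = 0 ∧ k = 0 := by
        have h1 : q * m + p * k = 0 := by exact_mod_cast hz
        rw [Nat.add_eq_zero_iff] at h1
        simpa [hp.ne', hq.ne'] using h1
      rw [hm.1, hm.2] at hd
      funext z
      have := congrFun hd z
      simp only [mono, Pi.sub_apply, Pi.zero_apply, smul_zero, pow_zero, mul_one, one_smul] at this ⊢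
      exact sub_eq_zero.1 this
    -- At `(1, 1)` both `V` and `E` equal `(q, p)`, so `V(u)` takes there the value `w u(1, 1)`. But
    -- `V(u)` is a multiple of `f`, which vanishes at this point.
    · have h1 : u (1, 1) = 0 := by
        have h2 := congrFun hV' (1, 1)
        have h3 := congrFun (vderiv_euler_of_mem_quasiHom hu) (1, 1)
        have h4 : vderiv (hamField p q) u (1, 1) = vderiv (eulerField p q) u (1, 1) := by
          ext i j
          simp [vderiv_apply, hamField, eulerField]
        rw [h4, h3] at h2
        simp only [curveFn, one_pow, sub_self, zero_smul, Pi.smul_apply] at h2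
        exact (smul_eq_zero.1 h2).resolve_left (by exact_mod_cast hz)
      have hu1 : u = fun z => curveFn p q z • u' z := by
        rw [← hd, h1]
        funext z; simp [mono]
      have hV2 : vderiv (hamField p q) u' = h' := by
        have h5 : IsHol (vderiv (hamField p q) u' - h') :=
          ((isHol_of_mem_quasiHom hu').vderiv (hamField_analytic p q)).sub
            (isHol_of_mem_complement hh')
        refine sub_eq_zero.1 (vanish_of_curveFn_smul (p := p) (q := q) hp h5 fun z => ?_)
        have h6 := congrFun (vderiv_ham_mul_curveFn (p := p) (q := q) (isHol_of_mem_quasiHom hu')) z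
        rw [← hu1, hV'] at h6
        rw [Pi.sub_apply, smul_sub, ← h6, sub_self]
      have hpq : (0 : ℤ) < p * q := by positivity
      rcases ih (by push_cast at hw; linarith) hu' (hV2 ▸ hh') with h7 | ⟨d, R, hdw, h7⟩
      · left
        rw [hu1, h7]; funext z; simp
      · right
        refine ⟨d + 1, R, by push_cast; linarith, ?_⟩
        rw [hu1, h7]
        funext z; simp only [smul_smul, pow_succ']

end Decomposition

/-! ### Holomorphic eigenfunctions of the Euler field are polynomials. -/

section Euler

variable {p q : ℕ} {W : Submodule ℂ (Mat n)} {μ : ℂ} {u : MatFun n}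

/-- The flow of the Euler field. -/
noncomputable def eulerFlow (p q : ℕ) (z : ℂ × ℂ) (t : ℂ) : ℂ × ℂ :=
  (Complex.exp (q * t) * z.1, Complex.exp (p * t) * z.2)

theorem hasDerivAt_eulerFlow (z : ℂ × ℂ) (t : ℂ) :
    HasDerivAt (eulerFlow p q z) (eulerField p q (eulerFlow p q z t)) t := by
  have h : ∀ (k : ℕ) (x : ℂ), HasDerivAt (fun t : ℂ => Complex.exp (k * t) * x)
      ((k : ℂ) * (Complex.exp (k * t) * x)) t := by
    intro k x
    have h1 := (((hasDerivAt_id t).const_mul (k : ℂ)).cexp).mul_const x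
    convert! h1 using 1
    simp only [id, mul_one]; ring
  exact (h q z.1).prodMk (h p z.2)

theorem apply_eulerFlow (hu : IsHol u) (hE : vderiv (eulerField p q) u = μ • u) (z : ℂ × ℂ)
    (t : ℂ) (i j : Fin n) :
    Complex.exp (-(μ * t)) * u (eulerFlow p q z t) i j = u z i j := by
  have hg : ∀ s : ℂ, HasDerivAt (fun s => u (eulerFlow p q z s) i j)
      (μ * u (eulerFlow p q z s) i j) s := by
    intro s
    have h1 := (hu.diffAt (eulerFlow p q z s) i j).hasFDerivAt.comp_hasDerivAt s
      (hasDerivAt_eulerFlow (p := p) (q := q) z s)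
    have h2 := congrArg (fun A : Mat n => A i j) (congrFun hE (eulerFlow p q z s))
    simp only [vderiv_apply, Pi.smul_apply, Matrix.smul_apply, smul_eq_mul] at h2
    rw [h2] at h1
    exact h1
  have hF : ∀ s : ℂ, HasDerivAt (fun s => Complex.exp (-(μ * s)) * u (eulerFlow p q z s) i j)
      0 s := by
    intro s
    have h1 := (((hasDerivAt_id s).const_mul μ).neg.cexp).mul (hg s)
    convert! h1 using 1
    simp only [id, mul_one]; ring
  have h := is_const_of_deriv_eq_zero (fun s => (hF s).differentiableAt) (fun s => (hF s).deriv) t 0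
  rw [h]
  simp [eulerFlow]

/-- The function of `t` in the hypothesis is constant, equal to `u z i j`. -/
theorem eq_zero_of_tendsto (hu : IsHol u) (hE : vderiv (eulerField p q) u = μ • u)
    (h : ∀ z i j, Tendsto (fun t : ℝ => Complex.exp (-(μ * t)) * u (eulerFlow p q z t) i j) atBot
      (𝓝 0)) : u = 0 := by
  ext z i j
  refine tendsto_nhds_unique (tendsto_const_nhds (x := u z i j) (f := (atBot : Filter ℝ))) ?_
  refine (h z i j).congr fun t => ?_
  rw [apply_eulerFlow hu hE]

theorem tendsto_cexp_atBot {c : ℂ} (hc : 0 < c.re) :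
    Tendsto (fun t : ℝ => Complex.exp (c * t)) atBot (𝓝 0) := by
  rw [tendsto_zero_iff_norm_tendsto_zero]
  simp only [Complex.norm_exp]
  have : ∀ t : ℝ, (c * (t : ℂ)).re = c.re * t := by intro t; simp
  simp only [this]
  exact Real.tendsto_exp_atBot.comp (tendsto_id.const_mul_atBot hc)

/-- As `t → -∞` the flow contracts to the origin, where `u` is continuous, while `exp(-μt)` decays.
-/
theorem eq_zero_of_re_neg (hp : 0 < p) (hq : 0 < q) (hu : IsHol u)
    (hE : vderiv (eulerField p q) u = μ • u) (hμ : μ.re < 0) : u = 0 := by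
  refine eq_zero_of_tendsto hu hE fun z i j => ?_
  have h1 : Tendsto (fun t : ℝ => Complex.exp (-(μ * t))) atBot (𝓝 0) := by
    have := tendsto_cexp_atBot (c := -μ) (by simpa using hμ)
    simpa using this
  have h2 : Tendsto (fun t : ℝ => eulerFlow p q z t) atBot (𝓝 (0, 0)) := by
    have ha := (tendsto_cexp_atBot (c := q) (by simpa using hq)).mul_const z.1
    have hb := (tendsto_cexp_atBot (c := p) (by simpa using hp)).mul_const z.2
    rw [zero_mul] at ha hb
    exact ha.prodMk_nhds hb
  have h3 : Tendsto (fun t : ℝ => u (eulerFlow p q z t) i j) atBot (𝓝 (u (0, 0) i j)) :=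
    (hu.diffAt (0, 0) i j).continuousAt.tendsto.comp h2
  simpa using h1.mul h3

/-- Along the flow a monomial of weight at least `v` scales by a power of `exp t` larger than `w`,
so the rescaled function tends to zero as `t → -∞`. -/
theorem eq_zero_of_mem_orderGE {v w : ℤ} (hvw : w < v) (hu : u ∈ orderGE n p q v)
    (hE : vderiv (eulerField p q) u = (w : ℂ) • u) : u = 0 := by
  refine eq_zero_of_tendsto (isHol_of_mem_orderGE hu) hE fun z i j => ?_
  clear hE
  induction hu using Submodule.span_induction with
  | zero => simp
  | add x y _ _ hx hy => simpa [mul_add] using hx.add hy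
  | smul c x _ hx => simpa [mul_left_comm] using hx.const_mul c
  | mem x hx =>
    obtain ⟨m, k, X, hm, rfl⟩ := hx
    have h1 := (tendsto_cexp_atBot (c := (((q : ℤ) * m + p * k - w : ℤ) : ℂ))
      (by rw [Complex.intCast_re]; exact_mod_cast (by linarith :
        0 < (q : ℤ) * m + p * k - w))).mul_const (mono m k X z i j)
    rw [zero_mul] at h1
    refine h1.congr fun t => ?_
    simp only [mono, eulerFlow, Matrix.smul_apply, smul_eq_mul, mul_pow, ← Complex.exp_nat_mul]
    push_cast
    rw [show ((q : ℂ) * m + p * k - w) * t = -(w * t) + m * (q * t) + k * (p * t) by ring,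
      Complex.exp_add, Complex.exp_add]
    ring

/-- The bracket of `E` with the constant field `c` is `-r c`, so differentiating along `c` lowers
the eigenvalue by `r`. It is used for `∂_x` with `r = q` and for `∂_y` with `r = p`. -/
theorem vderiv_euler_const (c : ℂ × ℂ) (r : ℂ) (hc : ((q : ℂ) * c.1, (p : ℂ) * c.2) = r • c)
    (hu : IsHol u) (hE : vderiv (eulerField p q) u = μ • u) :
    vderiv (eulerField p q) (vderiv (fun _ => c) u) = (μ - r) • vderiv (fun _ => c) u := by
  have hE' : ∀ z, HasFDerivAt (eulerField p q)
      (((q : ℂ) • ContinuousLinearMap.fst ℂ ℂ ℂ).prod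
        ((p : ℂ) • ContinuousLinearMap.snd ℂ ℂ ℂ)) z := fun z =>
    (hasFDerivAt_fst.const_mul _).prodMk (hasFDerivAt_snd.const_mul _)
  have hb : ∀ z, VectorField.lieBracket ℂ (eulerField p q) (fun _ => c) z = -(r • c) := by
    intro z
    rw [VectorField.lieBracket, (hE' z).fderiv, ← hc]
    simp
  funext z
  ext i j
  have hu' : AnalyticAt ℂ (fun w => u w i j) z := hu i j z (Set.mem_univ z)
  have h := VectorField.fderiv_apply_lieBracket (n := minSmoothness ℂ 2) (x := z)
    (V := eulerField p q) (W := fun _ => c) hu'.contDiffAt le_rfl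
    (differentiableAt_const _)
    ((eulerField_analytic p q) z (Set.mem_univ z)).differentiableAt
  rw [hb, map_neg, map_smul] at h
  have h2 : (fun w => fderiv ℂ (fun w => u w i j) w (eulerField p q w)) = fun w => μ * u w i j := by
    funext w
    have := congrArg (fun A : Mat n => A i j) (congrFun hE w)
    simpa [vderiv_apply] using this
  rw [h2, fderiv_const_mul hu'.differentiableAt] at h
  simp only [vderiv_apply, Pi.smul_apply, Matrix.smul_apply, smul_eq_mul] at h ⊢
  simp only [_root_.smul_apply, smul_eq_mul] at h
  linear_combination -h

theorem fst_mul_mem_quasiHom {w : ℤ} (hu : u ∈ quasiHom p q W w) :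
    (fun z => z.1 • u z) ∈ quasiHom p q W (w + q) := by
  induction hu using Submodule.span_induction with
  | zero => convert! Submodule.zero_mem _ using 1; funext z; simp
  | add x y _ _ hx hy => convert! Submodule.add_mem _ hx hy using 1; funext z; simp
  | smul c x _ hx => convert! Submodule.smul_mem _ c hx using 1; funext z; simp [smul_comm c]
  | mem x hx =>
    obtain ⟨m, k, X, hX, rfl, rfl⟩ := hx
    convert! mono_mem_quasiHom (p := p) (q := q) (m := m + 1) (k := k) (w := (q : ℤ) * m + p * k + q) hX
      (by push_cast; ring) using 1
    funext z; simp only [mono, smul_smul]; congr 1; ring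

theorem snd_mul_mem_quasiHom {w : ℤ} (hu : u ∈ quasiHom p q W w) :
    (fun z => z.2 • u z) ∈ quasiHom p q W (w + p) := by
  induction hu using Submodule.span_induction with
  | zero => convert! Submodule.zero_mem _ using 1; funext z; simp
  | add x y _ _ hx hy => convert! Submodule.add_mem _ hx hy using 1; funext z; simp
  | smul c x _ hx => convert! Submodule.smul_mem _ c hx using 1; funext z; simp [smul_comm c]
  | mem x hx =>
    obtain ⟨m, k, X, hX, rfl, rfl⟩ := hx
    convert! mono_mem_quasiHom (p := p) (q := q) (m := m) (k := k + 1) (w := (q : ℤ) * m + p * k + p) hX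
      (by push_cast; ring) using 1
    funext z; simp only [mono, smul_smul]; congr 1; ring

theorem vderiv_euler_eq (z : ℂ × ℂ) : vderiv (eulerField p q) u z
    = (q : ℂ) • z.1 • vderiv (fun _ => ((1 : ℂ), (0 : ℂ))) u z
      + (p : ℂ) • z.2 • vderiv (fun _ => ((0 : ℂ), (1 : ℂ))) u z := by
  ext i j
  simp only [vderiv_apply, Matrix.add_apply, Matrix.smul_apply]
  rw [← map_smul, ← map_smul, ← map_smul, ← map_smul, ← map_add]
  congr 1
  ext <;> simp [eulerField]

/-- A holomorphic eigenfunction of the Euler field is a quasihomogeneous polynomial. -/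
theorem eigenfunction_mem_quasiHom (hp : 0 < p) (hq : 0 < q) (N : ℕ) : ∀ {μ : ℂ} {u : MatFun n},
    μ.re < N → IsHol u → (∀ z, u z ∈ W) → vderiv (eulerField p q) u = μ • u →
    u = 0 ∨ ∃ w : ℤ, μ = w ∧ u ∈ quasiHom p q W w := by
  induction N with
  | zero =>
    intro μ u hμ hu hW hE
    exact Or.inl (eq_zero_of_re_neg hp hq hu hE (by simpa using hμ))
  | succ N ih =>
    intro μ u hμ hu hW hE
    have hq1 : (1 : ℝ) ≤ q := by exact_mod_cast hq
    have hp1 : (1 : ℝ) ≤ p := by exact_mod_cast hp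
    have hx := vderiv_euler_const ((1 : ℂ), (0 : ℂ)) q (by simp) hu hE
    have hy := vderiv_euler_const ((0 : ℂ), (1 : ℂ)) p (by simp) hu hE
    have hxh : IsHol (vderiv (fun _ => ((1 : ℂ), (0 : ℂ))) u) := hu.vderiv analyticOnNhd_const
    have hyh : IsHol (vderiv (fun _ => ((0 : ℂ), (1 : ℂ))) u) := hu.vderiv analyticOnNhd_const
    -- For `μ = 0` both partial derivatives have negative eigenvalues, so they vanish and `u` is
    -- constant. For `μ ≠ 0` Euler's identity recovers `u` from its partial derivatives, whose
    -- eigenvalues have smaller real part.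
    by_cases hμ0 : μ = 0
    · right
      refine ⟨0, by simpa using hμ0, ?_⟩
      have h1 := eq_zero_of_re_neg hp hq hxh hx (by simp [hμ0]; exact hq)
      have h2 := eq_zero_of_re_neg hp hq hyh hy (by simp [hμ0]; exact hp)
      have h3 : u = mono 0 0 (u (0, 0)) := by
        funext z
        ext i j
        have hd : Differentiable ℂ fun z => u z i j := fun z => hu.diffAt z i j
        have h4 : ∀ z, fderiv ℂ (fun z => u z i j) z = 0 := by
          intro z
          have e1 := congrArg (fun A : Mat n => A i j) (congrFun h1 z)
          have e2 := congrArg (fun A : Mat n => A i j) (congrFun h2 z)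
          simp only [vderiv_apply, Pi.zero_apply, Matrix.zero_apply] at e1 e2
          ext
          · simpa using e1
          · simpa using e2
        have := is_const_of_fderiv_eq_zero hd h4 z (0, 0)
        simpa [mono] using this
      rw [h3]
      exact mono_mem_quasiHom (hW _) (by simp)
    · have key : u = μ⁻¹ • ((q : ℂ) • (fun z => z.1 • vderiv (fun _ => ((1 : ℂ), (0 : ℂ))) u z)
          + (p : ℂ) • fun z => z.2 • vderiv (fun _ => ((0 : ℂ), (1 : ℂ))) u z) := by
        have h : vderiv (eulerField p q) u
            = (q : ℂ) • (fun z => z.1 • vderiv (fun _ => ((1 : ℂ), (0 : ℂ))) u z)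
          + (p : ℂ) • fun z => z.2 • vderiv (fun _ => ((0 : ℂ), (1 : ℂ))) u z :=
          funext vderiv_euler_eq
        rw [← h, hE, smul_smul, inv_mul_cancel₀ hμ0, one_smul]
      have ihx := ih (μ := μ - q) (by simp; push_cast at hμ; linarith) hxh
        (fun z => vderiv_mem _ hu hW z) hx
      have ihy := ih (μ := μ - p) (by simp; push_cast at hμ; linarith) hyh
        (fun z => vderiv_mem _ hu hW z) hy
      have fin : ∀ w : ℤ, μ = w →
          vderiv (fun _ => ((1 : ℂ), (0 : ℂ))) u ∈ quasiHom p q W (w - q) →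
          vderiv (fun _ => ((0 : ℂ), (1 : ℂ))) u ∈ quasiHom p q W (w - p) →
          u ∈ quasiHom p q W w := by
        intro w _ h1 h2
        rw [key]
        refine Submodule.smul_mem _ _ (Submodule.add_mem _ (Submodule.smul_mem _ _ ?_)
          (Submodule.smul_mem _ _ ?_))
        · simpa using fst_mul_mem_quasiHom h1
        · simpa using snd_mul_mem_quasiHom h2
      rcases ihx with hx0 | ⟨w, hw, hxw⟩
      · rcases ihy with hy0 | ⟨w', hw', hyw⟩
        · left
          rw [key, hx0, hy0]
          funext z; simp
        · right
          refine ⟨w' + p, by push_cast; rw [← hw']; ring, fin _ ?_ ?_ ?_⟩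
          · push_cast; rw [← hw']; ring
          · rw [hx0]; exact Submodule.zero_mem _
          · simpa using hyw
      · right
        refine ⟨w + q, by push_cast; rw [← hw]; ring, fin _ ?_ ?_ ?_⟩
        · push_cast; rw [← hw]; ring
        · simpa using hxw
        · rcases ihy with hy0 | ⟨w', hw', hyw⟩
          · rw [hy0]; exact Submodule.zero_mem _
          -- The weights of the two partial derivatives are tied together by `μ`.
          · have h1 : (w' : ℂ) + p = w + q := by rw [← hw, ← hw']; ring
            have h2 : w' = w + q - p := by
              have : w' + p = w + q := by exact_mod_cast h1
              linarith
            rw [← h2]; exact hyw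

end Euler

/-! ### Eigenspace projections of `ad_S`. -/

section Projections

variable {P : GL (Fin n) ℂ} {d : Fin n → ℂ} {S : Mat n}

/-- The projection of matrices onto the `μ`-eigenspace of `ad_D`, `D` diagonal with entries `d`. -/
noncomputable def diagProj (d : Fin n → ℂ) (μ : ℂ) : Mat n →ₗ[ℂ] Mat n where
  toFun X := Matrix.of fun i j => if d i - d j = μ then X i j else 0
  map_add' X Y := by ext i j; by_cases h : d i - d j = μ <;> simp [h]
  map_smul' c X := by ext i j; by_cases h : d i - d j = μ <;> simp [h]

theorem diagProj_apply (d : Fin n → ℂ) (μ : ℂ) (X : Mat n) (i j : Fin n) :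
    diagProj d μ X i j = if d i - d j = μ then X i j else 0 := rfl

/-- The projection of matrices onto the `μ`-eigenspace of `ad_S`, `S = P D P⁻¹` with `D` diagonal
with entries `d`. -/
noncomputable def adProj (P : GL (Fin n) ℂ) (d : Fin n → ℂ) (μ : ℂ) : Mat n →ₗ[ℂ] Mat n :=
  LinearMap.mulRight ℂ ((P⁻¹ : GL (Fin n) ℂ) : Mat n) ∘ₗ LinearMap.mulLeft ℂ (P : Mat n) ∘ₗ
    diagProj d μ ∘ₗ LinearMap.mulRight ℂ (P : Mat n) ∘ₗ
      LinearMap.mulLeft ℂ ((P⁻¹ : GL (Fin n) ℂ) : Mat n)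

/-- Conjugation by `P⁻¹`. -/
noncomputable def unconj (P : GL (Fin n) ℂ) (X : Mat n) : Mat n :=
  ((P⁻¹ : GL (Fin n) ℂ) : Mat n) * X * (P : Mat n)

theorem unconj_conj (X : Mat n) :
    unconj P ((P : Mat n) * X * ((P⁻¹ : GL (Fin n) ℂ) : Mat n)) = X := by
  unfold unconj
  rw [← mul_assoc, ← mul_assoc, Units.inv_mul, one_mul, mul_assoc, Units.inv_mul, mul_one]

theorem conj_unconj (X : Mat n) :
    (P : Mat n) * unconj P X * ((P⁻¹ : GL (Fin n) ℂ) : Mat n) = X := by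
  unfold unconj
  rw [← mul_assoc, ← mul_assoc, Units.mul_inv, one_mul, mul_assoc, Units.mul_inv, mul_one]

theorem unconj_injective : Function.Injective (unconj P) := fun X Y h => by
  rw [← conj_unconj (P := P) X, h, conj_unconj]

theorem unconj_mul (X Y : Mat n) : unconj P (X * Y) = unconj P X * unconj P Y := by
  apply_fun fun Z => (P : Mat n) * Z * ((P⁻¹ : GL (Fin n) ℂ) : Mat n) using
    (fun X Y h => by
      have := congrArg (unconj P) h
      simpa only [unconj_conj] using this)
  beta_reduce
  rw [conj_unconj]
  unfold unconj
  simp only [mul_assoc, Units.mul_inv, mul_one]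
  simp only [← mul_assoc, Units.mul_inv, one_mul]

theorem unconj_sub (X Y : Mat n) : unconj P (X - Y) = unconj P X - unconj P Y := by
  simp [unconj, mul_sub, sub_mul]

theorem unconj_smul (c : ℂ) (X : Mat n) : unconj P (c • X) = c • unconj P X := by
  simp [unconj]

theorem unconj_adProj (μ : ℂ) (X : Mat n) :
    unconj P (adProj P d μ X) = diagProj d μ (unconj P X) := unconj_conj _

theorem unconj_lie (hS : S = (P : Mat n) * Matrix.diagonal d * ((P⁻¹ : GL (Fin n) ℂ) : Mat n))
    (X : Mat n) (i j : Fin n) : unconj P ⁅S, X⁆ i j = (d i - d j) * unconj P X i j := by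
  rw [Ring.lie_def, unconj_sub, unconj_mul, unconj_mul, hS, unconj_conj, Matrix.sub_apply,
    Matrix.diagonal_mul, Matrix.mul_diagonal]
  ring

/-- In a basis diagonalizing `S`, the matrix units are eigenvectors of `ad_S` with eigenvalues `d i
- d j`. -/
theorem lie_eq_smul_iff
    (hS : S = (P : Mat n) * Matrix.diagonal d * ((P⁻¹ : GL (Fin n) ℂ) : Mat n))
    {X : Mat n} {μ : ℂ} : ⁅S, X⁆ = μ • X ↔ ∀ i j, unconj P X i j ≠ 0 → d i - d j = μ := by
  rw [← unconj_injective.eq_iff (f := unconj P), unconj_smul]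
  constructor
  · intro h i j hij
    have := congrArg (fun A : Mat n => A i j) h
    simp only [unconj_lie hS, Matrix.smul_apply, smul_eq_mul] at this
    exact mul_right_cancel₀ hij this
  · intro h
    ext i j
    rw [unconj_lie hS, Matrix.smul_apply, smul_eq_mul]
    by_cases hij : unconj P X i j = 0
    · rw [hij, mul_zero, mul_zero]
    · rw [h i j hij]

theorem lie_adProj (hS : S = (P : Mat n) * Matrix.diagonal d * ((P⁻¹ : GL (Fin n) ℂ) : Mat n))
    (μ : ℂ) (X : Mat n) : ⁅S, adProj P d μ X⁆ = μ • adProj P d μ X := by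
  rw [lie_eq_smul_iff hS]
  intro i j h
  rw [unconj_adProj, diagProj_apply] at h
  by_contra hne
  exact h (if_neg hne)

theorem adProj_lie (hS : S = (P : Mat n) * Matrix.diagonal d * ((P⁻¹ : GL (Fin n) ℂ) : Mat n))
    (μ : ℂ) (X : Mat n) : adProj P d μ ⁅S, X⁆ = μ • adProj P d μ X := by
  apply unconj_injective (P := P)
  ext i j
  rw [unconj_smul, unconj_adProj, unconj_adProj, Matrix.smul_apply, diagProj_apply, diagProj_apply,
    unconj_lie hS]
  split_ifs with h
  · rw [h, smul_eq_mul]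
  · simp

theorem adProj_of_eigen
    (hS : S = (P : Mat n) * Matrix.diagonal d * ((P⁻¹ : GL (Fin n) ℂ) : Mat n))
    {μ : ℂ} {X : Mat n} (hX : ⁅S, X⁆ = μ • X) : adProj P d μ X = X := by
  apply unconj_injective (P := P)
  ext i j
  rw [unconj_adProj, diagProj_apply]
  split_ifs with h
  · rfl
  · by_contra hne
    exact h ((lie_eq_smul_iff hS).1 hX i j (Ne.symm hne))

theorem adProj_of_eigen_ne
    (hS : S = (P : Mat n) * Matrix.diagonal d * ((P⁻¹ : GL (Fin n) ℂ) : Mat n))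
    {μ ν : ℂ} (hne : μ ≠ ν) {X : Mat n} (hX : ⁅S, X⁆ = μ • X) : adProj P d ν X = 0 := by
  apply unconj_injective (P := P)
  ext i j
  rw [unconj_adProj, diagProj_apply]
  have h0 : unconj P (0 : Mat n) = 0 := by simp [unconj]
  rw [h0]
  split_ifs with h
  · by_contra h1
    exact hne (((lie_eq_smul_iff hS).1 hX i j h1).symm.trans h)
  · rfl

/-- The eigenvalues of `ad_S`. -/
noncomputable def adSpec (d : Fin n → ℂ) : Finset ℂ :=
  Finset.univ.image fun ij : Fin n × Fin n => d ij.1 - d ij.2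

theorem sum_adProj (X : Mat n) : ∑ μ ∈ adSpec d, adProj P d μ X = X := by
  have h1 : ∑ μ ∈ adSpec d, diagProj d μ (unconj P X) = unconj P X := by
    ext i j
    rw [Matrix.sum_apply]
    simp only [diagProj_apply]
    rw [Finset.sum_ite_eq, if_pos]
    exact Finset.mem_image.2 ⟨(i, j), Finset.mem_univ _, rfl⟩
  calc ∑ μ ∈ adSpec d, adProj P d μ X
      = ∑ μ ∈ adSpec d, (P : Mat n) * diagProj d μ (unconj P X) *
          ((P⁻¹ : GL (Fin n) ℂ) : Mat n) := rfl
    _ = X := by rw [← Finset.sum_mul, ← Finset.mul_sum, h1, conj_unconj]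

/-- Applying `ad_S - a` kills the `a`-term and multiplies the others by the nonzero scalars `μ - a`;
this removes one eigenvalue at a time without leaving `W`. -/
theorem mem_of_sum_eigen_mem {W : Submodule ℂ (Mat n)} (hW : ∀ X ∈ W, ⁅S, X⁆ ∈ W)
    (s : Finset ℂ) : ∀ (x : ℂ → Mat n), (∀ μ ∈ s, ⁅S, x μ⁆ = μ • x μ) → ∑ μ ∈ s, x μ ∈ W →
      ∀ μ ∈ s, x μ ∈ W := by
  classical
  induction s using Finset.induction_on with
  | empty => simp
  | insert a s ha ih =>
    intro x hx hsum
    have h1 : ∀ μ ∈ s, x μ ∈ W := by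
      have h2 := ih (fun μ => (μ - a) • x μ) (fun μ hμ => by
        rw [show ⁅S, (μ - a) • x μ⁆ = (μ - a) • ⁅S, x μ⁆ by simp [Ring.lie_def, smul_sub],
          hx μ (by simp [hμ]), smul_comm]) (by
        have h3 := W.sub_mem (hW _ hsum) (W.smul_mem a hsum)
        convert h3 using 1
        rw [Finset.sum_insert ha, Ring.lie_def, mul_add, add_mul, add_sub_add_comm, smul_add,
          ← Ring.lie_def, hx a (by simp), add_sub_add_left_eq_sub, Finset.mul_sum, Finset.sum_mul,
          ← Finset.sum_sub_distrib, Finset.smul_sum, ← Finset.sum_sub_distrib]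
        refine Finset.sum_congr rfl fun μ hμ => ?_
        rw [← Ring.lie_def, hx μ (by simp [hμ]), sub_smul])
      intro μ hμ
      have hne : μ - a ≠ 0 := sub_ne_zero.2 (by rintro rfl; exact ha hμ)
      exact (W.smul_mem_iff hne).1 (h2 μ hμ)
    intro μ hμ
    rcases Finset.mem_insert.1 hμ with rfl | hμ
    · rw [Finset.sum_insert ha] at hsum
      exact (W.add_mem_iff_left (W.sum_mem h1)).1 hsum
    · exact h1 μ hμ

theorem adProj_eq_zero_of_notMem {μ : ℂ} (hμ : μ ∉ adSpec d) (X : Mat n) : adProj P d μ X = 0 := by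
  apply unconj_injective (P := P)
  ext i j
  rw [unconj_adProj, diagProj_apply, if_neg]
  · simp [unconj]
  · intro h
    exact hμ (Finset.mem_image.2 ⟨(i, j), Finset.mem_univ _, h⟩)

theorem adProj_mem (hS : S = (P : Mat n) * Matrix.diagonal d * ((P⁻¹ : GL (Fin n) ℂ) : Mat n))
    {W : Submodule ℂ (Mat n)} (hW : ∀ X ∈ W, ⁅S, X⁆ ∈ W) (μ : ℂ) {X : Mat n} (hX : X ∈ W) :
    adProj P d μ X ∈ W := by
  by_cases hμ : μ ∈ adSpec d
  · refine mem_of_sum_eigen_mem hW (adSpec d) (fun μ => adProj P d μ X)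
      (fun μ _ => lie_adProj hS μ X) ?_ μ hμ
    rwa [sum_adProj]
  · rw [adProj_eq_zero_of_notMem hμ]; exact W.zero_mem

end Projections

/-! ### Splitting weight spaces into homogeneous components; the spaces `H^0` and `H^1`. -/

section Grading

/-- The `μ`-eigenspace of `ad_S`. -/
def adEigenspace (S : Mat n) (μ : ℂ) : Submodule ℂ (Mat n) where
  carrier := {X | ⁅S, X⁆ = μ • X}
  add_mem' := fun {X Y} hX hY => by
    change ⁅S, X⁆ = μ • X at hX
    change ⁅S, Y⁆ = μ • Y at hY
    change ⁅S, X + Y⁆ = μ • (X + Y)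
    rw [smul_add, ← hX, ← hY]; simp only [Ring.lie_def]; noncomm_ring
  zero_mem' := by change ⁅S, (0 : Mat n)⁆ = μ • (0 : Mat n); simp [Ring.lie_def]
  smul_mem' := fun c X hX => by
    change ⁅S, X⁆ = μ • X at hX
    change ⁅S, c • X⁆ = μ • c • X
    rw [smul_comm, ← hX]; simp [Ring.lie_def, smul_sub]

theorem mem_adEigenspace {S X : Mat n} {μ : ℂ} : X ∈ adEigenspace S μ ↔ ⁅S, X⁆ = μ • X := Iff.rfl

/-- The `μ`-component of a matrix valued function. -/
noncomputable def comp (P : GL (Fin n) ℂ) (d : Fin n → ℂ) (μ : ℂ) : MatFun n →ₗ[ℂ] MatFun n :=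
  (adProj P d μ).compLeft (ℂ × ℂ)

variable {P : GL (Fin n) ℂ} {d : Fin n → ℂ} {S : Mat n} {p q : ℕ} {k l w v : ℤ} {u : MatFun n}
  {μ : ℂ} {W : Submodule ℂ (Mat n)}

theorem comp_apply (z : ℂ × ℂ) : comp P d μ u z = adProj P d μ (u z) := rfl

theorem isHol_comp (hu : IsHol u) : IsHol (comp P d μ u) := IsHol.map (adProj P d μ) hu

theorem vderiv_comp (X : ℂ × ℂ → ℂ × ℂ) (hu : IsHol u) :
    vderiv X (comp P d μ u) = comp P d μ (vderiv X u) := vderiv_map X (adProj P d μ) hu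

theorem comp_mem_orderGE (hu : u ∈ orderGE n p q v) : comp P d μ u ∈ orderGE n p q v :=
  map_mem_orderGE (adProj P d μ) hu

theorem sum_comp (u : MatFun n) : ∑ μ ∈ adSpec d, comp P d μ u = u := by
  funext z
  rw [Finset.sum_apply]
  exact sum_adProj (u z)

theorem mem_of_comp_mem {M : Submodule ℂ (MatFun n)} (h : ∀ μ ∈ adSpec d, comp P d μ u ∈ M) :
    u ∈ M := by
  rw [← sum_comp (P := P) (d := d) u]
  exact M.sum_mem h

/-- `S = P D P⁻¹` with `D` diagonal with entries `d`. -/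
abbrev Diagonalizes (P : GL (Fin n) ℂ) (d : Fin n → ℂ) (S : Mat n) : Prop :=
  S = (P : Mat n) * Matrix.diagonal d * ((P⁻¹ : GL (Fin n) ℂ) : Mat n)

/-- On the `μ`-component `ad_S` is the scalar `μ`, so the weight equation becomes an eigenvalue
equation for `E` alone. -/
theorem vderiv_euler_comp (hS : Diagonalizes P d S) (hu : u ∈ weightGL S p q k) :
    vderiv (eulerField p q) (comp P d μ u) = ((k : ℂ) - μ) • comp P d μ u := by
  rw [vderiv_comp _ hu.1]
  funext z
  rw [comp_apply, eq_sub_of_add_eq (hu.2 z), map_sub, map_smul, adProj_lie hS, ← sub_smul]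
  rfl

/-- This identifies the kernel of `E + ad_S - k` with the sum of the spaces `O_w ⊗ W_{k-w}`: the
weight and the `ad_S`-eigenvalue of a component determine each other. -/
theorem comp_eq_zero_or (hS : Diagonalizes P d S) (hp : 0 < p) (hq : 0 < q) (hWS : ∀ X ∈ W, ⁅S, X⁆ ∈ W)
    (hu : u ∈ weightGL S p q k) (huW : ∀ z, u z ∈ W) (μ : ℂ) :
    comp P d μ u = 0 ∨ ∃ w : ℤ, μ = k - w ∧ comp P d μ u ∈ quasiHom p q (W ⊓ adEigenspace S μ) w := by
  obtain ⟨N, hN⟩ := exists_nat_gt ((k : ℂ) - μ).re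
  rcases eigenfunction_mem_quasiHom (W := W ⊓ adEigenspace S μ) hp hq N hN (isHol_comp hu.1)
    (fun z => ⟨adProj_mem hS hWS μ (huW z), lie_adProj hS μ (u z)⟩)
    (vderiv_euler_comp hS hu) with h | ⟨w, hw, h⟩
  · exact Or.inl h
  · exact Or.inr ⟨w, by rw [← hw]; ring, h⟩

theorem comp_mem_quasiHom (hS : Diagonalizes P d S) (hp : 0 < p) (hq : 0 < q) (hWS : ∀ X ∈ W, ⁅S, X⁆ ∈ W)
    (hu : u ∈ weightGL S p q k) (huW : ∀ z, u z ∈ W) (w : ℤ) :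
    comp P d (k - w) u ∈ quasiHom p q (W ⊓ adEigenspace S (k - w)) w := by
  rcases comp_eq_zero_or hS hp hq hWS hu huW ((k : ℂ) - w) with h | ⟨w', hw', h⟩
  · rw [h]; exact Submodule.zero_mem _
  · have : (w : ℂ) = w' := by linear_combination -hw'
    have hww : w = w' := by exact_mod_cast this
    rw [← hww] at h
    exact h

theorem comp_eq_zero_of_lt (hS : Diagonalizes P d S) (hu : u ∈ weightGL S p q k) (hv : u ∈ orderGE n p q v) (hwv : w < v) :
    comp P d (k - w) u = 0 := by
  refine eq_zero_of_mem_orderGE hwv (comp_mem_orderGE hv) ?_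
  rw [vderiv_euler_comp hS hu, sub_sub_cancel]

theorem weightGL_le_orderGE (hS : Diagonalizes P d S) (hp : 0 < p) (hq : 0 < q) (hu : u ∈ weightGL S p q k) :
    u ∈ orderGE n p q 0 := by
  refine mem_of_comp_mem (P := P) (d := d) fun μ _ => ?_
  rcases comp_eq_zero_or (W := ⊤) hS hp hq (fun _ _ => trivial) hu (fun _ => trivial) μ with
    h | ⟨w, -, h⟩
  · rw [h]; exact Submodule.zero_mem _
  · rcases quasiHom_eq_zero_or h with h0 | ⟨m, j, rfl⟩
    · rw [h0]; exact Submodule.zero_mem _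
    · exact quasiHom_le_orderGE (by positivity) h

/-- In a space of fixed `k` the part of weight `v` is a single `ad_S`-component. Components of
smaller weight vanish by the order assumption, so removing this one raises the order. -/
theorem sub_comp_mem_orderGE (hS : Diagonalizes P d S) (hp : 0 < p) (hq : 0 < q) (hu : u ∈ weightGL S p q k)
    (hv : u ∈ orderGE n p q v) : u - comp P d (k - v) u ∈ orderGE n p q (v + 1) := by
  refine mem_of_comp_mem (P := P) (d := d) fun μ _ => ?_
  rw [map_sub]
  have hE := lie_adProj (P := P) (d := d) hS ((k : ℂ) - v)
  rcases comp_eq_zero_or (W := ⊤) hS hp hq (fun _ _ => trivial) hu (fun _ => trivial) μ with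
    h | ⟨w, rfl, h⟩
  · rw [h, zero_sub]
    refine Submodule.neg_mem _ ?_
    have h2 : comp P d μ (comp P d (k - v) u) = 0 := by
      by_cases hμ : (k : ℂ) - v = μ
      · rw [hμ, h, map_zero]
      · funext z
        exact adProj_of_eigen_ne hS hμ (hE (u z))
    rw [h2]; exact Submodule.zero_mem _
  · by_cases hwv : w = v
    · subst hwv
      have h2 : comp P d (k - w) (comp P d (k - w) u) = comp P d (k - w) u := by
        funext z
        exact adProj_of_eigen hS (hE (u z))
      rw [h2, sub_self]; exact Submodule.zero_mem _
    · have h2 : comp P d (k - w) (comp P d (k - v) u) = 0 := by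
        funext z
        refine adProj_of_eigen_ne hS (fun h3 => hwv ?_) (hE (u z))
        have : (w : ℂ) = v := by linear_combination h3
        exact_mod_cast this
      rw [h2, sub_zero]
      rcases lt_or_ge w v with hlt | hge
      · rw [comp_eq_zero_of_lt hS hu hv hlt]; exact Submodule.zero_mem _
      · exact quasiHom_le_orderGE (by omega) h

/-- Finiteness of the spectrum of `ad_S` bounds the weights; all the inductions on the order stop at
this bound. -/
theorem exists_weight_bound (d : Fin n → ℂ) (k : ℤ) :
    ∃ B : ℕ, ∀ w : ℤ, B ≤ w → (k : ℂ) - w ∉ adSpec d := by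
  obtain ⟨M, hM⟩ := ((adSpec d).image fun μ => ⌈((k : ℂ) - μ).re⌉₊).exists_le
  refine ⟨M + 1, fun w hw hmem => ?_⟩
  have h1 := hM _ (Finset.mem_image_of_mem _ hmem)
  have h2 : (w : ℝ) ≤ M := by
    have h3 := Nat.ceil_le.1 h1
    simpa using h3
  have h3 : w ≤ M := by exact_mod_cast h2
  omega

theorem exists_order_bound (hS : Diagonalizes P d S) (hp : 0 < p) (hq : 0 < q) (k : ℤ) :
    ∃ B : ℕ, ∀ v : ℤ, B ≤ v → ∀ u ∈ weightGL S p q k, u ∈ orderGE n p q v → u = 0 := by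
  obtain ⟨B, hB⟩ := exists_weight_bound d k
  refine ⟨B, fun v hv u hu huv => ?_⟩
  suffices u ∈ (⊥ : Submodule ℂ (MatFun n)) by simpa using this
  refine mem_of_comp_mem (P := P) (d := d) fun μ hμ => ?_
  rw [Submodule.mem_bot]
  rcases comp_eq_zero_or (W := ⊤) hS hp hq (fun _ _ => trivial) hu (fun _ => trivial) μ with
    h | ⟨w, rfl, -⟩
  · exact h
  · refine comp_eq_zero_of_lt hS hu huv (lt_of_lt_of_le ?_ hv)
    by_contra hw
    exact hB w (not_lt.1 hw) hμ

theorem quasiHom_le_weightGL : quasiHom p q (adEigenspace S ((k : ℂ) - w)) w ≤ weightGL S p q k := by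
  intro u hu
  refine ⟨isHol_of_mem_quasiHom hu, fun z => ?_⟩
  rw [vderiv_euler_of_mem_quasiHom hu, mem_adEigenspace.1 (mem_of_mem_quasiHom hu z),
    Pi.smul_apply, ← add_smul, add_sub_cancel]

/-- The span of the `f ^ c X` with `X ∈ W` and `[S, X] = -cpq X`. -/
def H0of (S : Mat n) (p q : ℕ) (W : Submodule ℂ (Mat n)) : Submodule ℂ (MatFun n) :=
  Submodule.span ℂ {u | ∃ (c : ℕ) (X : Mat n), X ∈ W ∧
    ⁅S, X⁆ = (-((c : ℂ) * (p * q))) • X ∧ u = fun z => curveFn p q z ^ c • X}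

/-- The span of the `f ^ c x ^ a y ^ b X` with `a < p - 1`, `b < q - 1`, `X ∈ W` and
`[S, X] = (w₀ - cpq - aq - bp) X`. -/
def H1of (S : Mat n) (p q : ℕ) (W : Submodule ℂ (Mat n)) : Submodule ℂ (MatFun n) :=
  Submodule.span ℂ {u | ∃ (c a b : ℕ) (X : Mat n), a + 1 < p ∧ b + 1 < q ∧ X ∈ W ∧
    ⁅S, X⁆ = ((w₀ p q : ℂ) - ((c : ℂ) * (p * q) + a * q + b * p)) • X ∧
    u = fun z => monom p q c a b z • X}

theorem H1of_mono {W' : Submodule ℂ (Mat n)} (h : W ≤ W') : H1of S p q W ≤ H1of S p q W' := by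
  refine Submodule.span_mono ?_
  rintro u ⟨c, a, b, X, ha, hb, hX, h1, rfl⟩
  exact ⟨c, a, b, X, ha, hb, h hX, h1, rfl⟩

theorem H0of_le_weightGL : H0of S p q W ≤ weightGL S p q 0 := by
  refine Submodule.span_le.2 ?_
  rintro u ⟨c, X, -, hX, rfl⟩
  refine quasiHom_le_weightGL (w := (c : ℤ) * (p * q)) ?_
  have := monom_mem_quasiHom (p := p) (q := q) (c := c) (a := 0) (b := 0)
    (W := adEigenspace S ((0 : ℤ) - ((c : ℤ) * (p * q) : ℤ))) (X := X)
    (by rw [mem_adEigenspace, hX]; congr 1; push_cast; ring) rfl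
  simpa [monom] using this

theorem H1of_le_weightGL : H1of S p q W ≤ weightGL S p q (w₀ p q) := by
  refine Submodule.span_le.2 ?_
  rintro u ⟨c, a, b, X, -, -, -, hX, rfl⟩
  refine quasiHom_le_weightGL (w := (c : ℤ) * (p * q) + a * q + b * p) ?_
  exact monom_mem_quasiHom (by rw [mem_adEigenspace, hX]; congr 1; push_cast; ring) rfl

theorem complement_le_H1of :
    complement p q (W ⊓ adEigenspace S (w₀ p q - w)) w ≤ H1of S p q W := by
  refine Submodule.span_mono ?_
  rintro u ⟨c, a, b, X, ha, hb, ⟨hX, hX2⟩, rfl, rfl⟩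
  refine ⟨c, a, b, X, ha, hb, hX, ?_, rfl⟩
  rw [mem_adEigenspace.1 hX2]; congr 1; push_cast; ring

theorem comp_H1of (hS : Diagonalizes P d S) (hu : u ∈ H1of S p q W) (w : ℤ) :
    comp P d (w₀ p q - w) u ∈ complement p q W w := by
  induction hu using Submodule.span_induction with
  | zero => rw [map_zero]; exact Submodule.zero_mem _
  | add x y _ _ hx hy => rw [map_add]; exact Submodule.add_mem _ hx hy
  | smul c x _ hx => rw [map_smul]; exact Submodule.smul_mem _ _ hx
  | mem x hx =>
    obtain ⟨c, a, b, X, ha, hb, hX, hSX, rfl⟩ := hx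
    by_cases hw : (c : ℤ) * (p * q) + a * q + b * p = w
    · refine Submodule.subset_span ⟨c, a, b, X, ha, hb, hX, hw, ?_⟩
      funext z
      rw [comp_apply, map_smul, adProj_of_eigen hS]
      rw [hSX, ← hw]; congr 1; push_cast; ring
    · convert! Submodule.zero_mem _ using 1
      funext z
      rw [comp_apply, map_smul, adProj_of_eigen_ne hS _ hSX, smul_zero]
      · rfl
      · intro h
        apply hw
        have : (((c : ℤ) * (p * q) + a * q + b * p : ℤ) : ℂ) = w := by
          push_cast; linear_combination -h
        exact_mod_cast this

theorem vderiv_ham_H0of (hu : u ∈ H0of S p q W) : vderiv (hamField p q) u = 0 := by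
  induction hu using Submodule.span_induction with
  | zero => exact vderiv_const _ 0
  | add x y hx hy h1 h2 =>
    rw [vderiv_add' _ (H0of_le_weightGL hx).1 (H0of_le_weightGL hy).1, h1, h2, add_zero]
  | smul c x hx h => rw [vderiv_smul' _ _ (H0of_le_weightGL hx).1, h, smul_zero]
  | mem x hx =>
    obtain ⟨c, X, -, -, rfl⟩ := hx
    rw [vderiv_ham_mul_curveFn_pow (IsHol.const X), vderiv_const]
    funext z; simp

theorem lie_mul_eigen {X Y : Mat n} {ν : ℂ} (hX : ⁅S, X⁆ = μ • X) (hY : ⁅S, Y⁆ = ν • Y) :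
    ⁅S, X * Y⁆ = (μ + ν) • (X * Y) := by
  have h : ⁅S, X * Y⁆ = ⁅S, X⁆ * Y + X * ⁅S, Y⁆ := by simp only [Ring.lie_def]; noncomm_ring
  rw [h, hX, hY, smul_mul_assoc, mul_smul_comm, add_smul]

/-- Span induction in both factors of a product. -/
theorem mul_mem_of_span {s t : Set (MatFun n)} {M : Submodule ℂ (MatFun n)}
    (h : ∀ x ∈ s, ∀ y ∈ t, x * y ∈ M) {x y : MatFun n} (hx : x ∈ Submodule.span ℂ s)
    (hy : y ∈ Submodule.span ℂ t) : x * y ∈ M := by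
  induction hx using Submodule.span_induction with
  | zero => rw [zero_mul]; exact M.zero_mem
  | add a b _ _ ha hb => rw [add_mul]; exact M.add_mem ha hb
  | smul c a _ ha => rw [smul_mul_assoc]; exact M.smul_mem _ ha
  | mem a ha =>
    induction hy using Submodule.span_induction with
    | zero => rw [mul_zero]; exact M.zero_mem
    | add b c _ _ hb hc => rw [mul_add]; exact M.add_mem hb hc
    | smul c b _ hb => rw [mul_smul_comm]; exact M.smul_mem _ hb
    | mem b hb => exact h a ha b hb

theorem mul_mem_H0of {u' : MatFun n} (hu : u ∈ H0of S p q ⊤) (hu' : u' ∈ H0of S p q ⊤) :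
    u * u' ∈ H0of S p q ⊤ := by
  refine mul_mem_of_span ?_ hu hu'
  rintro _ ⟨c, X, -, hX, rfl⟩ _ ⟨c', Y, -, hY, rfl⟩
  refine Submodule.subset_span ⟨c + c', X * Y, trivial, ?_, ?_⟩
  · rw [lie_mul_eigen hX hY]; congr 1; push_cast; ring
  · funext z
    simp only [Pi.mul_apply, smul_mul_assoc, mul_smul_comm, smul_smul, pow_add]
    congr 1; ring

theorem H0of_mul_H1of {u' : MatFun n} (hu : u ∈ H0of S p q ⊤) (hu' : u' ∈ H1of S p q ⊤) :
    u * u' ∈ H1of S p q ⊤ := by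
  refine mul_mem_of_span ?_ hu hu'
  rintro _ ⟨c, X, -, hX, rfl⟩ _ ⟨c', a, b, Y, ha, hb, -, hY, rfl⟩
  refine Submodule.subset_span ⟨c + c', a, b, X * Y, ha, hb, trivial, ?_, ?_⟩
  · rw [lie_mul_eigen hX hY]; congr 1; push_cast; ring
  · funext z
    simp only [Pi.mul_apply, smul_mul_assoc, mul_smul_comm, smul_smul, pow_add, monom]
    congr 1; ring

theorem H1of_mul_H0of {u' : MatFun n} (hu : u ∈ H1of S p q ⊤) (hu' : u' ∈ H0of S p q ⊤) :
    u * u' ∈ H1of S p q ⊤ := by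
  refine mul_mem_of_span ?_ hu hu'
  rintro _ ⟨c', a, b, Y, ha, hb, -, hY, rfl⟩ _ ⟨c, X, -, hX, rfl⟩
  refine Submodule.subset_span ⟨c + c', a, b, Y * X, ha, hb, trivial, ?_, ?_⟩
  · rw [lie_mul_eigen hY hX]; congr 1; push_cast; ring
  · funext z
    simp only [Pi.mul_apply, smul_mul_assoc, mul_smul_comm, smul_smul, pow_add, monom]
    congr 1; ring

theorem curveFn_one_zero (hq : 0 < q) : curveFn p q (1, 0) = 1 := by
  simp [curveFn, hq.ne']

/-- If `V(u)` differs from `u γ - γ' u` by an element of `H^1`, then `u` lies in `H^0`. -/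
theorem mem_H0of_of_vderiv (hS : Diagonalizes P d S) (hp : 0 < p) (hq : 0 < q)
    (hcop : Nat.Coprime p q) {γ γ' h : MatFun n} (hu : u ∈ weightGL S p q 0)
    (hγ : γ ∈ H1of S p q ⊤) (hγ' : γ' ∈ H1of S p q ⊤) (hh : h ∈ H1of S p q ⊤)
    (hγo : γ ∈ orderGE n p q (w₀ p q + 1)) (hγo' : γ' ∈ orderGE n p q (w₀ p q + 1))
    (hV : vderiv (hamField p q) u = u * γ - γ' * u + h) : u ∈ H0of S p q ⊤ := by
  -- Successive approximation of `u` by elements of `H^0`, gaining one order at a time; past the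
  -- order bound the remainder is zero.
  have key : ∀ v : ℕ, ∃ u' ∈ H0of S p q ⊤, u - u' ∈ orderGE n p q v := by
    intro v
    induction v with
    | zero =>
      refine ⟨0, Submodule.zero_mem _, ?_⟩
      rw [sub_zero]
      exact weightGL_le_orderGE hS hp hq hu
    | succ v ih =>
      obtain ⟨u', hu', hv⟩ := ih
      have hu'w := H0of_le_weightGL hu'
      have hd : u - u' ∈ weightGL S p q 0 := Submodule.sub_mem _ hu hu'w
      have hV' : vderiv (hamField p q) (u - u')
          = ((u - u') * γ - γ' * (u - u')) + (u' * γ - γ' * u' + h) := by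
        rw [vderiv_sub' _ hu.1 hu'w.1, hV, vderiv_ham_H0of hu']
        noncomm_ring
      have h2 : u' * γ - γ' * u' + h ∈ H1of S p q ⊤ :=
        Submodule.add_mem _ (Submodule.sub_mem _ (H0of_mul_H1of hu' hγ) (H1of_mul_H0of hγ' hu')) hh
      have h3 : (u - u') * γ - γ' * (u - u') ∈ orderGE n p q (v + w₀ p q + 1) := by
        refine Submodule.sub_mem _ ?_ ?_
        · have := mul_mem_orderGE hv hγo
          rwa [← add_assoc] at this
        · have := mul_mem_orderGE hγo' hv
          rwa [show w₀ p q + 1 + v = v + w₀ p q + 1 by ring] at this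
      have h4 : (u - u') * γ - γ' * (u - u') ∈ weightGL S p q (w₀ p q) := by
        refine Submodule.sub_mem _ ?_ ?_
        · simpa using mul_mem_weightGL hd (H1of_le_weightGL hγ)
        · simpa using mul_mem_weightGL (H1of_le_weightGL hγ') hd
      set c := comp P d (((0 : ℤ) : ℂ) - ((v : ℤ) : ℂ)) (u - u') with hc
      have hcq : c ∈ quasiHom p q ⊤ v := quasiHom_mono le_top
        (comp_mem_quasiHom (W := ⊤) hS hp hq (fun _ _ => trivial) hd (fun _ => trivial) v)
      -- The products of the remainder `u - u'` with `γ` and `γ'` have order at least `v + w₀ + 1`,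
      -- so they do not contribute in weight `v + w₀`. There `V(c)` comes only from the `H^1` term.
      have hcV : vderiv (hamField p q) c ∈ complement p q ⊤ ((v : ℤ) + w₀ p q) := by
        have e : ((0 : ℤ) : ℂ) - ((v : ℤ) : ℂ) = w₀ p q - ((v : ℤ) + w₀ p q : ℤ) := by
          push_cast; ring
        rw [hc, vderiv_comp _ hd.1, hV', map_add, e,
          comp_eq_zero_of_lt hS h4 h3 (by omega), zero_add]
        exact comp_H1of hS h2 _
      have hcH : c ∈ H0of S p q ⊤ := by
        rcases eq_curveFn_pow_of_vderiv_mem_complement hp hq hcop (v + 1) (by omega) hcq hcV with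
          h5 | ⟨m, R, hm, h5⟩
        · rw [h5]; exact Submodule.zero_mem _
        · refine Submodule.subset_span ⟨m, R, trivial, ?_, h5⟩
          -- As `f = 1` at `(1, 0)`, the coefficient `R` is a value of `c`, hence lies in the
          -- eigenspace of `ad_S` in which `c` takes its values.
          have hR : c (1, 0) = R := by rw [h5]; simp [curveFn_one_zero hq]
          rw [← hR]
          have := lie_adProj hS (((0 : ℤ) : ℂ) - ((v : ℤ) : ℂ)) ((u - u') (1, 0))
          rw [← hm] at this
          push_cast at this
          rw [zero_sub] at this
          rw [hc, comp_apply, ← hm]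
          push_cast
          rw [zero_sub]
          exact this
      refine ⟨u' + c, Submodule.add_mem _ hu' hcH, ?_⟩
      rw [← sub_sub]
      have := sub_comp_mem_orderGE hS hp hq hd hv
      rw [Nat.cast_succ]
      exact this
  obtain ⟨B, hB⟩ := exists_order_bound hS hp hq 0
  obtain ⟨u', hu', hv⟩ := key B
  have := hB B le_rfl _ (Submodule.sub_mem _ hu (H0of_le_weightGL hu')) hv
  rw [sub_eq_zero.1 this]
  exact hu'

/-- Representatives of the elements of `H^0`. -/
theorem exists_of_mem_H0of (hu : u ∈ H0of S p q W) : ∃ (s : Finset ℕ) (R : ℕ → Mat n),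
    (∀ c, R c ∈ W ∧ ⁅S, R c⁆ = (-((c : ℂ) * (p * q))) • R c) ∧
      u = fun z => ∑ c ∈ s, curveFn p q z ^ c • R c := by
  have h0 : ∀ c : ℕ, (0 : Mat n) ∈ W ∧ ⁅S, (0 : Mat n)⁆ = (-((c : ℂ) * (p * q))) • (0 : Mat n) :=
    fun c => ⟨W.zero_mem, by simp [Ring.lie_def]⟩
  suffices H : ∃ (s : Finset ℕ) (R : ℕ → Mat n),
      (∀ c, R c ∈ W ∧ ⁅S, R c⁆ = (-((c : ℂ) * (p * q))) • R c) ∧ (∀ c ∉ s, R c = 0) ∧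
      u = fun z => ∑ c ∈ s, curveFn p q z ^ c • R c by
    obtain ⟨s, R, h1, -, h2⟩ := H
    exact ⟨s, R, h1, h2⟩
  induction hu using Submodule.span_induction with
  | zero => exact ⟨∅, 0, h0, fun _ _ => rfl, by funext z; simp⟩
  | add x y _ _ hx hy =>
    obtain ⟨s, R, h1, h2, rfl⟩ := hx
    obtain ⟨s', R', h1', h2', rfl⟩ := hy
    classical
    refine ⟨s ∪ s', R + R', fun c => ⟨W.add_mem (h1 c).1 (h1' c).1,
      (adEigenspace S (-((c : ℂ) * (p * q)))).add_mem (h1 c).2 (h1' c).2⟩, fun c hc => ?_, ?_⟩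
    · rw [Finset.mem_union, not_or] at hc
      rw [Pi.add_apply, h2 c hc.1, h2' c hc.2, add_zero]
    · funext z
      simp only [Pi.add_apply, smul_add, Finset.sum_add_distrib]
      congr 1
      · exact Finset.sum_subset Finset.subset_union_left fun c _ hc => by rw [h2 c hc, smul_zero]
      · exact Finset.sum_subset Finset.subset_union_right fun c _ hc => by rw [h2' c hc, smul_zero]
  | smul r x _ hx =>
    obtain ⟨s, R, h1, h2, rfl⟩ := hx
    refine ⟨s, r • R, fun c => ⟨W.smul_mem r (h1 c).1,
      (adEigenspace S (-((c : ℂ) * (p * q)))).smul_mem r (h1 c).2⟩, fun c hc => ?_, ?_⟩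
    · rw [Pi.smul_apply, h2 c hc, smul_zero]
    · funext z
      simp only [Pi.smul_apply, Finset.smul_sum, smul_comm r]
  | mem x hx =>
    obtain ⟨c, X, hX, hSX, rfl⟩ := hx
    refine ⟨{c}, Pi.single c X, fun c' => ?_, fun c' hc' => ?_, ?_⟩
    · by_cases h : c' = c
      · subst h; rw [Pi.single_eq_same]; exact ⟨hX, hSX⟩
      · rw [Pi.single_eq_of_ne h]; exact h0 c'
    · rw [Pi.single_eq_of_ne (by simpa using hc')]
    · funext z; simp

/-- The eigenvalues `-cpq` are distinct, so the coefficients of a polynomial in `f` can be read off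
from its value where `f = 1`. -/
theorem adProj_sum_eigen (hS : Diagonalizes P d S) (hp : 0 < p) (hq : 0 < q) {s : Finset ℕ}
    {R : ℕ → Mat n} (hR : ∀ c, ⁅S, R c⁆ = (-((c : ℂ) * (p * q))) • R c) {c : ℕ} (hc : c ∈ s) :
    adProj P d (-((c : ℂ) * (p * q))) (∑ c ∈ s, R c) = R c := by
  have hpq : (p : ℂ) * q ≠ 0 := by
    have : 0 < p * q := by positivity
    exact_mod_cast this.ne'
  rw [map_sum, Finset.sum_eq_single_of_mem c hc, adProj_of_eigen hS (hR c)]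
  intro c' _ hne
  refine adProj_of_eigen_ne hS (fun h => hne ?_) (hR c')
  have := mul_right_cancel₀ hpq (neg_injective h)
  exact_mod_cast this

/-- An element of `H^0` is determined by its value at a point with `f = 1`. -/
theorem eq_of_mem_H0of (hS : Diagonalizes P d S) (hp : 0 < p) (hq : 0 < q) {u' : MatFun n}
    (hu : u ∈ H0of S p q ⊤) (hu' : u' ∈ H0of S p q ⊤) (h : u (1, 0) = u' (1, 0)) : u = u' := by
  obtain ⟨s, R, hR, hd⟩ := exists_of_mem_H0of (Submodule.sub_mem _ hu hu')
  have h0 : ∑ c ∈ s, R c = 0 := by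
    have := congrFun hd (1, 0)
    simpa [curveFn_one_zero hq, h] using this.symm
  refine sub_eq_zero.1 (hd.trans ?_)
  funext z
  refine Finset.sum_eq_zero fun c hc => ?_
  rw [← adProj_sum_eigen hS hp hq (fun c => (hR c).2) hc, h0, map_zero, smul_zero]

/-- Each coefficient is a projection of the value at `(1, 0)`, and the projections preserve an
`ad_S`-stable `W`. This brings results for all matrices back to `𝔤`. -/
theorem mem_H0of_of_forall_mem (hS : Diagonalizes P d S) (hp : 0 < p) (hq : 0 < q)
    (hWS : ∀ X ∈ W, ⁅S, X⁆ ∈ W) (hu : u ∈ H0of S p q ⊤) (huW : ∀ z, u z ∈ W) :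
    u ∈ H0of S p q W := by
  obtain ⟨s, R, hR, rfl⟩ := exists_of_mem_H0of hu
  have h1 : ∑ c ∈ s, R c ∈ W := by
    have := huW (1, 0)
    simpa [curveFn_one_zero hq] using this
  have h2 : (fun z => ∑ c ∈ s, curveFn p q z ^ c • R c)
      = ∑ c ∈ s, fun z => curveFn p q z ^ c • R c := by
    funext z; rw [Finset.sum_apply]
  rw [h2]
  refine Submodule.sum_mem _ fun c hc => Submodule.subset_span ⟨c, R c, ?_, (hR c).2, rfl⟩
  rw [← adProj_sum_eigen hS hp hq (fun c => (hR c).2) hc]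
  exact adProj_mem hS hWS _ h1

theorem vderiv_ham_curveFn_pow_smul (c : ℕ) (R : Mat n) :
    vderiv (hamField p q) (fun z => curveFn p q z ^ c • R) = 0 := by
  rw [vderiv_ham_mul_curveFn_pow (IsHol.const R), vderiv_const]
  funext z; simp

/-- A component of `u` is decomposed as `V(u') + h'` with coefficients in `W`. Over all matrices it
already lies in `complement`, so `V(u')` does too and must vanish; the component is `h'`. No linear
independence of the monomials `f^c x^a y^b` is needed. -/
theorem mem_H1of_of_forall_mem (hS : Diagonalizes P d S) (hp : 0 < p) (hq : 0 < q)
    (hcop : Nat.Coprime p q) (hWS : ∀ X ∈ W, ⁅S, X⁆ ∈ W) (hu : u ∈ H1of S p q ⊤)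
    (huW : ∀ z, u z ∈ W) : u ∈ H1of S p q W := by
  refine mem_of_comp_mem (P := P) (d := d) fun μ _ => ?_
  rcases comp_eq_zero_or hS hp hq hWS (H1of_le_weightGL hu) huW μ with h | ⟨w, rfl, h⟩
  · rw [h]; exact Submodule.zero_mem _
  · obtain ⟨u', hu', h', hh', he⟩ := exists_eq_vderiv_add_complement hp hq h
    have h1 : vderiv (hamField p q) u' ∈ complement p q ⊤ (w - w₀ p q + w₀ p q) := by
      rw [sub_add_cancel, eq_sub_of_add_eq he.symm]
      exact Submodule.sub_mem _ (comp_H1of hS hu w) (complement_mono le_top hh')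
    obtain ⟨N, hN⟩ : ∃ N : ℕ, w - w₀ p q < N := ⟨(w - w₀ p q + 1).toNat, by omega⟩
    have h2 : vderiv (hamField p q) u' = 0 := by
      rcases eq_curveFn_pow_of_vderiv_mem_complement hp hq hcop N hN (quasiHom_mono le_top hu') h1
        with rfl | ⟨m, R, -, rfl⟩
      · exact vderiv_const _ 0
      · exact vderiv_ham_curveFn_pow_smul m R
    rw [he, h2, zero_add]
    exact complement_le_H1of hh'

end Grading

/-! ### The linear theory: orders in `U_0^1` and the quasi-isomorphism. -/

section Gauge

variable {P : GL (Fin n) ℂ} {d : Fin n → ℂ} {S : Mat n} {p q : ℕ} {k l w v : ℤ} {u : MatFun n}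
  {G : ReductiveGroup n}

theorem lie_stable (hSg : S ∈ G.lieAlgebra) : ∀ X ∈ G.lieAlgebra, ⁅S, X⁆ ∈ G.lieAlgebra :=
  fun _ hX => lie_mem G.zariskiClosed hSg hX

/-- If all positive integer eigenvalues of `ad_S` exceed `w₀`, then all weights occurring in `U_0^1`
exceed `w₀`. -/
theorem U1_le_orderGE (hS : Diagonalizes P d S) (hp : 0 < p) (hq : 0 < q)
    (hcop : Nat.Coprime p q) (hSg : S ∈ G.lieAlgebra) (hlarge : G.LargeEnough S p q)
    (hu : u ∈ G.U1 S p q) : u ∈ orderGE n p q (w₀ p q + 1) := by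
  obtain ⟨hu1, hu2⟩ := (mem_weightSpace_iff G).1 hu
  refine mem_of_comp_mem (P := P) (d := d) fun μ _ => ?_
  rcases comp_eq_zero_or hS hp hq (lie_stable hSg) hu1 hu2 μ with h | ⟨w, rfl, h⟩
  · rw [h]; exact Submodule.zero_mem _
  by_cases hw : w₀ p q + 1 ≤ w
  · exact quasiHom_le_orderGE hw h
  rcases quasiHom_eq_zero_or h with h0 | ⟨m, j, rfl⟩
  · rw [h0]; exact Submodule.zero_mem _
  by_cases h0 : comp P d ((w₀ p q : ℂ) - ((q : ℤ) * m + p * j : ℤ)) u = 0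
  · rw [h0]; exact Submodule.zero_mem _
  obtain ⟨z, hz⟩ := Function.ne_iff.1 h0
  have hne := w₀_not_representable hp hcop m j
  -- In this case the weight `w` satisfies `0 ≤ w ≤ w₀` and `w ≠ w₀`, so a nonzero component would
  -- produce the positive integer eigenvalue `w₀ - w ≤ w₀` of `ad_S` on `𝔤`.
  have hmem := mem_of_mem_quasiHom h z
  have hnn : (0 : ℤ) ≤ (q : ℤ) * m + p * j := by positivity
  have := hlarge (w₀ p q - ((q : ℤ) * m + p * j)) (by omega)
    ⟨_, hmem.1, hz, by rw [mem_adEigenspace.1 hmem.2]; push_cast; rfl⟩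
  omega

/-- The common inductive step of the linear and nonlinear surjectivity arguments: the component of
lowest weight is split by the decomposition for `V`, applied with coefficients in an eigenspace of
`ad_S` on `𝔤`. -/
theorem exists_leading_term (hS : Diagonalizes P d S) (hp : 0 < p) (hq : 0 < q)
    (hSg : S ∈ G.lieAlgebra) (hu : u ∈ G.U1 S p q) (hv : u ∈ orderGE n p q v) :
    ∃ h ∈ G.H1 S p q, ∃ u' ∈ G.U0 S p q, u' ∈ orderGE n p q (v - w₀ p q) ∧
      u - (h + vderiv (hamField p q) u') ∈ orderGE n p q (v + 1) := by
  obtain ⟨hu1, hu2⟩ := (mem_weightSpace_iff G).1 hu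
  obtain ⟨u', hu', h, hh, he⟩ := exists_eq_vderiv_add_complement hp hq
    (comp_mem_quasiHom hS hp hq (lie_stable hSg) hu1 hu2 v)
  refine ⟨h, complement_le_H1of hh, u', ?_, quasiHom_le_orderGE le_rfl hu', ?_⟩
  · refine (mem_weightSpace_iff G).2 ⟨quasiHom_le_weightGL (w := v - w₀ p q) ?_,
      fun z => (mem_of_mem_quasiHom hu' z).1⟩
    refine quasiHom_mono ?_ hu'
    have : ((w₀ p q : ℂ) - v) = ((0 : ℤ) : ℂ) - ((v - w₀ p q : ℤ) : ℂ) := by push_cast; ring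
    rw [this]
    exact inf_le_right
  · rw [add_comm h, ← he]
    exact sub_comp_mem_orderGE hS hp hq hu1 hv

theorem vderiv_ham_mem_U1 (hu : u ∈ G.U0 S p q) : vderiv (hamField p q) u ∈ G.U1 S p q :=
  (G.delta S p q ⟨u, hu⟩).2

theorem commutator_mem_U1 {γ : MatFun n} (hγ : γ ∈ G.U1 S p q) (hu : u ∈ G.U0 S p q) :
    γ * u - u * γ ∈ G.U1 S p q :=
  (G.adU S p q ⟨γ, hγ⟩ ⟨u, hu⟩).2

theorem isHol_of_mem_U0 (hu : u ∈ G.U0 S p q) : IsHol u := hu.1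

theorem vderiv_zero (X : ℂ × ℂ → ℂ × ℂ) : vderiv X (0 : MatFun n) = 0 := vderiv_const _ 0

/-- `U_0^1` is the sum of `H^1` and the image of `δ_S + ad_γ`. -/
theorem exists_H1_add_twistedDiff (hS : Diagonalizes P d S) (hp : 0 < p) (hq : 0 < q)
    (hcop : Nat.Coprime p q) (hSg : S ∈ G.lieAlgebra) (hlarge : G.LargeEnough S p q)
    {γ η : MatFun n} (hγ : γ ∈ G.U1 S p q) (hη : η ∈ G.U1 S p q) :
    ∃ h ∈ G.H1 S p q, ∃ u ∈ G.U0 S p q, u ∈ orderGE n p q 1 ∧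
      η = h + (vderiv (hamField p q) u + (γ * u - u * γ)) := by
  obtain ⟨B, hB⟩ := exists_order_bound hS hp hq (w₀ p q)
  have hγo := U1_le_orderGE hS hp hq hcop hSg hlarge hγ
  -- `N` bounds the distance of the order `v` from `B`, beyond which `U_0^1` contains only zero.
  -- Starting at `v = w₀ + 1` ensures that each correction has order `v - w₀ ≥ 1`.
  have key : ∀ N : ℕ, ∀ v : ℤ, w₀ p q + 1 ≤ v → (B : ℤ) ≤ v + N → ∀ η ∈ G.U1 S p q,
      η ∈ orderGE n p q v → ∃ h ∈ G.H1 S p q, ∃ u ∈ G.U0 S p q, u ∈ orderGE n p q 1 ∧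
        η = h + (vderiv (hamField p q) u + (γ * u - u * γ)) := by
    intro N
    induction N with
    | zero =>
      intro v _ hvB η hη hv
      have := hB v (by simpa using hvB) η ((mem_weightSpace_iff G).1 hη).1 hv
      exact ⟨0, Submodule.zero_mem _, 0, Submodule.zero_mem _, Submodule.zero_mem _, by
        rw [this, vderiv_zero]; simp⟩
    | succ N ih =>
      intro v hv1 hvB η hη hv
      -- The term `[γ, u]` has order at least `(w₀ + 1) + (v - w₀) = v + 1`, so it only changes the
      -- remainder.
      obtain ⟨h, hh, u, hu, huo, hr⟩ := exists_leading_term hS hp hq hSg hη hv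
      have h1 : γ * u - u * γ ∈ orderGE n p q (v + 1) := by
        refine Submodule.sub_mem _ ?_ ?_
        · have := mul_mem_orderGE hγo huo
          rwa [show w₀ p q + 1 + (v - w₀ p q) = v + 1 by ring] at this
        · have := mul_mem_orderGE huo hγo
          rwa [show v - w₀ p q + (w₀ p q + 1) = v + 1 by ring] at this
      obtain ⟨h', hh', u', hu', huo', he⟩ := ih (v + 1) (by omega) (by push_cast at hvB; omega)
        (η - (h + vderiv (hamField p q) u) - (γ * u - u * γ))
        (Submodule.sub_mem _ (Submodule.sub_mem _ hη (Submodule.add_mem _ (G.H1_le S p q hh)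
          (vderiv_ham_mem_U1 hu))) (commutator_mem_U1 hγ hu)) (Submodule.sub_mem _ hr h1)
      refine ⟨h + h', Submodule.add_mem _ hh hh', u + u', Submodule.add_mem _ hu hu',
        Submodule.add_mem _ (orderGE_anti (by omega) huo) huo', ?_⟩
      rw [vderiv_add' _ (isHol_of_mem_U0 hu) (isHol_of_mem_U0 hu'), mul_add, add_mul]
      rw [sub_sub, sub_eq_iff_eq_add] at he
      rw [he]
      abel
  refine key (B - (w₀ p q + 1)).toNat (w₀ p q + 1) le_rfl (by omega) η hη
    (U1_le_orderGE hS hp hq hcop hSg hlarge hη)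

theorem quasiIso (hS : Diagonalizes P d S) (hp : 0 < p) (hq : 0 < q)
    (hcop : Nat.Coprime p q) (hSg : S ∈ G.lieAlgebra) (hlarge : G.LargeEnough S p q)
    (γ : G.H1 S p q) :
    IsQuasiIso₂ (G.adH S p q γ) (G.twistedDiff S p q (G.inclH1 S p q γ))
      (G.inclH0 S p q) (G.inclH1 S p q) (G.inclusion_comm S p q γ) := by
  have hγo := U1_le_orderGE hS hp hq hcop hSg hlarge (G.H1_le S p q γ.2)
  have hγ1 : (γ : MatFun n) ∈ H1of S p q ⊤ := H1of_mono le_top γ.2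
  -- The case `h = 0` gives surjectivity on kernels; general `h` gives injectivity on cokernels.
  have key : ∀ (x : G.U0 S p q) (h : G.H1 S p q),
      G.twistedDiff S p q (G.inclH1 S p q γ) x = G.inclH1 S p q h →
      (x : MatFun n) ∈ G.H0 S p q := by
    intro x h hx
    have hx' : vderiv (hamField p q) (x : MatFun n) + ((γ : MatFun n) * (x : MatFun n)
        - (x : MatFun n) * (γ : MatFun n)) = (h : MatFun n) :=
      congrArg Subtype.val hx
    have hxw := (mem_weightSpace_iff G).1 x.2
    refine mem_H0of_of_forall_mem hS hp hq (lie_stable hSg)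
      (mem_H0of_of_vderiv hS hp hq hcop hxw.1 hγ1 hγ1 (H1of_mono le_top h.2) hγo hγo ?_) hxw.2
    rw [← hx']; abel
  have hinj0 : Function.Injective (G.inclH0 S p q) := Submodule.inclusion_injective _
  have hinj1 : Function.Injective (G.inclH1 S p q) := Submodule.inclusion_injective _
  have hcomm := fun x => LinearMap.congr_fun (G.inclusion_comm S p q γ) x
  refine ⟨⟨?_, ?_⟩, ⟨?_, ?_⟩⟩
  · intro x y hxy
    exact Subtype.ext (hinj0 (congrArg Subtype.val hxy))
  · rintro ⟨x, hx⟩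
    have hx0 := key x 0 (by rw [map_zero]; exact hx)
    refine ⟨⟨⟨x, hx0⟩, ?_⟩, Subtype.ext (Subtype.ext rfl)⟩
    rw [LinearMap.mem_ker]
    apply hinj1
    rw [map_zero]
    exact (hcomm ⟨x, hx0⟩).trans hx
  · rw [← LinearMap.ker_eq_bot, eq_bot_iff]
    intro y hy
    obtain ⟨η, rfl⟩ := Submodule.Quotient.mk_surjective _ y
    rw [LinearMap.mem_ker, Submodule.mapQ_apply, Submodule.Quotient.mk_eq_zero] at hy
    obtain ⟨x, hx⟩ := hy
    have hx0 := key x η hx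
    rw [Submodule.mem_bot, Submodule.Quotient.mk_eq_zero]
    exact ⟨⟨x, hx0⟩, hinj1 ((hcomm ⟨x, hx0⟩).trans hx)⟩
  · intro y
    obtain ⟨η, rfl⟩ := Submodule.Quotient.mk_surjective _ y
    obtain ⟨h, hh, u, hu, -, he⟩ := exists_H1_add_twistedDiff hS hp hq hcop hSg hlarge
      (G.H1_le S p q γ.2) η.2
    refine ⟨Submodule.Quotient.mk ⟨h, hh⟩, ?_⟩
    rw [Submodule.mapQ_apply, Submodule.Quotient.eq]
    refine ⟨-⟨u, hu⟩, Subtype.ext ?_⟩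
    rw [map_neg]
    change -(vderiv (hamField p q) u + ((γ : MatFun n) * u - u * γ)) = h - (η : MatFun n)
    rw [he]; abel

end Gauge

/-! ### Exponentials of positive order and the nonlinear reduction to `H^1`. -/

section Exponential

variable {P : GL (Fin n) ℂ} {d : Fin n → ℂ} {S : Mat n} {p q : ℕ} {v : ℤ} {u : MatFun n}
  {G : ReductiveGroup n}

theorem exp_eq_sum_of_pow_eq_zero {A : Mat n} {N : ℕ} (h : A ^ N = 0) :
    NormedSpace.exp A = ∑ k ∈ Finset.range N, ((k.factorial : ℂ)⁻¹) • A ^ k := by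
  rw [NormedSpace.exp_eq_tsum ℂ]
  refine tsum_eq_sum fun k hk => ?_
  rw [pow_eq_zero_of_le (not_lt.1 (by simpa using hk)) h, smul_zero]

/-- Powers of `u` keep `k = 0` while their order grows, so they pass the order bound. The exponent
is `N + 2` so that the truncated series of `exp` always contains the terms `1` and `u`. -/
theorem exists_pow_eq_zero (hS : Diagonalizes P d S) (hp : 0 < p) (hq : 0 < q)
    (hu : u ∈ weightGL S p q 0) (huo : u ∈ orderGE n p q 1) : ∃ N : ℕ, u ^ (N + 2) = 0 := by
  obtain ⟨B, hB⟩ := exists_order_bound hS hp hq 0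
  refine ⟨B, hB (B + 2) (by omega) _ (pow_mem_weightGL hu _) ?_⟩
  have := pow_mem_orderGE huo (B + 2)
  push_cast at this
  rwa [mul_one] at this

/-- The truncated exponential series. -/
noncomputable def expSum (N : ℕ) (u : MatFun n) : MatFun n :=
  ∑ k ∈ Finset.range N, ((k.factorial : ℂ)⁻¹) • u ^ k

theorem exp_eq_expSum {N : ℕ} (h : u ^ N = 0) (z : ℂ × ℂ) :
    NormedSpace.exp (u z) = expSum N u z := by
  have h1 : u z ^ N = 0 := congrFun h z
  rw [exp_eq_sum_of_pow_eq_zero h1, expSum, Finset.sum_apply]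
  rfl

theorem expSum_mem_weightGL (N : ℕ) (hu : u ∈ weightGL S p q 0) :
    expSum N u ∈ weightGL S p q 0 :=
  Submodule.sum_mem _ fun k _ => Submodule.smul_mem _ _ (pow_mem_weightGL hu k)

theorem expSum_sub_one_sub_mem (N : ℕ) (hv : 0 ≤ v) (huo : u ∈ orderGE n p q v) :
    expSum (N + 2) u - 1 - u ∈ orderGE n p q (2 * v) := by
  have h : expSum (N + 2) u - 1 - u
      = ∑ k ∈ Finset.range N, (((k + 2).factorial : ℂ)⁻¹) • u ^ (k + 2) := by
    rw [expSum, Finset.sum_range_succ', Finset.sum_range_succ']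
    simp
  rw [h]
  refine Submodule.sum_mem _ fun k _ => Submodule.smul_mem _ _ ?_
  refine orderGE_anti ?_ (pow_mem_orderGE huo (k + 2))
  push_cast
  nlinarith [mul_nonneg (Int.natCast_nonneg k) hv]

theorem expGL_inv (A : Mat n) : (((expGL A)⁻¹ : GL (Fin n) ℂ) : Mat n) = NormedSpace.exp (-A) := by
  rw [Matrix.coe_units_inv, coe_expGL, Matrix.exp_neg]

/-- By nilpotency `exp u` is a polynomial in `u`, hence holomorphic and of weight zero. Its values
lie in `G` by the definition of `𝔤`. -/
theorem exp_mem_aut (hS : Diagonalizes P d S) (hp : 0 < p) (hq : 0 < q)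
    (hu : u ∈ G.U0 S p q) (huo : u ∈ orderGE n p q 1) : (fun z => expGL (u z)) ∈ G.aut S p q := by
  obtain ⟨hu1, hu2⟩ := (mem_weightSpace_iff G).1 hu
  obtain ⟨N, hN⟩ := exists_pow_eq_zero hS hp hq hu1 huo
  have he : (fun z => ((expGL (u z) : GL (Fin n) ℂ) : Mat n)) = expSum (N + 2) u :=
    funext fun z => exp_eq_expSum hN z
  have hw : expSum (N + 2) u ∈ weightGL S p q 0 := expSum_mem_weightGL _ hu1
  refine ⟨⟨by rw [he]; exact hw.1, fun z => ?_⟩, fun z => ?_⟩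
  · have := hu2 z 1
    rwa [one_smul] at this
  · refine (ReductiveGroup.preserves_iff S p q (fun z => expGL (u z)) z).2 ?_
    have h1 := eq_sub_of_add_eq (hw.2 z)
    rw [← he, Int.cast_zero, zero_smul, zero_sub, Ring.lie_def, neg_sub] at h1
    exact h1

/-- To first order `exp u` acts by `η ↦ η - V(u)`. What remains contains either a factor `η`, of
order above `w₀`, multiplied by a term of order `a`, or `V` with total order at least `2a + w₀`;
since `a ≥ 1`, both reach `a + w₀ + 1`. -/
theorem sub_gaugeAct_exp_mem (hS : Diagonalizes P d S) (hp : 0 < p) (hq : 0 < q)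
    (hu : u ∈ G.U0 S p q) {a : ℤ} (ha : 1 ≤ a) (huo : u ∈ orderGE n p q a) {η : MatFun n}
    (hη : η ∈ orderGE n p q (w₀ p q + 1)) :
    ReductiveGroup.gaugeAct p q (fun z => expGL (u z)) η - (η - vderiv (hamField p q) u)
      ∈ orderGE n p q (a + w₀ p q + 1) := by
  obtain ⟨hu1, hu2⟩ := (mem_weightSpace_iff G).1 hu
  obtain ⟨N, hN⟩ := exists_pow_eq_zero hS hp hq hu1 (orderGE_anti ha huo)
  have hN' : (-u) ^ (N + 2) = 0 := by rw [neg_pow, hN, mul_zero]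
  set e := expSum (N + 2) u with he
  set e' := expSum (N + 2) (-u) with he'
  have h1 : ReductiveGroup.gaugeAct p q (fun z => expGL (u z)) η
      = e * η * e' - vderiv (hamField p q) e * e' := by
    funext z
    have hee : (fun z => ((expGL (u z) : GL (Fin n) ℂ) : Mat n)) = e :=
      funext fun z => exp_eq_expSum hN z
    simp only [ReductiveGroup.gaugeAct]
    rw [hee, expGL_inv, coe_expGL, exp_eq_expSum hN]
    have h2 := exp_eq_expSum hN' z
    rw [Pi.neg_apply] at h2
    rw [h2]
    rfl
  have hA2 := expSum_sub_one_sub_mem (p := p) (q := q) N (by omega : 0 ≤ a) huo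
  have hB2 := expSum_sub_one_sub_mem (p := p) (q := q) N (by omega : 0 ≤ a)
    (Submodule.neg_mem _ huo)
  rw [← he] at hA2
  rw [← he'] at hB2
  have hA : e - 1 ∈ orderGE n p q a := by
    rw [← sub_add_cancel (e - 1) u]
    exact Submodule.add_mem _ (orderGE_anti (by omega) hA2) huo
  have hB : e' - 1 ∈ orderGE n p q a := by
    rw [← sub_add_cancel (e' - 1) (-u)]
    exact Submodule.add_mem _ (orderGE_anti (by omega) hB2) (Submodule.neg_mem _ huo)
  have hee : e - 1 - u + u + 1 = e := by abel
  have h1h : IsHol (1 : MatFun n) := IsHol.const 1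
  have hVe : vderiv (hamField p q) e
      = vderiv (hamField p q) (e - 1 - u) + vderiv (hamField p q) u := by
    conv_lhs => rw [← hee]
    have hs : IsHol (e - 1 - u + u) := (isHol_of_mem_orderGE hA2).add hu1.1
    rw [vderiv_add' _ hs h1h,
      vderiv_add' _ (isHol_of_mem_orderGE hA2) hu1.1,
      show vderiv (hamField p q) (1 : MatFun n) = 0 from vderiv_const _ 1, add_zero]
  have hVA := vderiv_ham_mem_orderGE hp hq hA2
  have hVu := vderiv_ham_mem_orderGE hp hq huo
  have hfin : e * η * e' - vderiv (hamField p q) e * e' - (η - vderiv (hamField p q) u)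
      = (e - 1) * η + η * (e' - 1) + (e - 1) * η * (e' - 1)
        - vderiv (hamField p q) (e - 1 - u) * (e' - 1) - vderiv (hamField p q) (e - 1 - u)
        - vderiv (hamField p q) u * (e' - 1) := by
    rw [hVe]; noncomm_ring
  rw [h1, hfin]
  have hc : ∀ {x : MatFun n} {b : ℤ}, x ∈ orderGE n p q b → a + w₀ p q + 1 ≤ b →
      x ∈ orderGE n p q (a + w₀ p q + 1) := fun hx hb => orderGE_anti hb hx
  refine Submodule.sub_mem _ (Submodule.sub_mem _ (Submodule.sub_mem _ (Submodule.add_mem _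
    (Submodule.add_mem _ ?_ ?_) ?_) ?_) ?_) ?_
  · exact hc (mul_mem_orderGE hA hη) (by omega)
  · exact hc (mul_mem_orderGE hη hB) (by omega)
  · exact hc (mul_mem_orderGE (mul_mem_orderGE hA hη) hB) (by omega)
  · exact hc (mul_mem_orderGE hVA hB) (by omega)
  · exact hc hVA (by omega)
  · exact hc (mul_mem_orderGE hVu hB) (by omega)

/-- Every orbit of `Aut(S)` in `U_0^1` meets `H^1`. -/
theorem exists_smul_mem_H1 (hS : Diagonalizes P d S) (hp : 0 < p) (hq : 0 < q)
    (hcop : Nat.Coprime p q) (hSg : S ∈ G.lieAlgebra) (hlarge : G.LargeEnough S p q)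
    (η : G.U1 S p q) :
    ∃ g : G.aut S p q, ((g • η : G.U1 S p q) : MatFun n) ∈ G.H1 S p q := by
  obtain ⟨B, hB⟩ := exists_order_bound hS hp hq (w₀ p q)
  have key : ∀ N : ℕ, ∀ v : ℤ, w₀ p q + 1 ≤ v → (B : ℤ) ≤ v + N → ∀ η : G.U1 S p q,
      ∀ h ∈ G.H1 S p q, (η : MatFun n) - h ∈ orderGE n p q v →
        ∃ g : G.aut S p q, ((g • η : G.U1 S p q) : MatFun n) ∈ G.H1 S p q := by
    intro N
    induction N with
    | zero =>
      intro v _ hvB η h hh hv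
      have := hB v (by simpa using hvB) _ ((mem_weightSpace_iff G).1
        (Submodule.sub_mem _ η.2 (G.H1_le S p q hh))).1 hv
      refine ⟨1, ?_⟩
      rw [one_smul, sub_eq_zero.1 this]
      exact hh
    | succ N ih =>
      intro v hv1 hvB η h hh hv
      obtain ⟨h', hh', u, hu, huo, hr⟩ := exists_leading_term hS hp hq hSg
        (Submodule.sub_mem _ η.2 (G.H1_le S p q hh)) hv
      have huo1 := orderGE_anti (v := 1) (by omega) huo
      -- Gauging by `exp u` removes the term `V(u)` from the leading part of `η - h`, which leaves
      -- `h'` and a remainder of order at least `v + 1`.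
      let g : G.aut S p q := ⟨fun z => expGL (u z), exp_mem_aut hS hp hq hu huo1⟩
      have hg := sub_gaugeAct_exp_mem hS hp hq hu (by omega) huo
        (U1_le_orderGE hS hp hq hcop hSg hlarge η.2)
      rw [show v - w₀ p q + w₀ p q + 1 = v + 1 by ring] at hg
      obtain ⟨g', hg'⟩ := ih (v + 1) (by omega) (by push_cast at hvB; omega) (g • η) (h + h')
        (Submodule.add_mem _ hh hh') (by
          rw [ReductiveGroup.coe_smul]
          have := Submodule.add_mem _ hg hr
          convert! this using 1
          abel)
      exact ⟨g' * g, by rw [mul_smul]; exact hg'⟩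
  refine key (B - (w₀ p q + 1)).toNat (w₀ p q + 1) le_rfl (by omega) η 0 (Submodule.zero_mem _) ?_
  rw [sub_zero]
  exact U1_le_orderGE hS hp hq hcop hSg hlarge η.2

end Exponential

/-! ### The action map is a submersion. -/

section Submersion

/-- Entrywise derivatives of matrix valued functions of one variable. -/
def HasMatDerivAt (A : ℂ → Mat n) (A' : Mat n) (t : ℂ) : Prop :=
  ∀ i j, HasDerivAt (fun s => A s i j) (A' i j) t

theorem HasMatDerivAt.mul {A B : ℂ → Mat n} {A' B' : Mat n} {t : ℂ} (hA : HasMatDerivAt A A' t)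
    (hB : HasMatDerivAt B B' t) :
    HasMatDerivAt (fun s => A s * B s) (A' * B t + A t * B') t := by
  intro i j
  have h := HasDerivAt.fun_sum (u := Finset.univ) fun l _ => (hA i l).mul (hB l j)
  simp only [Matrix.mul_apply, Matrix.add_apply, ← Finset.sum_add_distrib]
  exact h

theorem HasMatDerivAt.sub {A B : ℂ → Mat n} {A' B' : Mat n} {t : ℂ} (hA : HasMatDerivAt A A' t)
    (hB : HasMatDerivAt B B' t) : HasMatDerivAt (fun s => A s - B s) (A' - B') t :=
  fun i j => (hA i j).sub (hB i j)

theorem HasMatDerivAt.const (A : Mat n) (t : ℂ) : HasMatDerivAt (fun _ => A) 0 t :=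
  fun i j => hasDerivAt_const t (A i j)

theorem hasMatDerivAt_sum (N : ℕ) (C : ℕ → Mat n) (t : ℂ) :
    HasMatDerivAt (fun s => ∑ k ∈ Finset.range N, s ^ k • C k)
      (∑ k ∈ Finset.range N, ((k : ℂ) * t ^ (k - 1)) • C k) t := by
  intro i j
  simp only [Matrix.sum_apply, Matrix.smul_apply, smul_eq_mul]
  exact HasDerivAt.fun_sum fun k _ => (hasDerivAt_pow k t).mul_const (C k i j)

theorem hasMatDerivAt_sum_zero (N : ℕ) (C : ℕ → Mat n) :
    HasMatDerivAt (fun s => ∑ k ∈ Finset.range (N + 2), s ^ k • C k) (C 1) 0 := by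
  have h := hasMatDerivAt_sum (N + 2) C 0
  convert h using 1
  rw [Finset.sum_eq_single_of_mem 1 (by simp)]
  · simp
  · intro k _ hk
    rcases k with _ | _ | k
    · simp
    · exact absurd rfl hk
    · simp

variable {P : GL (Fin n) ℂ} {d : Fin n → ℂ} {S : Mat n} {p q : ℕ} {G : ReductiveGroup n}

/-- Conjugation is the linear part of the affine gauge action, that is, the difference of `g * γ`
and `g * 0`. -/
theorem conj_mem_U1 {g : ℂ × ℂ → GL (Fin n) ℂ} (hg : g ∈ G.aut S p q) {γ : MatFun n}
    (hγ : γ ∈ G.U1 S p q) :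
    (fun z => (g z : Mat n) * γ z * (((g z)⁻¹ : GL (Fin n) ℂ) : Mat n)) ∈ G.U1 S p q := by
  have h := Submodule.sub_mem _ (G.gaugeAct_mem S p q hg hγ)
    (G.gaugeAct_mem S p q hg (Submodule.zero_mem _))
  convert! h using 1
  funext z
  simp [ReductiveGroup.gaugeAct]

theorem submersive (hS : Diagonalizes P d S) (hp : 0 < p) (hq : 0 < q)
    (hcop : Nat.Coprime p q) (hSg : S ∈ G.lieAlgebra) (hlarge : G.LargeEnough S p q)
    (g : G.aut S p q) (γ : G.H1 S p q) (v : G.U1 S p q) :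
    ∃ (c : ℂ → G.aut S p q) (η : ℂ → G.H1 S p q), c 0 = g ∧ η 0 = γ ∧
      (∀ z a b, Differentiable ℂ
        fun t => ((c t : ℂ × ℂ → GL (Fin n) ℂ) z : Mat n) a b) ∧
      (∀ z a b, Differentiable ℂ fun t => (η t : MatFun n) z a b) ∧
      ∀ z a b, HasDerivAt
        (fun t => ((c t • G.inclH1 S p q (η t) : G.U1 S p q) : MatFun n) z a b)
        ((v : MatFun n) z a b) 0 := by
  -- Conjugating by `g⁻¹` moves the tangent vector back to the point `γ`, so that only the identity
  -- of `Aut(S)` has to be considered.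
  have hv' := conj_mem_U1 (g⁻¹).2 v.2
  obtain ⟨h, hh, u₀, hu₀, hu₀o, he⟩ := exists_H1_add_twistedDiff hS hp hq hcop hSg hlarge
    (G.H1_le S p q γ.2) hv'
  -- The sign is reversed because the derivative of `exp(tu) * (γ + t h)` at `t = 0` is `h - V(u) +
  -- [u, γ]`.
  obtain ⟨u, hu, huo, rfl⟩ : ∃ u ∈ G.U0 S p q, u ∈ orderGE n p q 1 ∧ u₀ = -u :=
    ⟨-u₀, Submodule.neg_mem _ hu₀, Submodule.neg_mem _ hu₀o, (neg_neg _).symm⟩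
  obtain ⟨hu1, hu2⟩ := (mem_weightSpace_iff G).1 hu
  obtain ⟨N, hN⟩ := exists_pow_eq_zero hS hp hq hu1 huo
  let e : ℂ → G.aut S p q := fun t => ⟨fun z => expGL ((t • u) z),
    exp_mem_aut hS hp hq (Submodule.smul_mem _ t hu) (Submodule.smul_mem _ t huo)⟩
  have hNt : ∀ t : ℂ, (t • u) ^ (N + 2) = 0 := fun t => by rw [smul_pow, hN, smul_zero]
  have hexp : ∀ t : ℂ, expSum (N + 2) (t • u)
      = fun z => ∑ k ∈ Finset.range (N + 2), t ^ k • ((k.factorial : ℂ)⁻¹ • (u ^ k) z) := by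
    intro t
    funext z
    rw [expSum, Finset.sum_apply]
    refine Finset.sum_congr rfl fun k _ => ?_
    rw [smul_pow, Pi.smul_apply, Pi.smul_apply, smul_comm]
  have het : ∀ t, (fun z => (((e t : ℂ × ℂ → GL (Fin n) ℂ) z : GL (Fin n) ℂ) : Mat n))
      = fun z => ∑ k ∈ Finset.range (N + 2), t ^ k • ((k.factorial : ℂ)⁻¹ • (u ^ k) z) := by
    intro t
    rw [← hexp]
    exact funext fun z => exp_eq_expSum (hNt t) z
  have heti : ∀ t z, ((((e t : ℂ × ℂ → GL (Fin n) ℂ) z)⁻¹ : GL (Fin n) ℂ) : Mat n)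
      = ∑ k ∈ Finset.range (N + 2), t ^ k • ((-1) ^ k • (k.factorial : ℂ)⁻¹ • (u ^ k) z) := by
    intro t z
    have h1 := congrFun (het (-t)) z
    have h2 : ((((e t : ℂ × ℂ → GL (Fin n) ℂ) z)⁻¹ : GL (Fin n) ℂ) : Mat n)
        = (((e (-t) : ℂ × ℂ → GL (Fin n) ℂ) z : GL (Fin n) ℂ) : Mat n) := by
      change (((expGL ((t • u) z))⁻¹ : GL (Fin n) ℂ) : Mat n) = _
      rw [expGL_inv]
      change _ = NormedSpace.exp ((-t • u) z)
      rw [neg_smul]; rfl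
    rw [h2]
    beta_reduce at h1
    rw [h1]
    refine Finset.sum_congr rfl fun k _ => ?_
    rw [neg_pow, mul_comm, mul_smul]
    congr 1
    rcases neg_one_pow_eq_or ℂ k with h | h
    · rcases Nat.even_or_odd k with h' | h' <;> simp [h'.neg_one_pow]
    · rcases Nat.even_or_odd k with h' | h' <;> simp [h'.neg_one_pow]
  have hVe : ∀ t z, vderiv (hamField p q)
      (fun z => (((e t : ℂ × ℂ → GL (Fin n) ℂ) z : GL (Fin n) ℂ) : Mat n)) z
      = ∑ k ∈ Finset.range (N + 2),
        t ^ k • ((k.factorial : ℂ)⁻¹ • vderiv (hamField p q) (u ^ k) z) := by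
    intro t z
    have hk : ∀ k : ℕ, IsHol (t ^ k • ((k.factorial : ℂ)⁻¹ • (u ^ k))) := fun k =>
      (Submodule.smul_mem _ _ (Submodule.smul_mem _ _ (pow_mem_weightGL hu1 k)) :
        _ ∈ weightGL S p q 0).1
    rw [het]
    have := congrFun (vderiv_sum (hamField p q) (Finset.range (N + 2)) fun k _ => hk k) z
    refine this.trans (Finset.sum_congr rfl fun k _ => ?_)
    have huk := (pow_mem_weightGL hu1 k).1
    rw [vderiv_smul' _ _ ((Submodule.smul_mem _ _ (pow_mem_weightGL hu1 k) :
        _ ∈ weightGL S p q 0).1), vderiv_smul' _ _ huk]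
    rfl
  have hd_e : ∀ z t, ∃ D, HasMatDerivAt
      (fun t => (((e t : ℂ × ℂ → GL (Fin n) ℂ) z : GL (Fin n) ℂ) : Mat n)) D t := by
    intro z t
    refine ⟨∑ k ∈ Finset.range (N + 2),
        ((k : ℂ) * t ^ (k - 1)) • ((k.factorial : ℂ)⁻¹ • (u ^ k) z), ?_⟩
    · rw [show (fun t => (((e t : ℂ × ℂ → GL (Fin n) ℂ) z : GL (Fin n) ℂ) : Mat n))
        = fun t => ∑ k ∈ Finset.range (N + 2), t ^ k • ((k.factorial : ℂ)⁻¹ • (u ^ k) z) from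
        funext fun t => congrFun (het t) z]
      exact hasMatDerivAt_sum _ _ _
  have he0 : e 0 = 1 := by
    apply Subtype.ext
    funext z
    ext1
    change NormedSpace.exp (((0 : ℂ) • u) z) = 1
    rw [zero_smul, Pi.zero_apply, NormedSpace.exp_zero]
  -- The curve is `(g exp(tu), γ + t h)`. As `u` is nilpotent, it is polynomial in `t`, and so are
  -- the inverse of `exp(tu)` and its derivative along `V`.
  refine ⟨fun t => g * e t, fun t => γ + t • ⟨h, hh⟩, ?_, ?_, ?_, ?_, ?_⟩
  · beta_reduce
    rw [he0, mul_one]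
  · simp
  · intro z a b t
    obtain ⟨D, hD⟩ := hd_e z t
    exact ((HasMatDerivAt.const (((g : ℂ × ℂ → GL (Fin n) ℂ) z : GL (Fin n) ℂ) : Mat n) t).mul
      hD a b).differentiableAt
  · intro z a b
    change Differentiable ℂ fun t => (γ : MatFun n) z a b + t * h z a b
    fun_prop
  · intro z
    have hM : ∀ t, ((e t • G.inclH1 S p q (γ + t • ⟨h, hh⟩) : G.U1 S p q) : MatFun n) z
        = (∑ k ∈ Finset.range (N + 2), t ^ k • ((k.factorial : ℂ)⁻¹ • (u ^ k) z))
          * ((γ : MatFun n) z + t • h z)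
          * (∑ k ∈ Finset.range (N + 2), t ^ k • ((-1) ^ k • (k.factorial : ℂ)⁻¹ • (u ^ k) z))
          - (∑ k ∈ Finset.range (N + 2),
              t ^ k • ((k.factorial : ℂ)⁻¹ • vderiv (hamField p q) (u ^ k) z))
          * (∑ k ∈ Finset.range (N + 2), t ^ k • ((-1) ^ k • (k.factorial : ℂ)⁻¹ • (u ^ k) z)) := by
      intro t
      rw [ReductiveGroup.coe_smul, ReductiveGroup.gaugeAct, hVe, heti, congrFun (het t) z]
      rfl
    have hlin : HasMatDerivAt (fun t : ℂ => (γ : MatFun n) z + t • h z) (h z) 0 := by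
      intro a b
      have := ((hasDerivAt_id (0 : ℂ)).mul_const (h z a b)).const_add ((γ : MatFun n) z a b)
      simpa using this
    have hM' := (((hasMatDerivAt_sum_zero N fun k => (k.factorial : ℂ)⁻¹ • (u ^ k) z).mul
      hlin).mul (hasMatDerivAt_sum_zero N fun k => (-1) ^ k • (k.factorial : ℂ)⁻¹ • (u ^ k) z)).sub
      ((hasMatDerivAt_sum_zero N
        fun k => (k.factorial : ℂ)⁻¹ • vderiv (hamField p q) (u ^ k) z).mul
      (hasMatDerivAt_sum_zero N fun k => (-1) ^ k • (k.factorial : ℂ)⁻¹ • (u ^ k) z))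
    have hz0 : ∀ C : ℕ → Mat n, ∑ k ∈ Finset.range (N + 2), (0 : ℂ) ^ k • C k = C 0 := by
      intro C
      rw [Finset.sum_eq_single_of_mem 0 (by simp)]
      · simp
      · intro k _ hk; simp [hk]
    have hV1 : vderiv (hamField p q) (1 : MatFun n) = 0 := vderiv_const _ 1
    simp only [hz0] at hM'
    simp only [Nat.factorial_zero, Nat.factorial_one, Nat.cast_one, inv_one, one_smul, pow_zero,
      pow_one, zero_smul, add_zero, hV1, Pi.zero_apply, zero_mul, Pi.one_apply, mul_one,
      one_mul] at hM'
    have hfull := (((HasMatDerivAt.const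
      (((g : ℂ × ℂ → GL (Fin n) ℂ) z : GL (Fin n) ℂ) : Mat n) 0).mul hM').mul
      (HasMatDerivAt.const ((((g : ℂ × ℂ → GL (Fin n) ℂ) z)⁻¹ : GL (Fin n) ℂ) : Mat n) 0)).sub
      (HasMatDerivAt.const (vderiv (hamField p q)
        (fun w => (((g : ℂ × ℂ → GL (Fin n) ℂ) w : GL (Fin n) ℂ) : Mat n)) z
        * ((((g : ℂ × ℂ → GL (Fin n) ℂ) z)⁻¹ : GL (Fin n) ℂ) : Mat n)) 0)
    intro a b
    -- Acting by the fixed `g` is affine: conjugation plus a constant. Hence the velocity at `t = 0`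
    -- is conjugated by `g`, which gives back `v`.
    have hfun : (fun t => (((g * e t) • G.inclH1 S p q (γ + t • ⟨h, hh⟩) : G.U1 S p q) : MatFun n) z)
        = fun t => (((g : ℂ × ℂ → GL (Fin n) ℂ) z : GL (Fin n) ℂ) : Mat n)
          * ((e t • G.inclH1 S p q (γ + t • ⟨h, hh⟩) : G.U1 S p q) : MatFun n) z
          * ((((g : ℂ × ℂ → GL (Fin n) ℂ) z)⁻¹ : GL (Fin n) ℂ) : Mat n)
          - vderiv (hamField p q)
            (fun w => (((g : ℂ × ℂ → GL (Fin n) ℂ) w : GL (Fin n) ℂ) : Mat n)) z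
            * ((((g : ℂ × ℂ → GL (Fin n) ℂ) z)⁻¹ : GL (Fin n) ℂ) : Mat n) := by
      funext t
      rw [mul_smul, ReductiveGroup.coe_smul]
      rfl
    simp only [hM] at hfun
    have hval : ∀ t, (((g * e t) • G.inclH1 S p q (γ + t • ⟨h, hh⟩) : G.U1 S p q) : MatFun n) z a b
        = _ := fun t => congrArg (fun A : Mat n => A a b) (congrFun hfun t)
    have hgoal := hfull a b
    simp only [hval]
    convert! hgoal using 1
    have hez := congrFun he z
    have hv1 : (v : MatFun n) z = (((g : ℂ × ℂ → GL (Fin n) ℂ) z : GL (Fin n) ℂ) : Mat n)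
        * ((((g⁻¹ : G.aut S p q) : ℂ × ℂ → GL (Fin n) ℂ) z : Mat n) * (v : MatFun n) z
          * (((((g⁻¹ : G.aut S p q) : ℂ × ℂ → GL (Fin n) ℂ) z)⁻¹ : GL (Fin n) ℂ) : Mat n))
        * ((((g : ℂ × ℂ → GL (Fin n) ℂ) z)⁻¹ : GL (Fin n) ℂ) : Mat n) := by
      change _ = _ * (((((g : ℂ × ℂ → GL (Fin n) ℂ) z)⁻¹ : GL (Fin n) ℂ) : Mat n) * (v : MatFun n) z
          * (((((g : ℂ × ℂ → GL (Fin n) ℂ) z)⁻¹)⁻¹ : GL (Fin n) ℂ) : Mat n)) * _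
      rw [inv_inv, mul_assoc, mul_assoc, mul_assoc, Units.mul_inv, mul_one, ← mul_assoc,
        Units.mul_inv, one_mul]
    rw [hv1]
    beta_reduce at hez
    rw [hez]
    have hVn : vderiv (hamField p q) (-u) = -vderiv (hamField p q) u := by
      have := vderiv_smul' (hamField p q) (-1) hu1.1
      rwa [neg_one_smul, neg_one_smul] at this
    rw [hVn]
    simp only [Pi.add_apply, Pi.sub_apply, Pi.neg_apply, Pi.mul_apply, mul_neg, neg_mul, zero_mul,
      mul_zero, add_zero, zero_add, sub_zero, neg_smul, one_smul]
    refine congrFun (congrFun ?_ a) b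
    noncomm_ring

end Submersion

/-! ### Functions of a diagonalizable matrix. -/

section Diagonal

variable {P : GL (Fin n) ℂ} {d : Fin n → ℂ} {S A X : Mat n} {μ τ : ℂ}

theorem aeval_of_diagonalizes (hA : Diagonalizes P d A) (f : Polynomial ℂ) :
    Diagonalizes P (fun i => f.eval (d i)) (Polynomial.aeval A f) := by
  unfold Diagonalizes
  induction f using Polynomial.induction_on' with
  | add f g hf hg =>
    rw [map_add, hf, hg, ← add_mul, ← mul_add, Matrix.diagonal_add]
    simp
  | monomial k a =>
    rw [Polynomial.aeval_monomial]
    have hk : A ^ k = (P : Mat n) * Matrix.diagonal (fun i => d i ^ k)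
        * ((P⁻¹ : GL (Fin n) ℂ) : Mat n) := by
      induction k with
      | zero => simp
      | succ k ih =>
        apply unconj_injective (P := P)
        have h1 : unconj P A = Matrix.diagonal d := by rw [hA, unconj_conj]
        rw [pow_succ, unconj_mul, ih, unconj_conj, unconj_conj, h1, Matrix.diagonal_mul_diagonal]
        simp only [pow_succ]
    rw [hk, Matrix.algebraMap_eq_diagonal]
    apply unconj_injective (P := P)
    rw [unconj_mul, unconj_conj, unconj_conj]
    have h2 : unconj P (Matrix.diagonal (algebraMap ℂ (Fin n → ℂ) a)) = Matrix.diagonal fun _ => a := by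
      have : (Matrix.diagonal (algebraMap ℂ (Fin n → ℂ) a) : Mat n) = a • 1 := by
        ext i j; simp [Matrix.diagonal_apply, Matrix.one_apply]
      rw [this, unconj_smul]
      have h3 : unconj P (1 : Mat n) = 1 := by simp [unconj]
      rw [h3]
      ext i j; simp [Matrix.diagonal_apply, Matrix.one_apply]
    rw [h2, Matrix.diagonal_mul_diagonal]
    simp [Polynomial.eval_monomial]

/-- This makes the diagonal entries nodes of the interpolation that defines `rePart`. -/
theorem mem_roots_charpoly (hS : Diagonalizes P d S) (i : Fin n) :
    d i ∈ S.charpoly.roots.toFinset := by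
  rw [Multiset.mem_toFinset, Polynomial.mem_roots (Matrix.charpoly_monic S).ne_zero,
    Polynomial.IsRoot, Matrix.eval_charpoly]
  have h : Matrix.scalar (Fin n) (d i) - S
      = (P : Mat n) * Matrix.diagonal (fun j => d i - d j) * ((P⁻¹ : GL (Fin n) ℂ) : Mat n) := by
    apply unconj_injective (P := P)
    rw [unconj_sub, unconj_conj, hS, unconj_conj]
    have h3 : unconj P (Matrix.scalar (Fin n) (d i)) = Matrix.diagonal fun _ => d i := by
      have : (Matrix.scalar (Fin n) (d i) : Mat n) = d i • 1 := by
        ext a b; simp [Matrix.diagonal_apply, Matrix.one_apply]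
      rw [this, unconj_smul]
      have h3 : unconj P (1 : Mat n) = 1 := by simp [unconj]
      rw [h3]
      ext i j; simp [Matrix.diagonal_apply, Matrix.one_apply]
    rw [h3, Matrix.diagonal_sub]
  rw [h, Matrix.det_mul, Matrix.det_mul, Matrix.det_diagonal,
    Finset.prod_eq_zero (Finset.mem_univ i) (sub_self _)]
  simp

theorem rePart_diagonalizes (hS : Diagonalizes P d S) :
    Diagonalizes P (fun i => (((d i).re : ℝ) : ℂ)) (ReductiveGroup.rePart S) := by
  have h := aeval_of_diagonalizes hS (Lagrange.interpolate S.charpoly.roots.toFinset id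
    fun l => ((l.re : ℝ) : ℂ))
  have h2 : ∀ i, (Lagrange.interpolate S.charpoly.roots.toFinset id
      fun l => ((l.re : ℝ) : ℂ)).eval (d i) = (((d i).re : ℝ) : ℂ) := fun i =>
    Lagrange.eval_interpolate_at_node (v := id) (r := fun l : ℂ => ((l.re : ℝ) : ℂ))
      Function.injective_id.injOn (mem_roots_charpoly hS i)
  simp only [h2] at h
  exact h

theorem exp_diagonalizes (hA : Diagonalizes P d A) (τ : ℂ) :
    unconj P (NormedSpace.exp (τ • A)) = Matrix.diagonal fun i => Complex.exp (τ * d i) := by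
  have h : τ • A = (P : Mat n) * Matrix.diagonal (fun i => τ * d i)
      * ((P⁻¹ : GL (Fin n) ℂ) : Mat n) := by
    apply unconj_injective (P := P)
    rw [unconj_smul, hA, unconj_conj, unconj_conj]
    ext i j; simp [Matrix.diagonal_apply]
  rw [h, Matrix.exp_units_conj, unconj_conj, Matrix.exp_diagonal]
  congr 1
  funext i
  rw [Pi.coe_exp, Complex.exp_eq_exp_ℂ]

theorem unconj_conj_exp (hA : Diagonalizes P d A) (τ : ℂ) (X : Mat n) (i j : Fin n) :
    unconj P ((expGL (τ • A) : Mat n) * X * (((expGL (τ • A))⁻¹ : GL (Fin n) ℂ) : Mat n)) i j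
      = Complex.exp (τ * (d i - d j)) * unconj P X i j := by
  rw [unconj_mul, unconj_mul, expGL_inv, ← neg_smul, coe_expGL, exp_diagonalizes hA,
    exp_diagonalizes hA, Matrix.mul_diagonal, Matrix.diagonal_mul, mul_sub, Complex.exp_sub,
    neg_mul, Complex.exp_neg]
  ring

theorem conj_exp_eigen (hA : Diagonalizes P d A) (hX : ⁅A, X⁆ = μ • X) (τ : ℂ) :
    (expGL (τ • A) : Mat n) * X * (((expGL (τ • A))⁻¹ : GL (Fin n) ℂ) : Mat n)
      = Complex.exp (τ * μ) • X := by
  apply unconj_injective (P := P)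
  ext i j
  rw [unconj_conj_exp hA, unconj_smul, Matrix.smul_apply, smul_eq_mul]
  by_cases h : unconj P X i j = 0
  · rw [h, mul_zero, mul_zero]
  · rw [(lie_eq_smul_iff hA).1 hX i j h]

theorem conj_exp_sum {ι : Type*} (hA : Diagonalizes P d A) {s : Finset ι} {R : ι → Mat n}
    {μ : ι → ℂ} (hR : ∀ c, ⁅A, R c⁆ = μ c • R c) (τ : ℂ) :
    (expGL (τ • A) : Mat n) * (∑ c ∈ s, R c) * (((expGL (τ • A))⁻¹ : GL (Fin n) ℂ) : Mat n)
      = ∑ c ∈ s, Complex.exp (τ * μ c) • R c := by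
  rw [Finset.mul_sum, Finset.sum_mul]
  exact Finset.sum_congr rfl fun c _ => conj_exp_eigen hA (hR c) τ

/-- For a real eigenvalue, `ad_S` and the adjoint action of the real part of `S` agree, since `d i -
d j` equals the difference of the real parts. -/
theorem rePart_eigen (hS : Diagonalizes P d S) {r : ℝ} (hX : ⁅S, X⁆ = (r : ℂ) • X) :
    ⁅ReductiveGroup.rePart S, X⁆ = (r : ℂ) • X := by
  rw [lie_eq_smul_iff (rePart_diagonalizes hS)]
  intro i j h
  have := congrArg Complex.re ((lie_eq_smul_iff hS).1 hX i j h)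
  rw [Complex.sub_re, Complex.ofReal_re] at this
  rw [← Complex.ofReal_sub, this]

/-- The units of a complete normed ring carry the topology of an open subset, so matrix convergence
suffices once the limit is known to be invertible. -/
theorem tendsto_GL {ι : Type*} {l : Filter ι} {F : ι → GL (Fin n) ℂ} {g : GL (Fin n) ℂ}
    (h : Tendsto (fun r => (F r : Mat n)) l (𝓝 (g : Mat n))) : Tendsto F l (𝓝 g) := by
  let _ : NormedRing (Mat n) := Matrix.linftyOpNormedRing
  let _ : NormedAlgebra ℂ (Mat n) := Matrix.linftyOpNormedAlgebra
  have : CompleteSpace (Mat n) := FiniteDimensional.complete ℂ (Mat n)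
  exact (Units.isOpenEmbedding_val (R := Mat n)).isEmbedding.tendsto_nhds_iff.2 h

end Diagonal

/-! ### The group `P_S` as the polynomials in `f` inside `Aut(S)`. -/

section Parabolic

variable {P : GL (Fin n) ℂ} {d : Fin n → ℂ} {S : Mat n} {p q : ℕ} {G : ReductiveGroup n}

/-- The matrix polynomial `∑ t ^ c R c`. -/
def matPoly (s : Finset ℕ) (R : ℕ → Mat n) (t : ℂ) : Mat n := ∑ c ∈ s, t ^ c • R c

theorem continuous_matPoly (s : Finset ℕ) (R : ℕ → Mat n) : Continuous (matPoly s R) :=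
  continuous_finsetSum _ fun c _ => (continuous_pow c).smul continuous_const

theorem matPoly_one (s : Finset ℕ) (R : ℕ → Mat n) : matPoly s R 1 = ∑ c ∈ s, R c := by
  simp [matPoly]

theorem pq_ne_zero (hp : 0 < p) (hq : 0 < q) : (q : ℂ) * p ≠ 0 := by
  have : 0 < q * p := by positivity
  exact_mod_cast this.ne'

/-- With `t = exp τ` this is `t^{-S/(pq)} h t^{S/(pq)}`: on the eigenspace for `-cpq` the
conjugation is multiplication by `t^c`. -/
theorem exp_conj_matPoly (hS : Diagonalizes P d S) (hp : 0 < p) (hq : 0 < q) {s : Finset ℕ}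
    {R : ℕ → Mat n} (hR : ∀ c, ⁅S, R c⁆ = (-((c : ℂ) * (p * q))) • R c) (τ : ℂ) :
    (expGL ((-τ / (q * p)) • S) : Mat n) * (∑ c ∈ s, R c)
      * (((expGL ((-τ / (q * p)) • S))⁻¹ : GL (Fin n) ℂ) : Mat n) = matPoly s R (Complex.exp τ) := by
  rw [conj_exp_sum hS hR]
  refine Finset.sum_congr rfl fun c _ => ?_
  rw [← Complex.exp_nat_mul]
  congr 2
  have hpq := pq_ne_zero hp hq
  have hq0 : (q : ℂ) ≠ 0 := left_ne_zero_of_mul hpq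
  have hp0 : (p : ℂ) ≠ 0 := right_ne_zero_of_mul hpq
  field_simp

theorem rayConj_eq (hS : Diagonalizes P d S) (hp : 0 < p) (hq : 0 < q) {s : Finset ℕ}
    {R : ℕ → Mat n} (hR : ∀ c, ⁅S, R c⁆ = (-((c : ℂ) * (p * q))) • R c) {h : GL (Fin n) ℂ}
    (hh : (h : Mat n) = ∑ c ∈ s, R c) (θ r : ℝ) :
    (ReductiveGroup.rayConj ((-1 / (q * p) : ℂ) • ReductiveGroup.rePart S) h θ r : Mat n)
      = matPoly s R (Complex.exp ((Real.log r : ℂ) + θ * Complex.I)) := by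
  have hR' : ∀ c, ⁅ReductiveGroup.rePart S, R c⁆ = (-((c : ℂ) * (p * q))) • R c := by
    intro c
    have h1 := rePart_eigen hS (r := -((c : ℝ) * (p * q))) (X := R c) (by
      rw [hR c]; push_cast; rfl)
    rw [h1]; push_cast; rfl
  rw [← exp_conj_matPoly (rePart_diagonalizes hS) hp hq hR', ReductiveGroup.rayConj, Units.val_mul,
    Units.val_mul, hh, smul_smul, mul_div_assoc', mul_neg, mul_one]

/-- Conjugation by `exp(-2πiS/(pq))` scales the entry by `exp(-2πi(d i - d j)/(pq))`, which must be
`1`. Along the ray the entry scales by `r^m` with `d i - d j = -m pq`, so it blows up as `r → 0` if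
`m < 0`. -/
theorem entry_of_mem_pS (hS : Diagonalizes P d S) (hp : 0 < p) (hq : 0 < q) {h : GL (Fin n) ℂ}
    (hh : h ∈ G.pS S p q) (i j : Fin n) (hij : unconj P (h : Mat n) i j ≠ 0) :
    ∃ c : ℕ, d i - d j = -((c : ℂ) * (p * q)) := by
  have hpq := pq_ne_zero hp hq
  have hq0 : (q : ℂ) ≠ 0 := left_ne_zero_of_mul hpq
  have hp0 : (p : ℂ) ≠ 0 := right_ne_zero_of_mul hpq
  obtain ⟨hc, -, hlim⟩ := hh
  -- the difference is an integer multiple of `pq`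
  obtain ⟨m, hm⟩ : ∃ m : ℤ, d i - d j = -((m : ℂ) * (p * q)) := by
    have h1 := Subgroup.mem_centralizer_iff.1 hc _ rfl
    have h2 := unconj_conj_exp hS (-2 * Real.pi * Complex.I / (q * p) : ℂ) (h : Mat n) i j
    rw [← Units.val_mul, ← Units.val_mul, h1, mul_inv_cancel_right] at h2
    have h3 : Complex.exp ((-2 * Real.pi * Complex.I / (q * p) : ℂ) * (d i - d j)) = 1 :=
      mul_right_cancel₀ hij (h2.symm.trans (one_mul _).symm)
    obtain ⟨m, hm⟩ := Complex.exp_eq_one_iff.1 h3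
    refine ⟨m, ?_⟩
    have hpi : (2 * Real.pi * Complex.I : ℂ) ≠ 0 := Complex.two_pi_I_ne_zero
    have h4 : (2 * Real.pi * Complex.I : ℂ) * (d i - d j)
        = (2 * Real.pi * Complex.I : ℂ) * (-((m : ℂ) * (p * q))) := by
      have h5 : (-2 * Real.pi * Complex.I / (q * p) : ℂ) * (d i - d j) * (q * p)
          = -(2 * Real.pi * Complex.I * (d i - d j)) := by
        field_simp
      rw [hm] at h5
      linear_combination h5
    exact mul_left_cancel₀ hpi h4
  -- and it is nonpositive since the limit exists
  have hm0 : 0 ≤ m := by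
    by_contra hneg
    obtain ⟨k, hk⟩ : ∃ k : ℕ, m = -((k : ℤ) + 1) := ⟨(-m - 1).toNat, by omega⟩
    obtain ⟨h0, -, ht⟩ := hlim 0
    have hre : (d i).re - (d j).re = -((m : ℝ) * (p * q)) := by
      have := congrArg Complex.re hm
      rw [Complex.sub_re] at this
      rw [this]
      have h6 : (-((m : ℂ) * (p * q))) = ((-((m : ℝ) * (p * q)) : ℝ) : ℂ) := by push_cast; rfl
      rw [h6, Complex.ofReal_re]
    have hent : ∀ r : ℝ, 0 < r → unconj P (ReductiveGroup.rayConj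
        ((-1 / (q * p) : ℂ) • ReductiveGroup.rePart S) h 0 r : Mat n) i j
        = ((r ^ (k + 1) : ℝ) : ℂ)⁻¹ * unconj P (h : Mat n) i j := by
      intro r hr
      rw [ReductiveGroup.rayConj, Units.val_mul, Units.val_mul, smul_smul,
        unconj_conj_exp (rePart_diagonalizes hS), ← Complex.ofReal_sub, hre]
      congr 1
      have h7 : ((Real.log r : ℂ) + (0 : ℝ) * Complex.I) * (-1 / (q * p))
          * ((-((m : ℝ) * (p * q)) : ℝ) : ℂ) = -(((k + 1 : ℕ) : ℂ) * Real.log r) := by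
        rw [hk]; push_cast; field_simp; ring
      rw [h7, Complex.exp_neg, Complex.exp_nat_mul, ← Complex.ofReal_exp, Real.exp_log hr]
      push_cast; rfl
    have hcont : Continuous fun A : GL (Fin n) ℂ => unconj P (A : Mat n) i j := by
      unfold unconj
      exact ((continuous_const.matrix_mul Units.continuous_val).matrix_mul
        continuous_const).matrix_elem i j
    have ht2 := (hcont.tendsto h0).comp ht
    have hpow : Tendsto (fun r : ℝ => ((r ^ (k + 1) : ℝ) : ℂ)) (𝓝[>] 0) (𝓝 0) := by
      have : Continuous fun r : ℝ => ((r ^ (k + 1) : ℝ) : ℂ) := by fun_prop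
      have h8 := (this.tendsto 0).mono_left (nhdsWithin_le_nhds (s := Set.Ioi 0))
      simpa using h8
    have hprod := hpow.mul ht2
    rw [zero_mul] at hprod
    refine hij (tendsto_nhds_unique (tendsto_const_nhds.congr' ?_) hprod)
    filter_upwards [self_mem_nhdsWithin] with r hr
    have hr' : (0 : ℝ) < r := hr
    have hr0 : ((r ^ (k + 1) : ℝ) : ℂ) ≠ 0 := by
      exact_mod_cast (pow_pos hr' (k + 1)).ne'
    rw [Function.comp_apply, hent r hr, mul_inv_cancel_left₀ hr0]
  obtain ⟨c, rfl⟩ := Int.eq_ofNat_of_zero_le hm0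
  exact ⟨c, by simpa using hm⟩

theorem exists_decomposition_of_mem_pS (hS : Diagonalizes P d S) (hp : 0 < p) (hq : 0 < q)
    {h : GL (Fin n) ℂ} (hh : h ∈ G.pS S p q) : ∃ (s : Finset ℕ) (R : ℕ → Mat n),
      (∀ c, ⁅S, R c⁆ = (-((c : ℂ) * (p * q))) • R c) ∧ (h : Mat n) = ∑ c ∈ s, R c := by
  obtain ⟨B, hB⟩ := exists_weight_bound d 0
  refine ⟨Finset.range B, fun c => adProj P d (-((c : ℂ) * (p * q))) h,
    fun c => lie_adProj hS _ _, ?_⟩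
  have h1 : ∑ c ∈ Finset.range B, diagProj d (-((c : ℂ) * (p * q))) (unconj P (h : Mat n))
      = unconj P (h : Mat n) := by
    ext i j
    rw [Matrix.sum_apply]
    by_cases hij : unconj P (h : Mat n) i j = 0
    · rw [hij]
      refine Finset.sum_eq_zero fun c _ => ?_
      rw [diagProj_apply, hij, ite_self]
    · obtain ⟨c, hc⟩ := entry_of_mem_pS hS hp hq hh i j hij
      have hcB : c < B := by
        by_contra hge
        refine hB (c * (p * q)) ?_ ?_
        · have h2 : 0 < p * q := by positivity
          have h3 : B ≤ c * (p * q) := (not_lt.1 hge).trans (Nat.le_mul_of_pos_right c h2)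
          exact_mod_cast h3
        · refine Finset.mem_image.2 ⟨(i, j), Finset.mem_univ _, ?_⟩
          rw [hc]; push_cast; ring
      rw [Finset.sum_eq_single_of_mem c (Finset.mem_range.2 hcB), diagProj_apply, if_pos hc]
      intro c' _ hne
      rw [diagProj_apply, if_neg]
      intro hc'
      have h4 : (c : ℂ) = c' := by
        have h5 := hc.symm.trans hc'
        refine mul_right_cancel₀ (b := (p : ℂ) * q) ?_ (neg_injective h5)
        rw [mul_comm]; exact pq_ne_zero hp hq
      exact hne (by exact_mod_cast h4.symm)
  calc (h : Mat n) = (P : Mat n) * unconj P (h : Mat n) * ((P⁻¹ : GL (Fin n) ℂ) : Mat n) :=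
        (conj_unconj _).symm
    _ = ∑ c ∈ Finset.range B, (P : Mat n) * diagProj d (-((c : ℂ) * (p * q)))
          (unconj P (h : Mat n)) * ((P⁻¹ : GL (Fin n) ℂ) : Mat n) := by
        rw [← Finset.sum_mul, ← Finset.mul_sum, h1]

theorem aut_mem_weightGL {g : ℂ × ℂ → GL (Fin n) ℂ} (hg : g ∈ G.aut S p q) :
    (fun z => (g z : Mat n)) ∈ weightGL S p q 0 := by
  refine ⟨hg.1.1, fun z => ?_⟩
  rw [(ReductiveGroup.preserves_iff S p q g z).1 (hg.2 z), Ring.lie_def]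
  simp

theorem mem_aut_of_weightGL {g : ℂ × ℂ → GL (Fin n) ℂ} (hG : ∀ z, g z ∈ G.toSubgroup)
    (hw : (fun z => (g z : Mat n)) ∈ weightGL S p q 0) : g ∈ G.aut S p q := by
  refine ⟨⟨hw.1, hG⟩, fun z => (ReductiveGroup.preserves_iff S p q g z).2 ?_⟩
  have h1 := eq_sub_of_add_eq (hw.2 z)
  rw [Int.cast_zero, zero_smul, zero_sub, Ring.lie_def, neg_sub] at h1
  exact h1

theorem matPoly_curveFn_mem_H0of (s : Finset ℕ) {R : ℕ → Mat n}
    (hR : ∀ c, ⁅S, R c⁆ = (-((c : ℂ) * (p * q))) • R c) :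
    (fun z => matPoly s R (curveFn p q z)) ∈ H0of S p q ⊤ := by
  have h : (fun z => matPoly s R (curveFn p q z)) = ∑ c ∈ s, fun z => curveFn p q z ^ c • R c := by
    funext z; rw [Finset.sum_apply]; rfl
  rw [h]
  exact Submodule.sum_mem _ fun c _ => Submodule.subset_span ⟨c, R c, trivial, hR c, rfl⟩

/-- Every element of `P_S` is the value at a point of the Milnor fibre `f = 1` of an element of
`Aut(S)` which is a polynomial in `f`. -/
theorem exists_aut_of_mem_pS (hS : Diagonalizes P d S) (hp : 0 < p) (hq : 0 < q)
    (hSg : S ∈ G.lieAlgebra) {h : GL (Fin n) ℂ} (hh : h ∈ G.pS S p q) :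
    ∃ g : G.aut S p q, (fun z => ((g : ℂ × ℂ → GL (Fin n) ℂ) z : Mat n)) ∈ H0of S p q ⊤ ∧
      (g : ℂ × ℂ → GL (Fin n) ℂ) (1, 0) = h := by
  obtain ⟨s, R, hR, hsum⟩ := exists_decomposition_of_mem_pS hS hp hq hh
  have hval : ∀ t : ℂ, ∃ g ∈ G.toSubgroup, (g : Mat n) = matPoly s R t := by
    intro t
    -- For `t ≠ 0` the value is a conjugate of `h` by the element `t^{-S/(pq)}` of `G`. At `t = 0`
    -- it is the limit along the ray `θ = 0`, which lies in `G` by the definition of the parabolic;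
    -- in particular it is invertible.
    by_cases ht : t = 0
    · subst ht
      obtain ⟨h0, hh0, hlim⟩ := hh.2.2 0
      refine ⟨h0, hh0, ?_⟩
      have h1 := (Units.continuous_val.tendsto h0).comp hlim
      have h2 : Tendsto (fun r : ℝ => matPoly s R (r : ℂ)) (𝓝[>] 0) (𝓝 (matPoly s R 0)) := by
        have hc : Continuous fun r : ℝ => matPoly s R (r : ℂ) :=
          (continuous_matPoly s R).comp Complex.continuous_ofReal
        have := (hc.tendsto 0).mono_left (nhdsWithin_le_nhds (s := Set.Ioi 0))
        simpa using this
      refine tendsto_nhds_unique h1 (h2.congr' ?_)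
      filter_upwards [self_mem_nhdsWithin] with r hr
      rw [Function.comp_apply, rayConj_eq hS hp hq hR hsum]
      congr 1
      rw [Complex.ofReal_zero, zero_mul, add_zero, ← Complex.ofReal_exp, Real.exp_log hr]
    · refine ⟨expGL ((-Complex.log t / (q * p)) • S) * h
        * (expGL ((-Complex.log t / (q * p)) • S))⁻¹, ?_, ?_⟩
      · have := hSg (-Complex.log t / (q * p))
        exact G.toSubgroup.mul_mem (G.toSubgroup.mul_mem this hh.2.1) (G.toSubgroup.inv_mem this)
      · rw [Units.val_mul, Units.val_mul, hsum, exp_conj_matPoly hS hp hq hR, Complex.exp_log ht]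
  choose φ hφG hφ using hval
  have hmem := matPoly_curveFn_mem_H0of (p := p) (q := q) s hR
  have heq : (fun z => (φ (curveFn p q z) : Mat n)) = fun z => matPoly s R (curveFn p q z) :=
    funext fun z => hφ _
  rw [← heq] at hmem
  refine ⟨⟨fun z => φ (curveFn p q z), mem_aut_of_weightGL (fun z => hφG _)
    (H0of_le_weightGL hmem)⟩, hmem, ?_⟩
  ext1
  change (φ (curveFn p q (1, 0)) : Mat n) = h
  rw [hφ, curveFn_one_zero hq, matPoly_one, hsum]

theorem aut_ext (hS : Diagonalizes P d S) (hp : 0 < p) (hq : 0 < q) {g g' : G.aut S p q}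
    (hg : (fun z => ((g : ℂ × ℂ → GL (Fin n) ℂ) z : Mat n)) ∈ H0of S p q ⊤)
    (hg' : (fun z => ((g' : ℂ × ℂ → GL (Fin n) ℂ) z : Mat n)) ∈ H0of S p q ⊤)
    (h : (g : ℂ × ℂ → GL (Fin n) ℂ) (1, 0) = (g' : ℂ × ℂ → GL (Fin n) ℂ) (1, 0)) : g = g' := by
  have := eq_of_mem_H0of hS hp hq hg hg' (congrArg Units.val h)
  apply Subtype.ext
  funext z
  ext1
  exact congrFun this z

/-- Running once around `f = 0`, that is `τ = 2πi`, returns the polynomial to its value at `1`,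
which gives the centralizer condition. The limit along every ray is the value at the origin, where
`f = 0`. -/
theorem value_mem_pS (hS : Diagonalizes P d S) (hp : 0 < p) (hq : 0 < q) {g : G.aut S p q}
    (hg : (fun z => ((g : ℂ × ℂ → GL (Fin n) ℂ) z : Mat n)) ∈ H0of S p q ⊤) :
    (g : ℂ × ℂ → GL (Fin n) ℂ) (1, 0) ∈ G.pS S p q := by
  obtain ⟨s, R, hR', heq⟩ := exists_of_mem_H0of hg
  have hR := fun c => (hR' c).2
  have hval : ∀ z, ((g : ℂ × ℂ → GL (Fin n) ℂ) z : Mat n) = matPoly s R (curveFn p q z) :=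
    fun z => congrFun heq z
  have hsum : ((g : ℂ × ℂ → GL (Fin n) ℂ) (1, 0) : Mat n) = ∑ c ∈ s, R c := by
    rw [hval, curveFn_one_zero hq, matPoly_one]
  refine ⟨?_, g.2.1.2 _, fun θ => ⟨(g : ℂ × ℂ → GL (Fin n) ℂ) (0, 0), g.2.1.2 _, ?_⟩⟩
  · refine Subgroup.mem_centralizer_iff.2 ?_
    rintro _ rfl
    have h1 := exp_conj_matPoly hS hp hq hR (s := s) (2 * Real.pi * Complex.I)
    rw [Complex.exp_two_pi_mul_I, matPoly_one, ← hsum, ← Units.val_mul, ← Units.val_mul] at h1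
    have h2 := Units.ext h1
    rw [mul_inv_eq_iff_eq_mul] at h2
    convert h2 using 4 <;> ring
  · refine tendsto_GL ?_
    have h00 : curveFn p q (0, 0) = 0 := by simp [curveFn, hp.ne', hq.ne']
    rw [hval, h00]
    simp only [rayConj_eq hS hp hq hR hsum]
    refine ((continuous_matPoly s R).tendsto 0).comp ?_
    have h3 : Tendsto (fun r : ℝ => (r : ℂ) * Complex.exp (θ * Complex.I)) (𝓝[>] 0) (𝓝 0) := by
      have hc : Continuous fun r : ℝ => (r : ℂ) * Complex.exp (θ * Complex.I) := by fun_prop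
      have := (hc.tendsto 0).mono_left (nhdsWithin_le_nhds (s := Set.Ioi 0))
      simpa using this
    refine h3.congr' ?_
    filter_upwards [self_mem_nhdsWithin] with r hr
    rw [Complex.exp_add, ← Complex.ofReal_exp, Real.exp_log hr]

theorem exists_line (hp : 0 < p) (hq : 0 < q) {g : G.aut S p q}
    (hg : (fun z => ((g : ℂ × ℂ → GL (Fin n) ℂ) z : Mat n)) ∈ H0of S p q ⊤) :
    ∃ φ : ℂ → GL (Fin n) ℂ, G.IsAutOnLine S p q φ ∧ φ 1 = (g : ℂ × ℂ → GL (Fin n) ℂ) (1, 0) ∧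
      ∀ z, (g : ℂ × ℂ → GL (Fin n) ℂ) z = φ (curveFn p q z) := by
  obtain ⟨s, R, hR', heq⟩ := exists_of_mem_H0of hg
  have hR := fun c => (hR' c).2
  have hval : ∀ z, ((g : ℂ × ℂ → GL (Fin n) ℂ) z : Mat n) = matPoly s R (curveFn p q z) :=
    fun z => congrFun heq z
  -- A pointwise choice of preimages under `f` is enough: the values of `g` depend only on `f`,
  -- through a polynomial, so the choice does not affect holomorphy.
  have hroot : ∀ t : ℂ, ∃ z : ℂ × ℂ, curveFn p q z = t := by
    intro t
    obtain ⟨x, hx⟩ := IsAlgClosed.exists_pow_nat_eq t hp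
    exact ⟨(x, 0), by simp [curveFn, hx, hq.ne']⟩
  choose ζ hζ using hroot
  have hφ : ∀ t, ((g : ℂ × ℂ → GL (Fin n) ℂ) (ζ t) : Mat n) = matPoly s R t := fun t => by
    rw [hval, hζ]
  have hder : ∀ t i j, HasDerivAt (fun t => matPoly s R t i j)
      ((∑ c ∈ s, ((c : ℂ) * t ^ (c - 1)) • R c) i j) t := by
    intro t i j
    simp only [matPoly, Matrix.sum_apply, Matrix.smul_apply, smul_eq_mul]
    exact HasDerivAt.fun_sum fun k _ => (hasDerivAt_pow k t).mul_const (R k i j)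
  refine ⟨fun t => (g : ℂ × ℂ → GL (Fin n) ℂ) (ζ t), ⟨fun i j => ?_, fun t => g.2.1.2 _,
    fun t => ?_⟩, ?_, fun z => ?_⟩
  · simp only [hφ]
    exact fun t => (hder t i j).differentiableAt
  · have h1 : (t • Matrix.of fun i j => deriv (fun s => ((g : ℂ × ℂ → GL (Fin n) ℂ) (ζ s) : Mat n)
        i j) t) = ((g : ℂ × ℂ → GL (Fin n) ℂ) (ζ t) : Mat n) * ((1 / (q * p) : ℂ) • S)
          - ((1 / (q * p) : ℂ) • S) * ((g : ℂ × ℂ → GL (Fin n) ℂ) (ζ t) : Mat n) := by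
      have h2 : (Matrix.of fun i j => deriv (fun s => ((g : ℂ × ℂ → GL (Fin n) ℂ) (ζ s) : Mat n)
          i j) t) = ∑ c ∈ s, ((c : ℂ) * t ^ (c - 1)) • R c := by
        ext i j
        simp only [hφ, Matrix.of_apply]
        exact (hder t i j).deriv
      rw [h2, hφ, matPoly, Finset.sum_mul, Finset.mul_sum, ← Finset.sum_sub_distrib,
        Finset.smul_sum]
      refine Finset.sum_congr rfl fun c _ => ?_
      have h3 : (t ^ c • R c) * ((1 / (q * p) : ℂ) • S) - ((1 / (q * p) : ℂ) • S) * (t ^ c • R c)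
          = -((1 / (q * p) : ℂ) • t ^ c • ⁅S, R c⁆) := by
        simp only [Ring.lie_def, smul_mul_assoc, mul_smul_comm, smul_sub, neg_sub,
          smul_comm (t ^ c)]
      rw [h3, hR, smul_smul, smul_smul, smul_smul, ← neg_smul]
      congr 1
      have := natCast_mul_pow_pred c t
      have hpq := pq_ne_zero hp hq
      have hq0 : (q : ℂ) ≠ 0 := left_ne_zero_of_mul hpq
      have hp0 : (p : ℂ) ≠ 0 := right_ne_zero_of_mul hpq
      have h4 : -(1 / ((q : ℂ) * p) * t ^ c * -(c * (p * q))) = c * t ^ c := by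
        field_simp
      rw [h4, ← this]; ring
    beta_reduce
    rw [h1, ← sub_mul, sub_sub_cancel, mul_assoc, Units.mul_inv, mul_one]
  · ext1
    beta_reduce
    rw [hφ, hval, curveFn_one_zero hq]
  · ext1
    beta_reduce
    rw [hφ, hval]

/-- Polynomials in `f` are killed by `V`, so `g` acts by conjugation. The products lie in `H^1` over
all matrices, and their values lie in `𝔤`. -/
theorem gaugeAct_mem_H1 (hS : Diagonalizes P d S) (hp : 0 < p) (hq : 0 < q)
    (hcop : Nat.Coprime p q) (hSg : S ∈ G.lieAlgebra) {g : G.aut S p q}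
    (hg : (fun z => ((g : ℂ × ℂ → GL (Fin n) ℂ) z : Mat n)) ∈ H0of S p q ⊤)
    (hg' : (fun z => (((g⁻¹ : G.aut S p q) : ℂ × ℂ → GL (Fin n) ℂ) z : Mat n)) ∈ H0of S p q ⊤)
    (γ : G.H1 S p q) : ((g • G.inclH1 S p q γ : G.U1 S p q) : MatFun n) ∈ G.H1 S p q := by
  refine mem_H1of_of_forall_mem hS hp hq hcop (lie_stable hSg) ?_
    ((mem_weightSpace_iff G).1 (g • G.inclH1 S p q γ).2).2
  have h := H1of_mul_H0of (H0of_mul_H1of hg (H1of_mono le_top γ.2)) hg'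
  convert! h using 1
  rw [ReductiveGroup.coe_smul]
  funext z
  simp only [ReductiveGroup.gaugeAct]
  rw [vderiv_ham_H0of hg, Pi.zero_apply, zero_mul, sub_zero]
  rfl

end Parabolic

/-! ### The embedding of `P_S` and the equivalence of action groupoids. -/

section Morita

variable {G : ReductiveGroup n} {S : Mat n} {p q : ℕ} {P : GL (Fin n) ℂ} {d : Fin n → ℂ}

/-- Polynomials in `f` are determined by their value at `(1, 0)`, so multiplicativity is inherited
from `P_S`. The two recorded properties characterize the image of each `h` and are used for full
faithfulness. -/
theorem exists_parabolicEmbedding (hS : Diagonalizes P d S) (hp : 0 < p) (hq : 0 < q)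
    (hcop : Nat.Coprime p q) (hSg : S ∈ G.lieAlgebra) :
    ∃ j : G.ParabolicEmbedding S p q, ∀ h : G.pS S p q,
      (fun z => ((j.toHom h : ℂ × ℂ → GL (Fin n) ℂ) z : Mat n)) ∈ H0of S p q ⊤ ∧
        (j.toHom h : ℂ × ℂ → GL (Fin n) ℂ) (1, 0) = h := by
  choose g hg hval using fun h : G.pS S p q => exists_aut_of_mem_pS hS hp hq hSg h.2
  let φ : G.pS S p q →* G.aut S p q := MonoidHom.mk' g fun h h' =>
    aut_ext hS hp hq (hg (h * h')) (mul_mem_H0of (hg h) (hg h')) <| by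
      rw [hval]
      change _ = (g h : ℂ × ℂ → GL (Fin n) ℂ) (1, 0) * (g h' : ℂ × ℂ → GL (Fin n) ℂ) (1, 0)
      rw [hval, hval]; rfl
  refine ⟨⟨φ, fun h => ?_, fun h γ => ?_⟩, fun h => ⟨hg h, hval h⟩⟩
  · obtain ⟨ψ, h1, h2, h3⟩ := exists_line hp hq (hg h)
    exact ⟨ψ, h1, h2.trans (hval h), h3⟩
  · refine gaugeAct_mem_H1 hS hp hq hcop hSg (hg h) ?_ γ
    have : (g h)⁻¹ = g h⁻¹ := (map_inv φ h).symm
    rw [this]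
    exact hg h⁻¹

/-- The relation `g * γ = γ'` becomes linear after multiplication by `g` on the right: `V(g) = g γ -
γ' g`. -/
theorem aut_mem_H0of_of_smul_eq (hS : Diagonalizes P d S) (hp : 0 < p) (hq : 0 < q)
    (hcop : Nat.Coprime p q) (hSg : S ∈ G.lieAlgebra) (hlarge : G.LargeEnough S p q)
    {g : G.aut S p q} {γ γ' : G.H1 S p q}
    (h : g • G.inclH1 S p q γ = G.inclH1 S p q γ') :
    (fun z => ((g : ℂ × ℂ → GL (Fin n) ℂ) z : Mat n)) ∈ H0of S p q ⊤ := by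
  refine mem_H0of_of_vderiv hS hp hq hcop (aut_mem_weightGL g.2) (γ := γ) (γ' := γ') (h := 0)
    (H1of_mono le_top γ.2) (H1of_mono le_top γ'.2) (Submodule.zero_mem _)
    (U1_le_orderGE hS hp hq hcop hSg hlarge (G.H1_le S p q γ.2))
    (U1_le_orderGE hS hp hq hcop hSg hlarge (G.H1_le S p q γ'.2)) ?_
  have h1 : ReductiveGroup.gaugeAct p q g (γ : MatFun n) = γ' := congrArg Subtype.val h
  funext z
  simp only [← h1, Pi.add_apply, Pi.sub_apply, Pi.mul_apply, Pi.zero_apply,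
    ReductiveGroup.gaugeAct, sub_mul, mul_assoc, Units.inv_mul, mul_one]
  abel

open CategoryTheory in
theorem inclusion_isEquivalence (hS : Diagonalizes P d S) (hp : 0 < p) (hq : 0 < q)
    (hcop : Nat.Coprime p q) (hSg : S ∈ G.lieAlgebra) (hlarge : G.LargeEnough S p q)
    (j : G.ParabolicEmbedding S p q)
    (hj : ∀ h : G.pS S p q,
      (fun z => ((j.toHom h : ℂ × ℂ → GL (Fin n) ℂ) z : Mat n)) ∈ H0of S p q ⊤ ∧
        (j.toHom h : ℂ × ℂ → GL (Fin n) ℂ) (1, 0) = h) : j.inclusion.IsEquivalence where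
  faithful := ⟨fun {x y} a b hab => by
    have h1 : j.toHom a.1 = j.toHom b.1 := congrArg Subtype.val hab
    refine Subtype.ext (Subtype.ext (((hj a.1).2.symm.trans ?_).trans (hj b.1).2))
    rw [h1]⟩
  full := ⟨fun {x y} f => by
    have hf : (show G.aut S p q from f.1) • j.toU1 x.back = j.toU1 y.back := f.2
    have hmem := aut_mem_H0of_of_smul_eq hS hp hq hcop hSg hlarge hf
    -- The arrow is a polynomial in `f`, so its value at `(1, 0)` lies in `P_S` and determines it.
    let h : G.pS S p q := ⟨_, value_mem_pS hS hp hq hmem⟩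
    have hh : j.toHom h = f.1 := aut_ext hS hp hq (hj h).1 hmem (hj h).2
    refine ⟨⟨h, j.toU1_injective ?_⟩, Subtype.ext hh⟩
    exact (congrArg (fun g : G.aut S p q => g • j.toU1 x.back) hh).trans hf⟩
  essSurj := ⟨fun η => by
    obtain ⟨g, hg⟩ := exists_smul_mem_H1 hS hp hq hcop hSg hlarge η.back
    let γ : j.Rep := (⟨_, hg⟩ : G.H1 S p q)
    let f : η ⟶ j.inclusion.obj (γ : ActionCategory (G.pS S p q) j.Rep) := ⟨g, rfl⟩
    exact ⟨_, ⟨(Groupoid.isoEquivHom _ _).symm (Groupoid.inv f)⟩⟩⟩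

end Morita

end PlaneCurve

theorem proposition4p7 {n : ℕ} (G : PlaneCurve.ReductiveGroup n) (p q : ℕ) (hp : 0 < p)
    (hpq : p < q) (hcop : Nat.Coprime p q) (S : Matrix (Fin n) (Fin n) ℂ)
    (hS : S ∈ G.lieAlgebra) (hSs : PlaneCurve.IsSemisimple S) (hlarge : G.LargeEnough S p q) :
    ∃ j : G.ParabolicEmbedding S p q, j.IsMoritaEquivalence ∧
      ∀ γ : G.H1 S p q,
        PlaneCurve.IsQuasiIso₂ (G.adH S p q γ) (G.twistedDiff S p q (G.inclH1 S p q γ))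
          (G.inclH0 S p q) (G.inclH1 S p q) (G.inclusion_comm S p q γ) := by
  obtain ⟨P, d, hd⟩ := hSs
  have hq := hp.trans hpq
  obtain ⟨j, hj⟩ := PlaneCurve.exists_parabolicEmbedding hd hp hq hcop hS
  exact ⟨j, ⟨PlaneCurve.inclusion_isEquivalence hd hp hq hcop hS hlarge j hj,
    PlaneCurve.submersive hd hp hq hcop hS hlarge⟩,
    PlaneCurve.quasiIso hd hp hq hcop hS hlarge⟩
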